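/- Let $0\le\alpha\le 1$. For a function $\theta$ on $\mathbb{R}^2\cong\mathbb{C}$, let $v[\theta]$ be its velocity given by the $\alpha$-Biot–Savart law $$v[\theta](x)=C_\alpha\,\mathrm{p.v.}\!\int_{\mathbb{R}^2}\frac{(x-y)^\perp}{|x-y|^{2+\alpha}}\,\theta(y)\,dy,\qquad C_\alpha=\frac{2^\alpha}{2\pi}\,\frac{\Gamma(1+\frac{\alpha}{2})}{\Gamma(1-\frac{\alpha}{2})},\qquad x^\perp=(-x_2,x_1),$$ extended complex-linearly to complex-valued $\theta$ (the principal value is needed only for $\alpha=1$). For a real-valued function $\bar\Theta$ let $$L_{0}W=-v[\bar\Theta]\cdot\nabla W-v[W]\cdot\nabla\bar\Theta$$ be the linearization around $\bar\Theta$ of the unforced $\alpha$-SQG equation $\partial_t\theta+v[\theta]\cdot\nabla\theta=0$ (original coordinates, $b=0$). **Theorem.** For every $0\le\alpha\le1$ and every integer $n\ge2$ there is a real-valued radial function $\bar\Theta\in C_c^\infty(\mathbb{R}^2)$ with zero mean, $\int_0^\infty\bar\Theta(R)R\,dR=0$, which is linearly unstable with a smooth, compactly supported, purely $n$-fold symmetric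 eigenfunction: there exist $\lambda\in\mathbb{C}$ with $\Re\lambda>0$ and a complex-valued $W\in C_c^\infty(\mathbb{R}^2)$, $W\neq0$, of the form $W(Re^{i\phi})=W_n(R)e^{in\phi}$, such that the velocities $v[\bar\Theta]$ and $v[W]$ exist at every point and $$L_{0}W=\lambda W\quad\text{on }\mathbb{R}^2 .$$ -/

import Mathlib

open Complex Set Filter Topology MeasureTheory
open scoped ContDiff

namespace AlphaSQG

/-! The plane is identified with `ℂ` (with its Lebesgue measure and Euclidean norm), so that
`X = R e^{iφ}` and `x^⊥ = i x = (-x₂, x₁)`. Temperatures are complex-valued, and the velocity of a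
complex-valued temperature is the complex-linear extension of the real law; it is a pair of complex
numbers, indexed by `Fin 2`. -/

/-- The constant `C_α = (2^α / 2π) Γ(1 + α/2) / Γ(1 - α/2)`. -/
noncomputable def bsConst (α : ℝ) : ℝ :=
  (2 : ℝ) ^ α / (2 * Real.pi) * (Real.Gamma (1 + α / 2) / Real.Gamma (1 - α / 2))

/-- The kernel `x^⊥ / |x|^{2+α}`, as a pair `(-x₂, x₁) / |x|^{2+α}`. -/
noncomputable def bsKernel (α : ℝ) (x : ℂ) : Fin 2 → ℝ :=
  ![-x.im / ‖x‖ ^ (2 + α), x.re / ‖x‖ ^ (2 + α)]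

/-- The `j`-th component of the `α`-Biot-Savart integral at `x`, with the ball of radius `ε` around
the singularity removed. -/
noncomputable def truncatedVelocity (α : ℝ) (θ : ℂ → ℂ) (ε : ℝ) (x : ℂ) (j : Fin 2) : ℂ :=
  (bsConst α : ℂ) * ∫ y in {y : ℂ | ε < ‖x - y‖}, (bsKernel α (x - y) j : ℂ) * θ y

/-- `V` is the velocity of `θ` given by the `α`-Biot-Savart law
`V(x) = C_α ∫ (x-y)^⊥ / |x-y|^{2+α} θ(y) dy` at every point. The integral is taken in the sense of
principal values, as is needed when `α = 1`; for `α < 1` and `θ` bounded and integrable it is the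
ordinary absolutely convergent integral. -/
def IsVelocity (α : ℝ) (θ : ℂ → ℂ) (V : ℂ → Fin 2 → ℂ) : Prop :=
  ∀ (x : ℂ) (j : Fin 2),
    Tendsto (fun ε : ℝ => truncatedVelocity α θ ε x j) (𝓝[>] 0) (𝓝 (V x j))

/-- The velocity of `θ`: the principal value of the `α`-Biot-Savart integral. It is meaningful when
the limit exists, i.e. when `IsVelocity α θ (velocity α θ)`. -/
noncomputable def velocity (α : ℝ) (θ : ℂ → ℂ) (x : ℂ) (j : Fin 2) : ℂ :=
  limUnder (𝓝[>] (0 : ℝ)) (fun ε : ℝ => truncatedVelocity α θ ε x j)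

/-- `(V · ∇) f = V₁ ∂₁ f + V₂ ∂₂ f`. -/
noncomputable def advect (V : ℂ → Fin 2 → ℂ) (f : ℂ → ℂ) (X : ℂ) : ℂ :=
  V X 0 * fderiv ℝ f X 1 + V X 1 * fderiv ℝ f X I

/-- The linearization `L_0 W = -V̄ · ∇W - V · ∇Θ̄` of the unforced `α`-SQG equation
`∂_t θ + v · ∇θ = 0` around the steady temperature `Θ̄`, where `V̄` and `V` are the velocities of
`Θ̄` and `W`. -/
noncomputable def linearization (α : ℝ) (Θ : ℂ → ℝ) (W : ℂ → ℂ) (X : ℂ) : ℂ :=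
  -advect (velocity α (fun Y => (Θ Y : ℂ))) W X
    - advect (velocity α W) (fun Y => (Θ Y : ℂ)) X

/-- `U_0`: the radial functions (vortices) in `L²(ℝ²)` with zero mean,
`∫_0^∞ Θ̄(R) R dR = 0`. -/
def vortexSpace : Set (ℂ → ℝ) :=
  {Θ | MemLp Θ 2 volume ∧
    (∀ X Y : ℂ, ‖X‖ = ‖Y‖ → Θ X = Θ Y) ∧
    IntegrableOn (fun R : ℝ => Θ (R : ℂ) * R) (Ioi 0) ∧
    ∫ R in Ioi (0 : ℝ), Θ (R : ℂ) * R = 0}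

/-- `U_n`: the purely `n`-fold symmetric functions `W(R e^{iφ}) = W_n(R) e^{inφ}` in `L²(ℝ²)`. -/
def pureSymmetric (n : ℤ) : Set (ℂ → ℂ) :=
  {W | MemLp W 2 volume ∧
    ∃ w : ℝ → ℂ, ∀ R : ℝ, 0 < R → ∀ φ : ℝ,
      W ((R : ℂ) * exp (I * φ)) = w R * exp (I * n * φ)}

/-- `C_c^∞`, for functions on the plane with values in a real normed space. -/
def IsTestFunction {F : Type*} [NormedAddCommGroup F] [NormedSpace ℝ F] (f : ℂ → F) : Prop :=
  ContDiff ℝ ∞ f ∧ HasCompactSupport f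

/-- `W` is a nonzero element of `U_n` with `L_0 W = λ W` and `Re λ > 0`; that the velocities of
`Θ̄` and `W` exist at every point is part of the definition. -/
def IsUnstableMode (α : ℝ) (Θ : ℂ → ℝ) (n : ℤ) (lam : ℂ) (W : ℂ → ℂ) : Prop :=
  W ∈ pureSymmetric n ∧ W ≠ 0 ∧ 0 < lam.re ∧
    IsVelocity α (fun Y => (Θ Y : ℂ)) (velocity α (fun Y => (Θ Y : ℂ))) ∧
    IsVelocity α W (velocity α W) ∧
    ∀ X : ℂ, linearization α Θ W X = lam * W X

end AlphaSQG

/-! Write s = 1 + α/2 and use the logarithmic radius t = log R. For a vortex with Θ' = -γ(log R) R⁻³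
and a perturbation W = f(log R) R⁻³ e^{inφ}, the equation L₀W = λW with λ = -i n C_α c becomes the
scalar problem (Ω - c) f = γ ∫ K_n(·, y) f(y) dy, with Ω = ∫ K_1(·, y) γ(y) dy. Here K_m(x, y) =
e^{-s(x+y)} κ_m(x - y), and κ_m is the angular integral `angKer`. Mode 1 enters Ω because the
rotation speed of a vortex, after an integration by parts, is an integral of its gradient. Zero mean
of the vortex is ∫ γ = 0. An unstable mode is a solution with Im c > 0.

Take γ = η₁ - η₂, two thin bumps of unit mass at t₁ < t₂, and f = γh. If h were constant on each
bump, the problem would be the 2×2 matrix with diagonal g₁ - m, m - g₂ and off-diagonal entries k,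
-k, where g_j is the value of K_1 - K_n at (t_j, t_j), m = K_1(t₁, t₂) and k = K_n(t₁, t₂) > 0. The
gap K_1 - K_n is continuous on the diagonal although K_1 and K_n may be singular there. When the
diagonal entries agree, with common value a, the eigenvalues are a ± ik. This resonance reads κ_1(τ)
= G(0) cosh(sτ), with τ = t₂ - t₁ and G = κ_1 - κ_n; the intermediate value theorem gives τ > 0,
because κ_n is positive near 0 and κ_1 decays at infinity (`exists_resonance`).

The passage to genuine bumps needs no uniform bound on the singular diagonal blocks. In L² of the
measure (η₁ + η₂) dt these blocks are self-adjoint, so the resolvent is bounded in the upper half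
plane, and the indicators of the bumps are approximate eigenvectors for a. The skew rank-two
coupling then produces an eigenvalue near a + ik through the zero of a 2×2 determinant
(`exists_eigenvector_of_coupling`, `exists_mode_of_two_pieces`).

Since Ω - c never vanishes, the eigenfunction solves f = q (κ ⋆ f) with q smooth and κ integrable,
and is therefore smooth (`exists_smooth_of_eq_mul_conv`). The dictionary between the plane and the
radial problem is computed with the kernel x^⊥ (|x|² + δ)^{-s}, for which Fubini and integration by
parts are harmless; it yields the principal value as δ → 0 (`tendsto_regKernel`). -/

namespace AlphaSQG

/-! ### Angular kernels: bounds and continuity -/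

/-- The squared distance `|e^{t} - e^{t'+iβ}|² / e^{t+t'}` for `τ = t - t'`. -/
noncomputable def angDen (τ β : ℝ) : ℝ := 2 * Real.cosh τ - 2 * Real.cos β

/-- The angular weight `sin β sin (mβ) / m`. -/
noncomputable def angWeight (m : ℕ) (β : ℝ) : ℝ := Real.sin β * (Real.sin (m * β) / m)

/-- The Biot-Savart kernel of the `m`-th angular mode in logarithmic radial coordinates. -/
noncomputable def angKer (s : ℝ) (m : ℕ) (τ : ℝ) : ℝ :=
  ∫ β in Ioo (-Real.pi) Real.pi, angWeight m β * angDen τ β ^ (-s)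

/-- The difference of the kernels of the first and the `n`-th mode. -/
noncomputable def angGap (s : ℝ) (n : ℕ) (τ : ℝ) : ℝ :=
  ∫ β in Ioo (-Real.pi) Real.pi, (angWeight 1 β - angWeight n β) * angDen τ β ^ (-s)

lemma abs_sin_nat_mul_le (m : ℕ) (β : ℝ) : |Real.sin (m * β)| ≤ m * |Real.sin β| := by
  induction m with
  | zero => simp
  | succ k ih =>
    have h : ((k + 1 : ℕ) : ℝ) * β = k * β + β := by push_cast; ring
    rw [h, Real.sin_add]
    have h1 := Real.abs_cos_le_one β
    have h2 := Real.abs_cos_le_one (k * β)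
    calc _ ≤ |Real.sin (k * β)| * |Real.cos β| + |Real.cos (k * β)| * |Real.sin β| := by
          rw [← abs_mul, ← abs_mul]; exact abs_add_le _ _
      _ ≤ |Real.sin (k * β)| * 1 + 1 * |Real.sin β| := by gcongr
      _ ≤ _ := by push_cast; linarith

lemma abs_sin_nat_mul_div_le (m : ℕ) (β : ℝ) : |Real.sin (m * β) / m| ≤ |Real.sin β| := by
  rcases Nat.eq_zero_or_pos m with rfl | hm
  · simp
  · have : (0 : ℝ) < m := by exact_mod_cast hm
    rw [abs_div, abs_of_pos this, div_le_iff₀ this, mul_comm |_|]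
    exact abs_sin_nat_mul_le m β

lemma abs_angWeight_le (m : ℕ) (β : ℝ) : |angWeight m β| ≤ Real.sin β ^ 2 := by
  rw [angWeight, abs_mul, ← sq_abs, sq]
  exact mul_le_mul_of_nonneg_left (abs_sin_nat_mul_div_le m β) (abs_nonneg _)

lemma angWeight_one (β : ℝ) : angWeight 1 β = Real.sin β ^ 2 := by
  simp [angWeight, sq]

lemma angWeight_le_one (n : ℕ) (β : ℝ) : angWeight n β ≤ angWeight 1 β := by
  rw [angWeight_one]; exact (le_abs_self _).trans (abs_angWeight_le n β)

lemma continuous_angWeight (m : ℕ) : Continuous (angWeight m) := by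
  unfold angWeight; fun_prop

/-- Both weights are β² + O(β⁴), by the cubic Taylor bound for sin, so their difference is quartic.
Against a singularity |β|^{-2s} with 2s ≤ 3 this is what makes the gap kernel bounded. -/
lemma abs_angWeight_sub_le {n : ℕ} (hn : 1 ≤ n) (β : ℝ) :
    |angWeight 1 β - angWeight n β| ≤ n ^ 2 * β ^ 4 := by
  have hn0 : (1 : ℝ) ≤ n := by exact_mod_cast hn
  have h0 : angWeight 1 β - angWeight n β =
      Real.sin β * ((n * β - Real.sin (n * β)) / n - (β - Real.sin β)) := by
    simp only [angWeight]; field_simp; simp; left; ring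
  have h1 := Real.abs_sub_sin_le β
  have h2 := Real.abs_sub_sin_le (n * β)
  have h3 : |(n * β - Real.sin (n * β)) / n| ≤ n ^ 2 * |β| ^ 3 / 6 := by
    rw [abs_div, abs_of_pos (by linarith : (0 : ℝ) < n), div_le_iff₀ (by linarith)]
    rw [abs_mul, abs_of_pos (by linarith : (0 : ℝ) < n)] at h2
    calc _ ≤ _ := h2
      _ = _ := by ring
  rw [h0, abs_mul]
  have h4 : |(n * β - Real.sin (n * β)) / n - (β - Real.sin β)| ≤ n ^ 2 * |β| ^ 3 := by
    refine (abs_sub _ _).trans ?_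
    have : |β| ^ 3 ≤ n ^ 2 * |β| ^ 3 := le_mul_of_one_le_left (by positivity) (by nlinarith)
    have : 0 ≤ |β| ^ 3 := by positivity
    linarith
  calc _ ≤ |β| * (n ^ 2 * |β| ^ 3) :=
        mul_le_mul Real.abs_sin_le_abs h4 (abs_nonneg _) (abs_nonneg _)
    _ = n ^ 2 * |β| ^ 4 := by ring
    _ = _ := by rw [Even.pow_abs (by decide)]

lemma sq_le_cosh (τ : ℝ) : τ ^ 2 ≤ 2 * Real.cosh τ - 2 := by
  have h := Real.cosh_sq (τ / 2)
  have h2 := Real.cosh_two_mul (τ / 2)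
  rw [show 2 * (τ / 2) = τ by ring] at h2
  have h3 : |τ / 2| ≤ |Real.sinh (τ / 2)| := by
    rw [Real.abs_sinh]
    exact Real.self_le_sinh_iff.2 (abs_nonneg _)
  have h4 := sq_le_sq.2 h3
  nlinarith

lemma angDen_ge (τ : ℝ) {β : ℝ} (hβ : |β| ≤ Real.pi) :
    τ ^ 2 + (2 * |β| / Real.pi) ^ 2 ≤ angDen τ β := by
  have h1 := sq_le_cosh τ
  have h2 := Real.cos_le_one_sub_mul_cos_sq hβ
  have : (2 * |β| / Real.pi) ^ 2 = 2 * (2 / Real.pi ^ 2 * β ^ 2) := by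
    rw [div_pow, mul_pow, sq_abs]; ring
  rw [this, angDen]; linarith

lemma angDen_nonneg (τ β : ℝ) : 0 ≤ angDen τ β := by
  have := Real.one_le_cosh τ
  have := Real.cos_le_one β
  unfold angDen; linarith

lemma angDen_pos_of_ne {τ : ℝ} (hτ : τ ≠ 0) (β : ℝ) : 0 < angDen τ β := by
  have := Real.one_lt_cosh.2 hτ
  have := Real.cos_le_one β
  unfold angDen; linarith

lemma angDen_pos_of_ne' (τ : ℝ) {β : ℝ} (hβ : |β| ≤ Real.pi) (h0 : β ≠ 0) : 0 < angDen τ β := by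
  have := angDen_ge τ hβ
  have : 0 < |β| := abs_pos.2 h0
  have := Real.pi_pos
  have : 0 < (2 * |β| / Real.pi) ^ 2 := by positivity
  nlinarith [sq_nonneg τ]

lemma angDen_neg (τ β : ℝ) : angDen (-τ) β = angDen τ β := by simp [angDen]

lemma angKer_neg (s : ℝ) (m : ℕ) (τ : ℝ) : angKer s m (-τ) = angKer s m τ := by
  simp [angKer, angDen_neg]

lemma continuous_angDen : Continuous fun p : ℝ × ℝ => angDen p.1 p.2 := by
  unfold angDen; fun_prop

lemma measurable_angDen_rpow (s : ℝ) : Measurable fun p : ℝ × ℝ => angDen p.1 p.2 ^ (-s) :=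
  continuous_angDen.measurable.pow_const _

lemma abs_le_of_mem_Ioo {a x : ℝ} (h : x ∈ Ioo (-a) a) : |x| ≤ a := abs_le.2 ⟨h.1.le, h.2.le⟩

/-- The integrable majorant of the angular integrands. -/
noncomputable def angBound (β : ℝ) : ℝ := Real.pi ^ 2 / 2 * (2 * |β| / Real.pi) ^ (-(1 / 2) : ℝ)

lemma integrableOn_abs_rpow (r : ℝ) : IntegrableOn (fun β : ℝ => |β| ^ (-(1 / 2) : ℝ))
    (Ioo (-r) r) := by
  have : LocallyIntegrable (fun β : ℝ => |β| ^ (-(1 / 2) : ℝ)) volume := by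
    refine locallyIntegrable_of_norm_le_rpow (C := 1) (α := 1 / 2) (by simp) (by norm_num) ?_ ?_
    · refine Eventually.of_forall fun x => ?_
      rw [Real.norm_of_nonneg (by positivity), one_mul, Real.norm_eq_abs]
    · exact (by fun_prop : Measurable fun β : ℝ => |β| ^ (-(1 / 2) : ℝ)).aestronglyMeasurable
  exact (this.integrableOn_isCompact isCompact_Icc).mono_set Ioo_subset_Icc_self

lemma integrableOn_angBound : IntegrableOn angBound (Ioo (-Real.pi) Real.pi) := by
  have : angBound = fun β => (Real.pi ^ 2 / 2 * (2 / Real.pi) ^ (-(1 / 2) : ℝ)) *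
      |β| ^ (-(1 / 2) : ℝ) := by
    ext β
    have := Real.pi_pos
    rw [angBound, show 2 * |β| / Real.pi = (2 / Real.pi) * |β| by ring,
      Real.mul_rpow (by positivity) (by positivity), mul_assoc]
  rw [this]
  exact (integrableOn_abs_rpow _).const_mul _

/-- Split D^{-s} = D^{-1/4} D^{-(s-1/4)}. The first factor is controlled by τ and gives |τ|^{-1/2};
the second is controlled by β and, multiplied by β², leaves |β|^{5/2-2s}, an exponent at least -1/2
as long as s ≤ 3/2. Both resulting singularities are integrable, uniformly up to the endpoint α = 1.
-/
lemma sin_sq_mul_rpow_le {s : ℝ} (h1 : 1 ≤ s) (h2 : s ≤ 3 / 2) {τ β : ℝ} (hτ : τ ≠ 0)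
    (hβ : |β| ≤ Real.pi) :
    Real.sin β ^ 2 * angDen τ β ^ (-s) ≤ angBound β * |τ| ^ (-(1 / 2) : ℝ) := by
  rcases eq_or_ne β 0 with rfl | hb
  · simp only [Real.sin_zero]
    rw [zero_pow two_ne_zero, zero_mul]
    have := Real.pi_pos
    unfold angBound; positivity
  have hpi := Real.pi_pos
  have hb' : 0 < |β| := abs_pos.2 hb
  have hτ' : 0 < |τ| := abs_pos.2 hτ
  set b := 2 * |β| / Real.pi with hbdef
  have hbpos : 0 < b := by positivity
  have hb2 : b ≤ 2 := by rw [hbdef, div_le_iff₀ hpi]; linarith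
  have hA := angDen_ge τ hβ
  rw [← hbdef] at hA
  have hAp := angDen_pos_of_ne hτ β
  have e1 : angDen τ β ^ (-s) = angDen τ β ^ (-(1 / 4) : ℝ) * angDen τ β ^ (-(s - 1 / 4)) := by
    rw [← Real.rpow_add hAp]; congr 1; ring
  have e2 : angDen τ β ^ (-(1 / 4) : ℝ) ≤ |τ| ^ (-(1 / 2) : ℝ) := by
    calc _ ≤ (|τ| ^ 2) ^ (-(1 / 4) : ℝ) := by
          apply Real.rpow_le_rpow_of_nonpos (by positivity) _ (by norm_num)
          rw [sq_abs]; nlinarith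
      _ = _ := by
          rw [← Real.rpow_natCast, ← Real.rpow_mul hτ'.le]; norm_num
  have e3 : angDen τ β ^ (-(s - 1 / 4)) ≤ b ^ (-(2 * s - 1 / 2)) := by
    calc _ ≤ (b ^ 2) ^ (-(s - 1 / 4)) := by
          apply Real.rpow_le_rpow_of_nonpos (by positivity) _ (by linarith)
          nlinarith
      _ = _ := by
          rw [← Real.rpow_natCast, ← Real.rpow_mul hbpos.le]; congr 1; push_cast; ring
  have e4 : Real.sin β ^ 2 ≤ Real.pi ^ 2 / 4 * b ^ (2 : ℝ) := by
    refine Real.sin_sq_le_sq.trans (le_of_eq ?_)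
    rw [Real.rpow_two, hbdef, div_pow, mul_pow, sq_abs]; field_simp; norm_num
  have e5 : b ^ (2 : ℝ) * b ^ (-(2 * s - 1 / 2)) ≤ 2 * b ^ (-(1 / 2) : ℝ) := by
    rw [← Real.rpow_add hbpos,
      show (2 : ℝ) + -(2 * s - 1 / 2) = (3 - 2 * s) + -(1 / 2) by ring, Real.rpow_add hbpos]
    gcongr
    calc b ^ (3 - 2 * s) ≤ 2 ^ (3 - 2 * s) := Real.rpow_le_rpow hbpos.le hb2 (by linarith)
      _ ≤ 2 ^ (1 : ℝ) := Real.rpow_le_rpow_of_exponent_le (by norm_num) (by linarith)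
      _ = 2 := by simp
  rw [e1]
  calc _ ≤ (Real.pi ^ 2 / 4 * b ^ (2 : ℝ)) *
        (|τ| ^ (-(1 / 2) : ℝ) * b ^ (-(2 * s - 1 / 2))) := by
        gcongr
    _ = Real.pi ^ 2 / 4 * (b ^ (2 : ℝ) * b ^ (-(2 * s - 1 / 2))) * |τ| ^ (-(1 / 2) : ℝ) := by ring
    _ ≤ Real.pi ^ 2 / 4 * (2 * b ^ (-(1 / 2) : ℝ)) * |τ| ^ (-(1 / 2) : ℝ) := by gcongr
    _ = _ := by rw [angBound, ← hbdef]; ring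

lemma abs_angWeight_mul_le {s : ℝ} (h1 : 1 ≤ s) (h2 : s ≤ 3 / 2) (m : ℕ) {τ β : ℝ} (hτ : τ ≠ 0)
    (hβ : |β| ≤ Real.pi) :
    |angWeight m β * angDen τ β ^ (-s)| ≤ angBound β * |τ| ^ (-(1 / 2) : ℝ) := by
  refine le_trans ?_ (sin_sq_mul_rpow_le h1 h2 hτ hβ)
  rw [abs_mul, abs_of_nonneg (Real.rpow_nonneg (angDen_nonneg _ _) _)]
  gcongr
  · exact Real.rpow_nonneg (angDen_nonneg _ _) _
  · exact abs_angWeight_le m β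

lemma aestronglyMeasurable_angInt (s : ℝ) (m : ℕ) (τ : ℝ) (μ : Measure ℝ) :
    AEStronglyMeasurable (fun β => angWeight m β * angDen τ β ^ (-s)) μ := by
  have h : Continuous fun β => angDen τ β := by unfold angDen; fun_prop
  exact ((continuous_angWeight m).measurable.mul (h.measurable.pow_const _)).aestronglyMeasurable

lemma integrableOn_angInt {s : ℝ} (h1 : 1 ≤ s) (h2 : s ≤ 3 / 2) (m : ℕ) {τ : ℝ} (hτ : τ ≠ 0) :
    IntegrableOn (fun β => angWeight m β * angDen τ β ^ (-s)) (Ioo (-Real.pi) Real.pi) := by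
  refine Integrable.mono' (integrableOn_angBound.mul_const (|τ| ^ (-(1 / 2) : ℝ)))
    (aestronglyMeasurable_angInt s m τ _) ?_
  filter_upwards [ae_restrict_mem measurableSet_Ioo] with β hβ
  exact abs_angWeight_mul_le h1 h2 m hτ (abs_le_of_mem_Ioo hβ)

/-- The constant in the bound `|κ_m(τ)| ≤ C |τ|^{-1/2}`. -/
noncomputable def angConst : ℝ := ∫ β in Ioo (-Real.pi) Real.pi, angBound β

lemma abs_angKer_le {s : ℝ} (h1 : 1 ≤ s) (h2 : s ≤ 3 / 2) (m : ℕ) {τ : ℝ} (hτ : τ ≠ 0) :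
    |angKer s m τ| ≤ angConst * |τ| ^ (-(1 / 2) : ℝ) := by
  rw [angKer, angConst, ← integral_mul_const]
  refine norm_integral_le_of_norm_le (f := fun β => angWeight m β * angDen τ β ^ (-s))
    (integrableOn_angBound.mul_const _) ?_
  filter_upwards [ae_restrict_mem measurableSet_Ioo] with β hβ
  exact abs_angWeight_mul_le h1 h2 m hτ (abs_le_of_mem_Ioo hβ)

lemma measurable_angKer (s : ℝ) (m : ℕ) : Measurable (angKer s m) := by
  unfold angKer
  refine StronglyMeasurable.measurable (StronglyMeasurable.integral_prod_right
    (f := fun τ β => angWeight m β * angDen τ β ^ (-s)) ?_)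
  exact (((continuous_angWeight m).measurable.comp measurable_snd).mul
    (measurable_angDen_rpow s)).stronglyMeasurable

lemma continuousAt_angKer {s : ℝ} (h1 : 1 ≤ s) (h2 : s ≤ 3 / 2) (m : ℕ) {τ : ℝ} (hτ : τ ≠ 0) :
    ContinuousAt (angKer s m) τ := by
  have hpos : 0 < |τ| := abs_pos.2 hτ
  have hev : ∀ᶠ x in 𝓝 τ, |τ| / 2 < |x| :=
    (continuous_abs.tendsto τ).eventually (lt_mem_nhds (by linarith))
  refine continuousAt_of_dominated (F := fun τ β => angWeight m β * angDen τ β ^ (-s))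
    (bound := fun β => angBound β * (|τ| / 2) ^ (-(1 / 2) : ℝ))
    (Eventually.of_forall fun x => aestronglyMeasurable_angInt s m x _) ?_
    (integrableOn_angBound.mul_const _) ?_
  · filter_upwards [hev] with x hx
    filter_upwards [ae_restrict_mem measurableSet_Ioo] with β hβ
    have hx0 : x ≠ 0 := abs_pos.1 (by linarith)
    refine (abs_angWeight_mul_le h1 h2 m hx0 (abs_le_of_mem_Ioo hβ)).trans ?_
    have := Real.pi_pos
    refine mul_le_mul_of_nonneg_left ?_ (by unfold angBound; positivity)
    exact Real.rpow_le_rpow_of_nonpos (by positivity) hx.le (by norm_num)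
  · refine Eventually.of_forall fun β => ?_
    refine continuousAt_const.mul (ContinuousAt.rpow_const ?_ (Or.inl (angDen_pos_of_ne hτ β).ne'))
    exact (continuous_angDen.comp (continuous_id.prodMk continuous_const)).continuousAt

lemma locallyIntegrable_angKer {s : ℝ} (h1 : 1 ≤ s) (h2 : s ≤ 3 / 2) (m : ℕ) :
    LocallyIntegrable (angKer s m) volume := by
  refine locallyIntegrable_of_norm_le_rpow (C := angConst) (α := 1 / 2) (by simp) (by norm_num) ?_
    (measurable_angKer s m).aestronglyMeasurable
  have : ∀ᵐ x : ℝ, x ≠ 0 := by simp [ae_iff]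
  filter_upwards [this] with x hx
  exact abs_angKer_le h1 h2 m hx

lemma angKer_one_sub {s : ℝ} (h1 : 1 ≤ s) (h2 : s ≤ 3 / 2) (n : ℕ) {τ : ℝ} (hτ : τ ≠ 0) :
    angGap s n τ = angKer s 1 τ - angKer s n τ := by
  rw [angGap, angKer, angKer,
    ← integral_sub (integrableOn_angInt h1 h2 1 hτ) (integrableOn_angInt h1 h2 n hτ)]
  simp only [sub_mul]

/-- The quartic bound on the weights absorbs |β|^{-2s}. The estimate includes τ = 0, unlike the one
for a single kernel, and so gives continuity of the gap across the diagonal by dominated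
convergence. -/
lemma abs_angGapInt_le {s : ℝ} (h1 : 1 ≤ s) (h2 : s ≤ 3 / 2) {n : ℕ} (hn : 1 ≤ n) (τ : ℝ) {β : ℝ}
    (hβ : |β| ≤ Real.pi) :
    |(angWeight 1 β - angWeight n β) * angDen τ β ^ (-s)| ≤ 2 * (n ^ 2 * Real.pi ^ 4) := by
  rcases eq_or_ne β 0 with rfl | hb
  · simp only [angWeight]; simp; positivity
  have hpi := Real.pi_pos
  have hb' : 0 < |β| := abs_pos.2 hb
  set b := 2 * |β| / Real.pi with hbdef
  have hbpos : 0 < b := by positivity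
  have hb2 : b ≤ 2 := by rw [hbdef, div_le_iff₀ hpi]; linarith
  have hA := angDen_ge τ hβ
  rw [← hbdef] at hA
  have e3 : angDen τ β ^ (-s) ≤ b ^ (-(2 * s)) := by
    calc _ ≤ (b ^ 2) ^ (-s) := by
          apply Real.rpow_le_rpow_of_nonpos (by positivity) _ (by linarith)
          nlinarith [sq_nonneg τ]
      _ = _ := by
          rw [← Real.rpow_natCast, ← Real.rpow_mul hbpos.le]; congr 1; push_cast; ring
  have e4 : |angWeight 1 β - angWeight n β| ≤ n ^ 2 * (Real.pi ^ 4 / 16 * b ^ (4 : ℝ)) := by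
    refine (abs_angWeight_sub_le hn β).trans (le_of_eq ?_)
    rw [show (4 : ℝ) = ((4 : ℕ) : ℝ) by norm_num, Real.rpow_natCast, hbdef, div_pow, mul_pow,
      Even.pow_abs (by decide)]
    field_simp; norm_num
  have e5 : b ^ (4 : ℝ) * b ^ (-(2 * s)) ≤ 4 := by
    rw [← Real.rpow_add hbpos]
    calc b ^ (4 + -(2 * s)) ≤ 2 ^ (4 + -(2 * s)) := Real.rpow_le_rpow hbpos.le hb2 (by linarith)
      _ ≤ 2 ^ (2 : ℝ) := Real.rpow_le_rpow_of_exponent_le (by norm_num) (by linarith)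
      _ = 4 := by norm_num
  rw [abs_mul, abs_of_nonneg (Real.rpow_nonneg (angDen_nonneg _ _) _)]
  calc _ ≤ (n ^ 2 * (Real.pi ^ 4 / 16 * b ^ (4 : ℝ))) * b ^ (-(2 * s)) := by
        gcongr
        exact Real.rpow_nonneg (angDen_nonneg _ _) _
    _ = n ^ 2 * (Real.pi ^ 4 / 16) * (b ^ (4 : ℝ) * b ^ (-(2 * s))) := by ring
    _ ≤ n ^ 2 * (Real.pi ^ 4 / 16) * 4 := by gcongr
    _ ≤ _ := by nlinarith [show (0 : ℝ) ≤ n ^ 2 * Real.pi ^ 4 by positivity]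

lemma continuous_angGap {s : ℝ} (h1 : 1 ≤ s) (h2 : s ≤ 3 / 2) {n : ℕ} (hn : 1 ≤ n) :
    Continuous (angGap s n) := by
  refine continuous_of_dominated (bound := fun _ => 2 * (n ^ 2 * Real.pi ^ 4)) ?_ ?_ ?_ ?_
  · intro τ
    simp only [sub_mul]
    exact (aestronglyMeasurable_angInt s 1 τ _).sub (aestronglyMeasurable_angInt s n τ _)
  · intro τ
    filter_upwards [ae_restrict_mem measurableSet_Ioo] with β hβ
    exact abs_angGapInt_le h1 h2 hn τ (abs_le_of_mem_Ioo hβ)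
  · exact integrableOn_const (by simp)
  · have : ∀ᵐ x : ℝ ∂(volume.restrict (Ioo (-Real.pi) Real.pi)), x ≠ 0 :=
      ae_restrict_of_ae (by simp [ae_iff])
    filter_upwards [this, ae_restrict_mem measurableSet_Ioo] with β hb hβ
    refine continuous_const.mul (Continuous.rpow_const ?_ fun τ =>
      Or.inl (angDen_pos_of_ne' τ (abs_le_of_mem_Ioo hβ) hb).ne')
    exact continuous_angDen.comp (continuous_id.prodMk continuous_const)

/-! ### Positivity of the angular kernels -/

/-- The trigonometric moments `∫ sin β sin (mβ) cos^k β dβ`. -/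
noncomputable def sinMoment (m k : ℕ) : ℝ :=
  ∫ β in (-Real.pi)..Real.pi, Real.sin β * Real.sin (m * β) * Real.cos β ^ k

lemma sinMoment_zero_left (k : ℕ) : sinMoment 0 k = 0 := by simp [sinMoment]

/-- Product-to-sum: sin((m+1)β) cos β is the mean of sin((m+2)β) and sin(mβ). -/
lemma sinMoment_succ (m k : ℕ) :
    sinMoment (m + 1) (k + 1) = (sinMoment (m + 2) k + sinMoment m k) / 2 := by
  rw [sinMoment, sinMoment, sinMoment, ← intervalIntegral.integral_add
    (Continuous.intervalIntegrable (by fun_prop) _ _)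
    (Continuous.intervalIntegrable (by fun_prop) _ _), ← intervalIntegral.integral_div]
  congr 1
  ext β
  have h1 : ((m + 2 : ℕ) : ℝ) * β = (m + 1) * β + β := by push_cast; ring
  have h2 : (m : ℝ) * β = (m + 1) * β - β := by ring
  rw [h1, h2, Real.sin_add, Real.sin_sub, pow_succ]
  push_cast
  ring

lemma sinMoment_zero_right (m : ℕ) : 0 ≤ sinMoment m 0 := by
  rcases Nat.lt_trichotomy m 1 with h | rfl | h
  · rw [Nat.lt_one_iff.1 h, sinMoment_zero_left]
  · refine intervalIntegral.integral_nonneg (by linarith [Real.pi_pos]) fun β _ => ?_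
    simp only [Nat.cast_one, one_mul, pow_zero, mul_one]
    exact mul_self_nonneg _
  · have hm : (1 : ℝ) < m := by exact_mod_cast h
    have key : ∀ β, Real.sin β * Real.sin (m * β) * Real.cos β ^ 0 =
        (Real.cos ((m - 1) * β) - Real.cos ((m + 1) * β)) / 2 := by
      intro β
      rw [sub_mul, add_mul, one_mul, Real.cos_sub, Real.cos_add]; ring
    have hs1 : Real.sin ((m - 1) * Real.pi) = 0 := by
      have := Real.sin_int_mul_pi ((m : ℤ) - 1); push_cast at this; exact this
    have hs2 : Real.sin ((m + 1) * Real.pi) = 0 := by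
      have := Real.sin_int_mul_pi ((m : ℤ) + 1); push_cast at this; exact this
    rw [sinMoment]
    simp_rw [key]
    rw [intervalIntegral.integral_div, intervalIntegral.integral_sub
      (Continuous.intervalIntegrable (by fun_prop) _ _)
      (Continuous.intervalIntegrable (by fun_prop) _ _),
      intervalIntegral.integral_comp_mul_left _ (by linarith : 0 < (m : ℝ) - 1).ne',
      intervalIntegral.integral_comp_mul_left _ (by positivity)]
    simp [hs1, hs2]

/-- The recursion has nonnegative coefficients and lowers the power of the cosine, down to the
orthogonality relations of the sines. -/
lemma sinMoment_nonneg (m k : ℕ) : 0 ≤ sinMoment m k := by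
  induction k generalizing m with
  | zero => exact sinMoment_zero_right m
  | succ k ih =>
    cases m with
    | zero => rw [sinMoment_zero_left]
    | succ m => rw [sinMoment_succ]; linarith [ih (m + 2), ih m]

/-- Following the second summand of the recursion lowers both indices until only ∫ sin² = π is left;
all other contributions are nonnegative. -/
lemma sinMoment_pos (m : ℕ) : 0 < sinMoment (m + 1) m := by
  induction m with
  | zero =>
    simp only [sinMoment, zero_add, Nat.cast_one, one_mul, pow_zero, mul_one, ← sq, integral_sin_sq]
    simp [Real.pi_pos]
  | succ m ih =>
    rw [sinMoment_succ]
    linarith [sinMoment_nonneg (m + 3) m]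

/-- The coefficients of the binomial series `(1 - x)^{-s} = ∑ c_k x^k`. -/
noncomputable def binomCoeff (s : ℝ) (k : ℕ) : ℝ := Ring.choose (s + k - 1) k

lemma binomCoeff_pos {s : ℝ} (hs : 0 < s) (k : ℕ) : 0 < binomCoeff s k := by
  rw [binomCoeff, ← Ring.multichoose_eq]
  have h := Ring.factorial_nsmul_multichoose_eq_ascPochhammer s k
  rw [Polynomial.ascPochhammer_smeval_eq_eval] at h
  have h2 := ascPochhammer_pos k s hs
  rw [← h, nsmul_eq_mul] at h2
  exact pos_of_mul_pos_right h2 (by positivity)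

lemma hasSum_binomCoeff (s : ℝ) {x : ℝ} (hx : |x| < 1) :
    HasSum (fun k => binomCoeff s k * x ^ k) ((1 - x) ^ (-s)) := by
  have h := (Real.one_div_one_sub_rpow_hasFPowerSeriesOnBall_zero s).hasSum
    (y := x) (by
      have : ‖x‖₊ < 1 := hx
      simpa [enorm_eq_nnnorm] using this)
  have hx' : 0 ≤ 1 - x := by linarith [(abs_lt.1 hx).2]
  simpa [FormalMultilinearSeries.ofScalars_apply_eq, Real.rpow_neg hx', binomCoeff, mul_comm]
    using h

/-- Factor D = 2 cosh τ (1 - cos β / cosh τ) and expand the power in a binomial series, which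
converges geometrically for τ ≠ 0. Every term is then a nonnegative moment with a positive
coefficient. -/
lemma hasSum_angKer {s : ℝ} (hs : 0 < s) (m : ℕ) {τ : ℝ} (hτ : τ ≠ 0) :
    HasSum (fun k => binomCoeff s k * (2 * Real.cosh τ) ^ (-s) * (Real.cosh τ)⁻¹ ^ k / m *
      sinMoment m k) (angKer s m τ) := by
  have hc := Real.one_lt_cosh.2 hτ
  have hc0 : 0 < Real.cosh τ := by linarith
  have hq : |(Real.cosh τ)⁻¹| < 1 := by
    rw [abs_of_pos (by positivity)]; exact inv_lt_one_of_one_lt₀ hc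
  set F : ℕ → ℝ → ℝ := fun k β => angWeight m β * ((2 * Real.cosh τ) ^ (-s) *
    (binomCoeff s k * ((Real.cosh τ)⁻¹ * Real.cos β) ^ k)) with hF
  have hcont : ∀ k, Continuous (F k) := fun k => by
    have := continuous_angWeight m
    simp only [hF]; fun_prop
  have hint : ∀ k, IntegrableOn (F k) (Ioo (-Real.pi) Real.pi) := fun k =>
    ((hcont k).integrableOn_Icc).mono_set Ioo_subset_Icc_self
  have hsum : ∀ β, HasSum (fun k => F k β) (angWeight m β * angDen τ β ^ (-s)) := by
    intro β
    have h1 : |(Real.cosh τ)⁻¹ * Real.cos β| < 1 := by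
      rw [abs_mul]
      calc _ ≤ |(Real.cosh τ)⁻¹| * 1 := by gcongr; exact Real.abs_cos_le_one β
        _ < 1 := by simpa using hq
    have h2 : angDen τ β ^ (-s) =
        (2 * Real.cosh τ) ^ (-s) * (1 - (Real.cosh τ)⁻¹ * Real.cos β) ^ (-s) := by
      rw [← Real.mul_rpow (by positivity) (by linarith [(abs_lt.1 h1).2])]
      congr 1
      rw [angDen]; field_simp
    rw [h2]
    exact ((hasSum_binomCoeff s h1).mul_left _).mul_left _
  have hbd : ∀ k β, ‖F k β‖ ≤ (2 * Real.cosh τ) ^ (-s) * (binomCoeff s k * (Real.cosh τ)⁻¹ ^ k) := by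
    intro k β
    have hb := binomCoeff_pos hs k
    rw [hF, Real.norm_eq_abs, abs_mul, abs_mul, abs_mul, abs_pow, abs_mul, abs_of_pos hb,
      abs_of_pos (show 0 < (2 * Real.cosh τ) ^ (-s) by positivity),
      abs_of_pos (show 0 < (Real.cosh τ)⁻¹ by positivity)]
    have h1 : |angWeight m β| ≤ 1 := (abs_angWeight_le m β).trans (Real.sin_sq_le_one β)
    calc _ ≤ 1 * ((2 * Real.cosh τ) ^ (-s) * (binomCoeff s k * ((Real.cosh τ)⁻¹ * 1) ^ k)) := by
          gcongr; exact Real.abs_cos_le_one β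
      _ = _ := by ring
  have hsummable : Summable fun k => ∫ β in Ioo (-Real.pi) Real.pi, ‖F k β‖ := by
    have h0 := ((hasSum_binomCoeff s hq).summable.mul_left ((2 * Real.cosh τ) ^ (-s))).mul_left
      (2 * Real.pi)
    refine Summable.of_nonneg_of_le (fun k => integral_nonneg fun β => norm_nonneg _)
      (fun k => ?_) h0
    have := norm_setIntegral_le_of_norm_le_const (μ := volume) (s := Ioo (-Real.pi) Real.pi)
      (f := fun β => ‖F k β‖) (by simp) (fun β _ => by simpa using hbd k β)
    refine (le_abs_self _).trans (this.trans (le_of_eq ?_))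
    simp only [measureReal_def, Real.volume_Ioo]
    rw [ENNReal.toReal_ofReal (by linarith [Real.pi_pos])]; ring
  have := hasSum_integral_of_summable_integral_norm hint hsummable
  have e1 : ∀ β, ∑' k, F k β = angWeight m β * angDen τ β ^ (-s) := fun β => (hsum β).tsum_eq
  have e2 : ∀ k, ∫ β in Ioo (-Real.pi) Real.pi, F k β =
      binomCoeff s k * (2 * Real.cosh τ) ^ (-s) * (Real.cosh τ)⁻¹ ^ k / m * sinMoment m k := by
    intro k
    rw [← integral_Ioc_eq_integral_Ioo, ← intervalIntegral.integral_of_le (by linarith [Real.pi_pos]),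
      sinMoment, ← intervalIntegral.integral_const_mul]
    congr 1
    ext β
    simp only [hF, angWeight, mul_pow]
    ring
  simp only [e1, e2] at this
  exact this

/-- A positive lower bound for the kernel `κ_n`. -/
noncomputable def angLower (s : ℝ) (n : ℕ) (τ : ℝ) : ℝ :=
  binomCoeff s (n - 1) * (2 * Real.cosh τ) ^ (-s) * (Real.cosh τ)⁻¹ ^ (n - 1) / n *
    sinMoment n (n - 1)

lemma angLower_pos {s : ℝ} (hs : 0 < s) {n : ℕ} (hn : 1 ≤ n) (τ : ℝ) : 0 < angLower s n τ := by
  obtain ⟨m, rfl⟩ : ∃ m, n = m + 1 := ⟨n - 1, by omega⟩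
  have := sinMoment_pos m
  have := binomCoeff_pos hs m
  have := Real.cosh_pos τ
  simp only [angLower, Nat.add_sub_cancel]
  positivity

lemma continuous_angLower (s : ℝ) (n : ℕ) : Continuous (angLower s n) := by
  unfold angLower
  have h : Continuous fun τ => (2 * Real.cosh τ) ^ (-s) :=
    Continuous.rpow_const (by fun_prop) fun τ => Or.inl (by have := Real.cosh_pos τ; positivity)
  have h2 : Continuous fun τ => (Real.cosh τ)⁻¹ :=
    Real.continuous_cosh.inv₀ fun τ => (Real.cosh_pos τ).ne'
  fun_prop

/-- Keep only the term k = n - 1 of a series of nonnegative terms. Unlike `angKer`, whose definition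
may be singular at τ = 0, this minorant is continuous and positive there. -/
lemma angLower_le_angKer {s : ℝ} (hs : 0 < s) (n : ℕ) {τ : ℝ} (hτ : τ ≠ 0) :
    angLower s n τ ≤ angKer s n τ := by
  refine le_hasSum (hasSum_angKer hs n hτ) (n - 1) fun k _ => ?_
  have := sinMoment_nonneg n k
  have := binomCoeff_pos hs k
  have := Real.cosh_pos τ
  positivity

lemma angKer_pos {s : ℝ} (hs : 0 < s) {n : ℕ} (hn : 1 ≤ n) {τ : ℝ} (hτ : τ ≠ 0) :
    0 < angKer s n τ := (angLower_pos hs hn τ).trans_le (angLower_le_angKer hs n hτ)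

/-! ### Resonance of two thin annuli -/

/-- The integrand is nonnegative since |sin(nβ)| ≤ n |sin β|, and strictly positive on (π/n, 2π/n),
where sin β > 0 > sin(nβ). -/
lemma angGap_zero_pos {s : ℝ} (h1 : 1 ≤ s) (h2 : s ≤ 3 / 2) {n : ℕ} (hn : 2 ≤ n) :
    0 < angGap s n 0 := by
  have hn0 : (0 : ℝ) < n := by positivity
  have hpi := Real.pi_pos
  have hint : IntegrableOn (fun β => (angWeight 1 β - angWeight n β) * angDen 0 β ^ (-s))
      (Ioo (-Real.pi) Real.pi) := by
    refine Integrable.mono' (g := fun _ => 2 * (n ^ 2 * Real.pi ^ 4))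
      (integrableOn_const (by simp)) ?_ ?_
    · simp only [sub_mul]
      exact (aestronglyMeasurable_angInt s 1 0 _).sub (aestronglyMeasurable_angInt s n 0 _)
    · filter_upwards [ae_restrict_mem measurableSet_Ioo] with β hβ
      exact abs_angGapInt_le h1 h2 (by omega) 0 (abs_le_of_mem_Ioo hβ)
  rw [angGap, setIntegral_pos_iff_support_of_nonneg_ae _ hint]
  · have hsub : Ioo (Real.pi / n) (2 * Real.pi / n) ⊆ (Function.support fun β =>
        (angWeight 1 β - angWeight n β) * angDen 0 β ^ (-s)) ∩ Ioo (-Real.pi) Real.pi := by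
      intro β hβ
      have hβ0 : 0 < β := lt_trans (by positivity) hβ.1
      have hn2 : (2 : ℝ) ≤ n := by exact_mod_cast hn
      have hβpi : β < Real.pi := by
        refine hβ.2.trans_le ?_
        rw [div_le_iff₀ hn0]; nlinarith
      refine ⟨?_, by linarith, hβpi⟩
      have hs1 := Real.sin_pos_of_pos_of_lt_pi hβ0 hβpi
      have hs2 : Real.sin (n * β) < 0 := by
        have h3 := (div_lt_iff₀ hn0).1 hβ.1
        have h4 := (lt_div_iff₀ hn0).1 hβ.2
        have := Real.sin_pos_of_pos_of_lt_pi (x := n * β - Real.pi) (by linarith) (by linarith)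
        rw [Real.sin_sub_pi] at this
        linarith
      have hD := angDen_pos_of_ne' 0 (β := β) (by rw [abs_of_pos hβ0]; exact hβpi.le) hβ0.ne'
      have : angWeight n β < 0 := mul_neg_of_pos_of_neg hs1 (div_neg_of_neg_of_pos hs2 hn0)
      refine (mul_pos ?_ (Real.rpow_pos_of_pos hD _)).ne'
      rw [angWeight_one]; nlinarith
    refine lt_of_lt_of_le ?_ (measure_mono hsub)
    rw [Real.volume_Ioo, ENNReal.ofReal_pos, sub_pos]
    gcongr; linarith
  · refine Eventually.of_forall fun β => ?_
    exact mul_nonneg (sub_nonneg.2 (angWeight_le_one n β)) (Real.rpow_nonneg (angDen_nonneg _ _) _)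

/-- The resonance condition between two thin annuli. -/
lemma exists_resonance {s : ℝ} (h1 : 1 ≤ s) (h2 : s ≤ 3 / 2) {n : ℕ} (hn : 2 ≤ n) :
    ∃ τ : ℝ, 0 < τ ∧ angKer s 1 τ = angGap s n 0 * Real.cosh (s * τ) := by
  have hG := angGap_zero_pos h1 h2 hn
  have hcosh : Continuous fun τ => Real.cosh (s * τ) := by fun_prop
  have hcontG := continuous_angGap h1 h2 (n := n) (by omega)
  have hcontL := continuous_angLower s n
  have hL0 := angLower_pos (s := s) (by linarith) (n := n) (by omega) 0
  -- Near 0, κ_1 = G + κ_n exceeds G by at least the minorant, which is positive at 0, whereas G(0)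
  -- cosh(sτ) exceeds G(τ) only by a quantity tending to 0.
  obtain ⟨τ₁, hτ₁, hlt₁⟩ : ∃ τ : ℝ, 0 < τ ∧ angGap s n 0 * Real.cosh (s * τ) < angKer s 1 τ := by
    have hc : Continuous fun τ =>
        angGap s n τ + angLower s n τ - angGap s n 0 * Real.cosh (s * τ) := by fun_prop
    have h0 : 0 < angGap s n 0 + angLower s n 0 - angGap s n 0 * Real.cosh (s * 0) := by
      simpa using hL0
    have hev : ∀ᶠ τ in 𝓝[>] (0 : ℝ),
        0 < angGap s n τ + angLower s n τ - angGap s n 0 * Real.cosh (s * τ) :=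
      nhdsWithin_le_nhds (hc.continuousAt.eventually (lt_mem_nhds h0))
    obtain ⟨τ, hτ, hpos⟩ := (hev.and self_mem_nhdsWithin).exists
    have hpos' : 0 < τ := hpos
    refine ⟨τ, hpos', ?_⟩
    have e1 := angKer_one_sub h1 h2 n hpos'.ne'
    have e2 := angLower_le_angKer (s := s) (by linarith) n hpos'.ne'
    linarith
  -- For large τ the kernel is O(τ^{-1/2}), while the right-hand side is at least G(0) > 0.
  obtain ⟨τ₂, hτ₂, hlt₂⟩ : ∃ τ : ℝ, τ₁ < τ ∧ angKer s 1 τ < angGap s n 0 * Real.cosh (s * τ) := by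
    have ht : Tendsto (fun τ : ℝ => angConst * τ ^ (-(1 / 2) : ℝ)) atTop (𝓝 (angConst * 0)) :=
      (tendsto_rpow_neg_atTop (by norm_num)).const_mul _
    rw [mul_zero] at ht
    obtain ⟨τ, hτ, hgt⟩ := ((ht.eventually (gt_mem_nhds hG)).and (eventually_gt_atTop τ₁)).exists
    have hτ0 : 0 < τ := hτ₁.trans hgt
    refine ⟨τ, hgt, ?_⟩
    have e1 := (le_abs_self _).trans (abs_angKer_le h1 h2 1 hτ0.ne')
    rw [abs_of_pos hτ0] at e1
    calc _ ≤ _ := e1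
      _ < _ := hτ
      _ ≤ _ := le_mul_of_one_le_right hG.le (Real.one_le_cosh _)
  have hcont : ContinuousOn (fun τ => angKer s 1 τ - angGap s n 0 * Real.cosh (s * τ))
      (Icc τ₁ τ₂) := fun τ hτ =>
    ((continuousAt_angKer h1 h2 1 (hτ₁.trans_le hτ.1).ne').sub
      (continuous_const.mul hcosh).continuousAt).continuousWithinAt
  obtain ⟨τ, hτ, h⟩ := intermediate_value_Icc' hτ₂.le hcont
    (show (0 : ℝ) ∈ _ from ⟨by linarith, by linarith⟩)
  exact ⟨τ, hτ₁.trans_le hτ.1, by linarith⟩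

/-! ### Abstract perturbation: a skew coupling of two approximate eigenvectors -/

/-- A function that is smaller at the centre of a disc than on its boundary has a zero. -/
lemma exists_zero_of_small_center {f : ℂ → ℂ} {z₀ : ℂ} {r m : ℝ} (hr : 0 < r)
    (hf : DifferentiableOn ℂ f (Metric.closedBall z₀ r)) (h₀ : ‖f z₀‖ < m)
    (hs : ∀ z ∈ Metric.sphere z₀ r, m ≤ ‖f z‖) : ∃ z ∈ Metric.closedBall z₀ r, f z = 0 := by
  by_contra! hne
  have hm : 0 < m := (norm_nonneg _).trans_lt h₀
  -- Without a zero, 1/f would be holomorphic and larger at the centre than on the boundary, against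
  -- the maximum principle.
  have hd : DifferentiableOn ℂ (fun z => (f z)⁻¹) (Metric.closedBall z₀ r) :=
    hf.inv hne
  have hdc : DiffContOnCl ℂ (fun z => (f z)⁻¹) (Metric.ball z₀ r) := by
    refine DifferentiableOn.diffContOnCl ?_
    rwa [closure_ball _ hr.ne']
  have := Complex.norm_le_of_forall_mem_frontier_norm_le Metric.isBounded_ball hdc (C := m⁻¹)
    (fun z hz => ?_) (subset_closure (Metric.mem_ball_self hr))
  · rw [norm_inv] at this
    have h1 : 0 < ‖f z₀‖ := norm_pos_iff.2 (hne _ (Metric.mem_closedBall_self hr.le))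
    exact absurd ((inv_le_inv₀ h1 hm).1 this) (not_le.2 h₀)
  · rw [frontier_ball _ hr.ne'] at hz
    rw [norm_inv]
    exact inv_anti₀ hm (hs z hz)

section Hilbert

variable {H : Type*} [NormedAddCommGroup H] [InnerProductSpace ℂ H]

local notation "⟪" x ", " y "⟫" => inner ℂ x y

lemma im_inner_sub_smul (B : H →L[ℂ] H) (z : ℂ) (x : H) :
    (⟪(B - z • (1 : H →L[ℂ] H)) x, x⟫).im = (⟪B x, x⟫).im + z.im * ‖x‖ ^ 2 := by
  simp only [sub_apply, smul_apply,
    one_apply_eq_self, inner_sub_left, inner_smul_left, inner_self_eq_norm_sq_to_K]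
  simp [← Complex.ofReal_pow]

lemma lower_bound_sub_smul {B : H →L[ℂ] H} {δ : ℝ} (hB : ∀ x, |(⟪B x, x⟫).im| ≤ δ * ‖x‖ ^ 2)
    (z : ℂ) (x : H) : (z.im - δ) * ‖x‖ ^ 2 ≤ ‖⟪(B - z • (1 : H →L[ℂ] H)) x, x⟫‖ := by
  refine le_trans ?_ ((le_abs_self _).trans (Complex.abs_im_le_norm _))
  rw [im_inner_sub_smul]
  have := (abs_le.1 (hB x)).1
  linarith

variable [CompleteSpace H]

/-- The imaginary part of the quadratic form of B - z is bounded below by Im z - δ, so Lax–Milgram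
applies. Only the skew part of B is restricted, its norm is not. -/
lemma isUnit_sub_smul {B : H →L[ℂ] H} {δ : ℝ} (hB : ∀ x, |(⟪B x, x⟫).im| ≤ δ * ‖x‖ ^ 2)
    {z : ℂ} (hz : δ < z.im) : IsUnit (B - z • (1 : H →L[ℂ] H)) := by
  refine ContinuousLinearMap.isUnit_of_forall_le_norm_inner_map _
    (c := ⟨z.im - δ, by linarith⟩) (by exact_mod_cast sub_pos.2 hz) fun x => ?_
  rw [mul_comm]
  exact lower_bound_sub_smul hB z x

lemma norm_inverse_apply_le {B : H →L[ℂ] H} {δ : ℝ}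
    (hB : ∀ x, |(⟪B x, x⟫).im| ≤ δ * ‖x‖ ^ 2) {z : ℂ} (hz : δ < z.im) (v : H) :
    (z.im - δ) * ‖Ring.inverse (B - z • (1 : H →L[ℂ] H)) v‖ ≤ ‖v‖ := by
  set T := B - z • (1 : H →L[ℂ] H) with hT
  set x := Ring.inverse T v with hx
  have hTx : T x = v := by
    have := Ring.mul_inverse_cancel T (isUnit_sub_smul hB hz)
    calc T x = (T * Ring.inverse T) v := rfl
      _ = v := by rw [this]; rfl
  have h1 := lower_bound_sub_smul hB z x
  rw [← hT, hTx] at h1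
  have h2 := h1.trans (norm_inner_le_norm v x)
  rcases (norm_nonneg x).eq_or_lt with h | h
  · rw [← h, mul_zero]; exact norm_nonneg _
  · refine le_of_mul_le_mul_right ?_ h
    nlinarith

/-- Since (B - z)e = (a - z)e plus an error of size δ, applying the resolvent shows that it acts on
e almost as (a - z)⁻¹. -/
lemma norm_inverse_sub_le {B : H →L[ℂ] H} {δ a : ℝ}
    (hB : ∀ x, |(⟪B x, x⟫).im| ≤ δ * ‖x‖ ^ 2) {z : ℂ} (hz : δ < z.im) (haz : (a : ℂ) - z ≠ 0)
    {e : H} (he : ‖B e - (a : ℂ) • e‖ ≤ δ) :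
    (z.im - δ) * ‖(a : ℂ) - z‖ *
      ‖Ring.inverse (B - z • (1 : H →L[ℂ] H)) e - ((a : ℂ) - z)⁻¹ • e‖ ≤ δ := by
  set T := B - z • (1 : H →L[ℂ] H) with hT
  have hinv := Ring.inverse_mul_cancel T (isUnit_sub_smul hB hz)
  have h1 : Ring.inverse T (T e) = e := by
    calc Ring.inverse T (T e) = (Ring.inverse T * T) e := rfl
      _ = e := by rw [hinv]; rfl
  have h2 : T e = ((a : ℂ) - z) • e + (B e - (a : ℂ) • e) := by
    simp only [hT, sub_apply, smul_apply,
      one_apply_eq_self, sub_smul]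
    abel
  have h3 : ((a : ℂ) - z) • (Ring.inverse T e - ((a : ℂ) - z)⁻¹ • e) =
      - Ring.inverse T (B e - (a : ℂ) • e) := by
    have h4 : Ring.inverse T (T e) = ((a : ℂ) - z) • Ring.inverse T e +
        Ring.inverse T (B e - (a : ℂ) • e) := by rw [h2, map_add, map_smul]
    rw [h1] at h4
    rw [smul_sub, smul_inv_smul₀ haz]
    nth_rewrite 2 [h4]
    abel
  have h5 := norm_inverse_apply_le hB hz (B e - (a : ℂ) • e)
  rw [mul_assoc, ← norm_smul, h3, norm_neg]
  exact h5.trans he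

lemma differentiableAt_inner_inverse (B : H →L[ℂ] H) (u v : H) {z : ℂ}
    (hz : IsUnit (B - z • (1 : H →L[ℂ] H))) :
    DifferentiableAt ℂ (fun z : ℂ => ⟪u, Ring.inverse (B - z • (1 : H →L[ℂ] H)) v⟫) z := by
  have h0 : DifferentiableAt ℂ (fun z : ℂ => B - z • (1 : H →L[ℂ] H)) z :=
    (differentiableAt_const B).sub (differentiableAt_id.smul_const _)
  have h2 : DifferentiableAt ℂ (Ring.inverse : (H →L[ℂ] H) → _) (B - z • (1 : H →L[ℂ] H)) :=
    differentiableAt_inverse hz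
  have h1 : DifferentiableAt ℂ (fun z : ℂ => Ring.inverse (B - z • (1 : H →L[ℂ] H))) z :=
    DifferentiableAt.comp (f := fun z : ℂ => B - z • (1 : H →L[ℂ] H)) z h2 h0
  exact ((innerSL ℂ u).differentiableAt).comp z (h1.clm_apply (differentiableAt_const v))

/-- An operator which is nearly self-adjoint and nearly has a double eigenvalue `a`, perturbed by a
skew rank-two coupling of the two eigenvectors, has an eigenvalue near `a + ik`. -/
theorem exists_eigenvector_of_coupling {a k δ : ℝ} (hk : 0 < k) (hδ : δ = k / 1536)
    (B : H →L[ℂ] H) {e₁ e₂ : H} (h₁ : ‖e₁‖ = 1) (h₂ : ‖e₂‖ = 1) (h₁₂ : ⟪e₁, e₂⟫ = 0)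
    (hB : ∀ x, |(⟪B x, x⟫).im| ≤ δ * ‖x‖ ^ 2) (he₁ : ‖B e₁ - (a : ℂ) • e₁‖ ≤ δ)
    (he₂ : ‖B e₂ - (a : ℂ) • e₂‖ ≤ δ) :
    ∃ z : ℂ, 0 < z.im ∧ ∃ h : H, h ≠ 0 ∧
      B h - z • h = (-(k : ℂ) * ⟪e₂, h⟫) • e₁ + ((k : ℂ) * ⟪e₁, h⟫) • e₂ := by
  have h₂₁ : ⟪e₂, e₁⟫ = 0 := by rw [← inner_conj_symm, h₁₂, map_zero]
  have h₁₁ : ⟪e₁, e₁⟫ = 1 := by rw [inner_self_eq_norm_sq_to_K, h₁]; simp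
  have h₂₂ : ⟪e₂, e₂⟫ = 1 := by rw [inner_self_eq_norm_sq_to_K, h₂]; simp
  -- z₀ is the eigenvalue of the exact model. On the disc of radius k/2 around it both Im z and |a -
  -- z| are at least k/2.
  set z₀ : ℂ := a + k * I with hz₀
  set R : ℂ → H →L[ℂ] H := fun z => Ring.inverse (B - z • (1 : H →L[ℂ] H)) with hR
  have him : ∀ z ∈ Metric.closedBall z₀ (k / 2), k / 2 ≤ z.im := by
    intro z hz
    rw [Metric.mem_closedBall, Complex.dist_eq] at hz
    have h3 := (abs_le.1 ((Complex.abs_im_le_norm (z - z₀)).trans hz)).1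
    simp [hz₀] at h3
    linarith
  have hunit : ∀ z ∈ Metric.closedBall z₀ (k / 2), δ < z.im := fun z hz => by
    have := him z hz; rw [hδ]; linarith
  have haz : ∀ z ∈ Metric.closedBall z₀ (k / 2), k / 2 ≤ ‖(a : ℂ) - z‖ := by
    intro z hz
    refine (him z hz).trans ((le_abs_self _).trans ?_)
    have := Complex.abs_im_le_norm ((a : ℂ) - z)
    simpa using this
  have hkn : ‖(k : ℂ)‖ = k := by rw [Complex.norm_real, Real.norm_of_nonneg hk.le]
  -- the entries of the compressed resolvent
  have hentry : ∀ z ∈ Metric.closedBall z₀ (k / 2), ∀ u e : H, ‖u‖ = 1 →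
      ‖B e - (a : ℂ) • e‖ ≤ δ →
      ‖k * ⟪u, R z e⟫ - k * (((a : ℂ) - z)⁻¹ * ⟪u, e⟫)‖ ≤ 1 / 192 := by
    intro z hz u e hu he
    have h3 := haz z hz
    have h4 := him z hz
    have h0 : (a : ℂ) - z ≠ 0 := norm_pos_iff.1 (by linarith)
    have h5 := norm_inverse_sub_le hB (hunit z hz) h0 he
    set w := R z e - ((a : ℂ) - z)⁻¹ • e with hw
    -- As Im z - δ ≥ k/4, this gives k ‖w‖ ≤ 8δ/k = 1/192, the size of the error in each of the four
    -- matrix entries.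
    have h6 : k / 4 * (k / 2) * ‖w‖ ≤ δ := by
      refine le_trans (mul_le_mul_of_nonneg_right ?_ (norm_nonneg w)) h5
      exact mul_le_mul (by rw [hδ]; linarith) h3 (by positivity) (by rw [hδ]; linarith)
    have h7 : k * ⟪u, R z e⟫ - k * (((a : ℂ) - z)⁻¹ * ⟪u, e⟫) = k * ⟪u, w⟫ := by
      rw [hw, inner_sub_right, inner_smul_right]; ring
    rw [h7, norm_mul, hkn]
    have h8 : ‖⟪u, w⟫‖ ≤ ‖w‖ := by simpa [hu] using norm_inner_le_norm (𝕜 := ℂ) u w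
    have h9 : k * ‖⟪u, w⟫‖ ≤ k * ‖w‖ := by gcongr
    have h10 : k * (k * ‖w‖) ≤ k * (1 / 192) := by
      rw [hδ] at h6; nlinarith
    exact h9.trans (le_of_mul_le_mul_left h10 hk)
  -- Applying the resolvent to the sought equation and pairing with e₁ and e₂ gives a homogeneous
  -- 2×2 system for ⟪e₁, h⟫ and ⟪e₂, h⟫; d is its determinant. The function d₀ is its value when the
  -- resolvent acts exactly as (a - z)⁻¹ on e₁ and e₂.
  set d : ℂ → ℂ := fun z => (1 - k * ⟪e₁, R z e₂⟫) * (1 + k * ⟪e₂, R z e₁⟫) +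
    (k * ⟪e₁, R z e₁⟫) * (k * ⟪e₂, R z e₂⟫) with hd
  set d₀ : ℂ → ℂ := fun z => 1 + (k * ((a : ℂ) - z)⁻¹) ^ 2 with hd₀
  have hdd : ∀ z ∈ Metric.closedBall z₀ (k / 2), ‖d z - d₀ z‖ ≤ 1 / 24 := by
    intro z hz
    have r11 := hentry z hz e₁ e₁ h₁ he₁
    have r12 := hentry z hz e₁ e₂ h₁ he₂
    have r21 := hentry z hz e₂ e₁ h₂ he₁
    have r22 := hentry z hz e₂ e₂ h₂ he₂
    rw [h₁₂, mul_zero, mul_zero, sub_zero] at r12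
    rw [h₂₁, mul_zero, mul_zero, sub_zero] at r21
    rw [h₁₁, mul_one] at r11
    rw [h₂₂, mul_one] at r22
    set x11 := k * ⟪e₁, R z e₁⟫
    set x12 := k * ⟪e₁, R z e₂⟫
    set x21 := k * ⟪e₂, R z e₁⟫
    set x22 := k * ⟪e₂, R z e₂⟫
    set q := k * ((a : ℂ) - z)⁻¹ with hq
    have hqn : ‖q‖ ≤ 2 := by
      have h3 := haz z hz
      rw [hq, norm_mul, norm_inv, hkn, ← div_eq_mul_inv, div_le_iff₀ (by linarith)]
      linarith
    have e : d z - d₀ z = -x12 + x21 - x12 * x21 + (x11 - q) * (x22 - q) + q * (x22 - q) +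
        (x11 - q) * q := by
      simp only [hd, hd₀, ← hq]; ring
    rw [e]
    have n1 : ‖x12 * x21‖ ≤ 1 / 192 * (1 / 192) := by rw [norm_mul]; gcongr
    have n2 : ‖(x11 - q) * (x22 - q)‖ ≤ 1 / 192 * (1 / 192) := by rw [norm_mul]; gcongr
    have n3 : ‖q * (x22 - q)‖ ≤ 2 * (1 / 192) := by rw [norm_mul]; gcongr
    have n4 : ‖(x11 - q) * q‖ ≤ 1 / 192 * 2 := by rw [norm_mul]; gcongr
    calc _ ≤ ‖x12‖ + ‖x21‖ + ‖x12 * x21‖ + ‖(x11 - q) * (x22 - q)‖ + ‖q * (x22 - q)‖ +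
          ‖(x11 - q) * q‖ := by
          refine (norm_add_le _ _).trans (add_le_add ?_ le_rfl)
          refine (norm_add_le _ _).trans (add_le_add ?_ le_rfl)
          refine (norm_add_le _ _).trans (add_le_add ?_ le_rfl)
          refine (norm_sub_le _ _).trans (add_le_add ?_ le_rfl)
          refine (norm_add_le _ _).trans (add_le_add ?_ le_rfl)
          rw [norm_neg]
      _ ≤ 1 / 24 := by linarith
  have hd₀z : d₀ z₀ = 0 := by
    have hkc : (k : ℂ) ≠ 0 := by exact_mod_cast hk.ne'
    simp only [hd₀, hz₀]
    rw [show (a : ℂ) - (a + k * I) = -(k * I) by ring, ← div_eq_mul_inv, div_pow, neg_sq, mul_pow,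
      I_sq]
    field_simp
    ring
  -- d₀ has its zeros at a ± ik. On the circle the factors of the numerator are k/2 and at least
  -- 3k/2, and |a - z| ≤ 3k/2, whence the ratio 1/3.
  have hsph : ∀ z ∈ Metric.sphere z₀ (k / 2), 1 / 3 ≤ ‖d₀ z‖ := by
    intro z hz
    rw [mem_sphere_iff_norm] at hz
    have h0 : (a : ℂ) - z ≠ 0 := norm_pos_iff.1 (by
      have := haz z (by rw [mem_closedBall_iff_norm]; exact hz.le); linarith)
    have e : d₀ z = (z - z₀) * (z - z₀ + 2 * (k * I)) / ((a : ℂ) - z) ^ 2 := by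
      simp only [hd₀, hz₀]
      field_simp
      linear_combination (k : ℂ) ^ 2 * I_sq
    have hI : ‖(k : ℂ) * I‖ = k := by rw [norm_mul, Complex.norm_I, hkn, mul_one]
    have n1 : 3 * k / 2 ≤ ‖z - z₀ + 2 * (k * I)‖ := by
      have h3 : ‖2 * (k * I)‖ = 2 * k := by rw [norm_mul, hI]; simp
      have h4 := norm_sub_norm_le (2 * (k * I)) (-(z - z₀))
      rw [norm_neg, h3, hz, sub_neg_eq_add, add_comm (2 * (k * I))] at h4
      linarith
    have n2 : ‖(a : ℂ) - z‖ ≤ 3 * k / 2 := by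
      have : (a : ℂ) - z = -(z - z₀) - k * I := by rw [hz₀]; ring
      rw [this]
      refine (norm_sub_le _ _).trans ?_
      rw [norm_neg, hz, hI]; linarith
    have hp : 0 < ‖(a : ℂ) - z‖ := norm_pos_iff.2 h0
    rw [e, norm_div, norm_mul, norm_pow, hz, le_div_iff₀ (by positivity)]
    nlinarith
  -- The threshold 1/4 separates the centre, where |d| ≤ 1/24, from the circle, where |d| ≥ 1/3 -
  -- 1/24.
  obtain ⟨z, hz, hdz⟩ : ∃ z ∈ Metric.closedBall z₀ (k / 2), d z = 0 := by
    refine exists_zero_of_small_center (m := 1 / 4) (by positivity) (fun z hz => ?_) ?_ ?_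
    · have hu := isUnit_sub_smul hB (hunit z hz)
      have d11 := differentiableAt_inner_inverse B e₁ e₁ hu
      have d12 := differentiableAt_inner_inverse B e₁ e₂ hu
      have d21 := differentiableAt_inner_inverse B e₂ e₁ hu
      have d22 := differentiableAt_inner_inverse B e₂ e₂ hu
      exact ((((d12.const_mul _).const_sub _).mul ((d21.const_mul _).const_add _)).add
        ((d11.const_mul _).mul (d22.const_mul _))).differentiableWithinAt
    · have := hdd z₀ (Metric.mem_closedBall_self (by positivity))
      rw [hd₀z, sub_zero] at this
      linarith
    · intro z hz
      have h3 := hdd z (Metric.sphere_subset_closedBall hz)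
      have h4 := hsph z hz
      have h5 := norm_sub_norm_le (d₀ z) (d z)
      rw [norm_sub_rev] at h5
      linarith
  refine ⟨z, by have := him z hz; linarith, ?_⟩
  have hu := isUnit_sub_smul hB (hunit z hz)
  -- a null vector of the compressed system
  obtain ⟨v, hv0, hv⟩ := (Matrix.exists_mulVec_eq_zero_iff (M :=
    !![1 - k * ⟪e₁, R z e₂⟫, k * ⟪e₁, R z e₁⟫; -(k * ⟪e₂, R z e₂⟫), 1 + k * ⟪e₂, R z e₁⟫])).2 (by
      rw [Matrix.det_fin_two_of, ← hdz]; simp only [hd]; ring)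
  have hv1 := congrFun hv 0
  have hv2 := congrFun hv 1
  simp [Matrix.mulVec, dotProduct, Fin.sum_univ_two] at hv1 hv2
  set w : H := (-(k : ℂ) * v 1) • e₁ + ((k : ℂ) * v 0) • e₂ with hw
  have hx1 : ⟪e₁, R z w⟫ = v 0 := by
    rw [hw, map_add, map_smul, map_smul, inner_add_right, inner_smul_right, inner_smul_right]
    linear_combination -hv1
  have hx2 : ⟪e₂, R z w⟫ = v 1 := by
    rw [hw, map_add, map_smul, map_smul, inner_add_right, inner_smul_right, inner_smul_right]
    linear_combination -hv2
  refine ⟨R z w, ?_, ?_⟩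
  · intro h0
    rw [h0, inner_zero_right] at hx1 hx2
    exact hv0 (by ext i; fin_cases i <;> simp [← hx1, ← hx2])
  · rw [hx1, hx2, ← hw]
    have := Ring.mul_inverse_cancel _ hu
    calc B (R z w) - z • R z w = ((B - z • (1 : H →L[ℂ] H)) * R z) w := rfl
      _ = w := by rw [hR]; simp only; rw [this]; rfl

end Hilbert

/-! ### Integral operators on L² by Schur's test -/

section IntegralOperator

variable {X : Type*} [MeasurableSpace X] {ρ : Measure X} {q : X → X → ℝ} {C : NNReal}

/-- The hypotheses of Schur's test for a real kernel `q`. -/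
structure SchurKernel (ρ : Measure X) (q : X → X → ℝ) (C : NNReal) : Prop where
  measurable : Measurable (Function.uncurry q)
  row : ∀ x, ∫⁻ y, ‖q x y‖ₑ ∂ρ ≤ C
  col : ∀ y, ∫⁻ x, ‖q x y‖ₑ ∂ρ ≤ C

/-- The integral operator with kernel `q`, on functions. -/
noncomputable def intFun (ρ : Measure X) (q : X → X → ℝ) (f : X → ℂ) (x : X) : ℂ :=
  ∫ y, (q x y : ℂ) * f y ∂ρ

lemma SchurKernel.measurable_row (hq : SchurKernel ρ q C) (x : X) : Measurable (q x) :=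
  hq.measurable.comp (measurable_const.prodMk measurable_id)

lemma SchurKernel.lintegral_sq_le [IsFiniteMeasure ρ] (hq : SchurKernel ρ q C) {f : X → ℂ}
    (hf : AEStronglyMeasurable f ρ) :
    ∫⁻ x, ∫⁻ y, ‖q x y‖ₑ * ‖f y‖ₑ ^ (2 : ℝ) ∂ρ ∂ρ ≤ C * ∫⁻ y, ‖f y‖ₑ ^ (2 : ℝ) ∂ρ := by
  rw [lintegral_lintegral_swap]
  · have hm : ∀ y, Measurable fun x => ‖q x y‖ₑ := fun y =>
      (hq.measurable.comp (measurable_id.prodMk measurable_const)).enorm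
    calc _ = ∫⁻ y, (∫⁻ x, ‖q x y‖ₑ ∂ρ) * ‖f y‖ₑ ^ (2 : ℝ) ∂ρ := by
          congr 1; ext y; rw [lintegral_mul_const _ (hm y)]
      _ ≤ ∫⁻ y, C * ‖f y‖ₑ ^ (2 : ℝ) ∂ρ := by gcongr with y; exact hq.col y
      _ = _ := by rw [lintegral_const_mul' _ _ (by simp)]
  · exact (hq.measurable.enorm.aemeasurable).mul
      ((hf.comp_snd.enorm).pow_const _)

/-- Use |f| ≤ 1 + |f|²: the first part is a row bound, the second is finite almost everywhere by
Tonelli and the column bound. -/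
lemma SchurKernel.ae_integrable [IsFiniteMeasure ρ] (hq : SchurKernel ρ q C) {f : X → ℂ} (hf : MemLp f 2 ρ) :
    ∀ᵐ x ∂ρ, Integrable (fun y => (q x y : ℂ) * f y) ρ := by
  have hfin : ∫⁻ y, ‖f y‖ₑ ^ (2 : ℝ) ∂ρ < ⊤ := by
    simpa using lintegral_rpow_enorm_lt_top_of_eLpNorm_lt_top (by simp) (by simp) hf.2
  have h1 : ∫⁻ x, ∫⁻ y, ‖q x y‖ₑ * ‖f y‖ₑ ^ (2 : ℝ) ∂ρ ∂ρ ≠ ⊤ :=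
    ((hq.lintegral_sq_le hf.1).trans_lt (ENNReal.mul_lt_top (by simp) hfin)).ne
  have h2 := ae_lt_top' (AEMeasurable.lintegral_prod_right'
    (f := fun p : X × X => ‖q p.1 p.2‖ₑ * ‖f p.2‖ₑ ^ (2 : ℝ))
    ((hq.measurable.enorm.aemeasurable).mul ((hf.1.comp_snd.enorm).pow_const _))) h1
  filter_upwards [h2] with x hx
  refine ⟨(Complex.measurable_ofReal.comp (hq.measurable_row x)).aestronglyMeasurable.mul hf.1, ?_⟩
  rw [hasFiniteIntegral_iff_enorm]
  calc _ ≤ ∫⁻ y, (‖q x y‖ₑ + ‖q x y‖ₑ * ‖f y‖ₑ ^ (2 : ℝ)) ∂ρ := by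
        refine lintegral_mono fun y => ?_
        rw [enorm_mul]
        have e : ‖(q x y : ℂ)‖ₑ = ‖q x y‖ₑ := by simp [enorm_eq_nnnorm]
        rw [e, ← mul_one_add]
        gcongr
        rcases le_total ‖f y‖ₑ 1 with h | h
        · exact h.trans le_self_add
        · refine le_trans ?_ le_add_self
          calc ‖f y‖ₑ = ‖f y‖ₑ ^ (1 : ℝ) := by simp
            _ ≤ _ := ENNReal.rpow_le_rpow_of_exponent_le h (by norm_num)
    _ = ∫⁻ y, ‖q x y‖ₑ ∂ρ + ∫⁻ y, ‖q x y‖ₑ * ‖f y‖ₑ ^ (2 : ℝ) ∂ρ :=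
        lintegral_add_left (hq.measurable_row x).enorm _
    _ < ⊤ := ENNReal.add_lt_top.2 ⟨(hq.row x).trans_lt (by simp), hx⟩

lemma SchurKernel.aestronglyMeasurable [IsFiniteMeasure ρ] (hq : SchurKernel ρ q C) {f : X → ℂ}
    (hf : AEStronglyMeasurable f ρ) : AEStronglyMeasurable (intFun ρ q f) ρ :=
  AEStronglyMeasurable.integral_prod_right' (f := fun p : X × X => (q p.1 p.2 : ℂ) * f p.2)
    ((Complex.measurable_ofReal.comp hq.measurable).aestronglyMeasurable.mul hf.comp_snd)

/-- Cauchy–Schwarz with |q| = |q|^{1/2} |q|^{1/2}; the factor without f is a row bound. -/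
lemma enorm_intFun_sq_le (hq : SchurKernel ρ q C) {f : X → ℂ}
    (hf : AEStronglyMeasurable f ρ) (x : X) :
    ‖intFun ρ q f x‖ₑ ^ (2 : ℝ) ≤ C * ∫⁻ y, ‖q x y‖ₑ * ‖f y‖ₑ ^ (2 : ℝ) ∂ρ := by
  have hm := (hq.measurable_row x).enorm
  have h1 : ‖intFun ρ q f x‖ₑ ≤ ∫⁻ y, (‖q x y‖ₑ ^ (1 / 2 : ℝ)) *
      (‖q x y‖ₑ ^ (1 / 2 : ℝ) * ‖f y‖ₑ) ∂ρ := by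
    refine (enorm_integral_le_lintegral_enorm _).trans (le_of_eq ?_)
    congr 1; ext y
    rw [enorm_mul, ← mul_assoc, ← ENNReal.rpow_add_of_nonneg _ _ (by norm_num) (by norm_num)]
    norm_num [enorm_eq_nnnorm]
  have h2 := h1.trans (ENNReal.lintegral_mul_le_Lp_mul_Lq ρ Real.HolderConjugate.two_two
    (hm.pow_const _).aemeasurable ((hm.pow_const _).aemeasurable.mul hf.enorm))
  have e1 : ∀ y, (‖q x y‖ₑ ^ (1 / 2 : ℝ)) ^ (2 : ℝ) = ‖q x y‖ₑ := fun y => by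
    rw [← ENNReal.rpow_mul]; norm_num
  have e2 : ∀ y, (‖q x y‖ₑ ^ (1 / 2 : ℝ) * ‖f y‖ₑ) ^ (2 : ℝ) = ‖q x y‖ₑ * ‖f y‖ₑ ^ (2 : ℝ) :=
    fun y => by rw [ENNReal.mul_rpow_of_nonneg _ _ (by norm_num), e1]
  simp only [e1, e2] at h2
  calc _ ≤ ((∫⁻ y, ‖q x y‖ₑ ∂ρ) ^ (1 / 2 : ℝ) *
        (∫⁻ y, ‖q x y‖ₑ * ‖f y‖ₑ ^ (2 : ℝ) ∂ρ) ^ (1 / 2 : ℝ)) ^ (2 : ℝ) := by gcongr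
    _ = (∫⁻ y, ‖q x y‖ₑ ∂ρ) * ∫⁻ y, ‖q x y‖ₑ * ‖f y‖ₑ ^ (2 : ℝ) ∂ρ := by
        rw [ENNReal.mul_rpow_of_nonneg _ _ (by norm_num), ← ENNReal.rpow_mul, ← ENNReal.rpow_mul]
        norm_num
    _ ≤ _ := by gcongr; exact hq.row x

lemma eLpNorm_intFun_le [IsFiniteMeasure ρ] (hq : SchurKernel ρ q C) {f : X → ℂ}
    (hf : AEStronglyMeasurable f ρ) : eLpNorm (intFun ρ q f) 2 ρ ≤ C * eLpNorm f 2 ρ := by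
  have h1 : ∫⁻ x, ‖intFun ρ q f x‖ₑ ^ (2 : ℝ) ∂ρ ≤ (C : ENNReal) ^ (2 : ℝ) *
      ∫⁻ x, ‖f x‖ₑ ^ (2 : ℝ) ∂ρ := by
    calc _ ≤ ∫⁻ x, C * ∫⁻ y, ‖q x y‖ₑ * ‖f y‖ₑ ^ (2 : ℝ) ∂ρ ∂ρ :=
          lintegral_mono fun x => enorm_intFun_sq_le hq hf x
      _ = C * ∫⁻ x, ∫⁻ y, ‖q x y‖ₑ * ‖f y‖ₑ ^ (2 : ℝ) ∂ρ ∂ρ := by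
          rw [lintegral_const_mul' _ _ (by simp)]
      _ ≤ C * (C * ∫⁻ y, ‖f y‖ₑ ^ (2 : ℝ) ∂ρ) := by gcongr; exact hq.lintegral_sq_le hf
      _ = _ := by rw [← mul_assoc, ← sq]; norm_num
  rw [eLpNorm_eq_lintegral_rpow_enorm_toReal (by simp) (by simp),
    eLpNorm_eq_lintegral_rpow_enorm_toReal (by simp) (by simp)]
  simp only [ENNReal.toReal_ofNat]
  calc _ ≤ ((C : ENNReal) ^ (2 : ℝ) * ∫⁻ x, ‖f x‖ₑ ^ (2 : ℝ) ∂ρ) ^ (1 / 2 : ℝ) := by gcongr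
    _ = _ := by
        rw [ENNReal.mul_rpow_of_nonneg _ _ (by norm_num), ← ENNReal.rpow_mul]; norm_num

lemma memLp_intFun [IsFiniteMeasure ρ] (hq : SchurKernel ρ q C) {f : X → ℂ} (hf : MemLp f 2 ρ) :
    MemLp (intFun ρ q f) 2 ρ :=
  ⟨hq.aestronglyMeasurable hf.1,
    (eLpNorm_intFun_le hq hf.1).trans_lt (ENNReal.mul_lt_top (by simp) hf.2)⟩

/-- The integral operator with kernel `q` on `L²`. -/
noncomputable def intOp [IsFiniteMeasure ρ] (hq : SchurKernel ρ q C) : Lp ℂ 2 ρ →L[ℂ] Lp ℂ 2 ρ :=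
  LinearMap.mkContinuous
    { toFun := fun f => (memLp_intFun hq (Lp.memLp f)).toLp _
      map_add' := fun f g => by
        rw [← MemLp.toLp_add]
        refine MemLp.toLp_congr _ _ ?_
        filter_upwards [hq.ae_integrable (Lp.memLp f), hq.ae_integrable (Lp.memLp g)] with x hf hg
        rw [Pi.add_apply, intFun, intFun, intFun, ← integral_add hf hg]
        refine integral_congr_ae ?_
        filter_upwards [Lp.coeFn_add f g] with y hy
        rw [hy, Pi.add_apply, mul_add]
      map_smul' := fun c f => by
        rw [RingHom.id_apply, ← MemLp.toLp_const_smul]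
        refine MemLp.toLp_congr _ _ (Eventually.of_forall fun x => ?_)
        rw [Pi.smul_apply, intFun, intFun, ← integral_smul]
        refine integral_congr_ae ?_
        filter_upwards [Lp.coeFn_smul c f] with y hy
        rw [hy, Pi.smul_apply, smul_eq_mul, smul_eq_mul]; ring }
    C (fun f => by
      change ‖(memLp_intFun hq (Lp.memLp f)).toLp _‖ ≤ C * ‖f‖
      rw [Lp.norm_toLp, Lp.norm_def, ← ENNReal.coe_toReal C, ← ENNReal.toReal_mul]
      exact ENNReal.toReal_mono (ENNReal.mul_ne_top (by simp) (Lp.memLp f).2.ne)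
        (eLpNorm_intFun_le hq (Lp.memLp f).1))

lemma coeFn_intOp [IsFiniteMeasure ρ] (hq : SchurKernel ρ q C) (f : Lp ℂ 2 ρ) :
    intOp hq f =ᵐ[ρ] intFun ρ q f := MemLp.coeFn_toLp (memLp_intFun hq (Lp.memLp f))

lemma norm_intOp_apply_le [IsFiniteMeasure ρ] (hq : SchurKernel ρ q C) (f : Lp ℂ 2 ρ) : ‖intOp hq f‖ ≤ C * ‖f‖ :=
  (ContinuousLinearMap.le_opNorm _ _).trans
    (mul_le_mul_of_nonneg_right (LinearMap.mkContinuous_norm_le _ (by simp) _) (norm_nonneg _))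

/-- Since |f(x) f(y)| ≤ |f(x)|² + |f(y)|², the row and column bounds suffice. This licenses Fubini
in the symmetry argument for the quadratic form. -/
lemma SchurKernel.integrable_prod [IsFiniteMeasure ρ] (hq : SchurKernel ρ q C) {f : X → ℂ} (hf : MemLp f 2 ρ) :
    Integrable (fun p : X × X => (q p.1 p.2 : ℂ) * (star (f p.2) * f p.1)) (ρ.prod ρ) := by
  have hfin : ∫⁻ y, ‖f y‖ₑ ^ (2 : ℝ) ∂ρ < ⊤ := by
    simpa using lintegral_rpow_enorm_lt_top_of_eLpNorm_lt_top (by simp) (by simp) hf.2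
  have hmq : AEStronglyMeasurable (fun p : X × X => (q p.1 p.2 : ℂ)) (ρ.prod ρ) :=
    (Complex.measurable_ofReal.comp hq.measurable).aestronglyMeasurable
  have hswap : SchurKernel ρ (fun x y => q y x) C :=
    ⟨hq.measurable.comp measurable_swap, hq.col, hq.row⟩
  have m1 : AEMeasurable (fun p : X × X => ‖q p.1 p.2‖ₑ * ‖f p.2‖ₑ ^ (2 : ℝ)) (ρ.prod ρ) :=
    (hq.measurable.enorm.aemeasurable).mul ((hf.1.comp_snd.enorm).pow_const _)
  have m2 : AEMeasurable (fun p : X × X => ‖q p.1 p.2‖ₑ * ‖f p.1‖ₑ ^ (2 : ℝ)) (ρ.prod ρ) :=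
    (hq.measurable.enorm.aemeasurable).mul ((hf.1.comp_fst.enorm).pow_const _)
  have i1 : ∫⁻ p, ‖q p.1 p.2‖ₑ * ‖f p.2‖ₑ ^ (2 : ℝ) ∂(ρ.prod ρ) < ⊤ := by
    rw [lintegral_prod _ m1]
    exact (hq.lintegral_sq_le hf.1).trans_lt (ENNReal.mul_lt_top (by simp) hfin)
  have i2 : ∫⁻ p, ‖q p.1 p.2‖ₑ * ‖f p.1‖ₑ ^ (2 : ℝ) ∂(ρ.prod ρ) < ⊤ := by
    rw [lintegral_prod_symm _ m2]
    exact (hswap.lintegral_sq_le hf.1).trans_lt (ENNReal.mul_lt_top (by simp) hfin)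
  refine ⟨hmq.mul ((continuous_star.comp_aestronglyMeasurable hf.1.comp_snd).mul hf.1.comp_fst), ?_⟩
  rw [hasFiniteIntegral_iff_enorm]
  refine lt_of_le_of_lt ?_ (ENNReal.add_lt_top.2 ⟨i1, i2⟩)
  rw [← lintegral_add_left' m1]
  refine lintegral_mono fun p => ?_
  have e : ‖(q p.1 p.2 : ℂ)‖ₑ = ‖q p.1 p.2‖ₑ := by simp [enorm_eq_nnnorm]
  have e2 : ‖star (f p.2)‖ₑ = ‖f p.2‖ₑ := by simp [enorm_eq_nnnorm]
  rw [enorm_mul, enorm_mul, e, e2, ← mul_add]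
  gcongr
  norm_num
  rcases le_total ‖f p.2‖ₑ ‖f p.1‖ₑ with h | h
  · refine le_trans ?_ le_add_self
    rw [sq]; gcongr
  · refine le_trans ?_ le_self_add
    rw [sq]; gcongr

/-- Conjugating the double integral exchanges the two variables, which a real symmetric kernel does
not notice. -/
lemma im_inner_intOp [IsFiniteMeasure ρ] (hq : SchurKernel ρ q C) (hs : ∀ x y, q x y = q y x) (f : Lp ℂ 2 ρ) :
    (inner ℂ (intOp hq f) f).im = 0 := by
  have hint := hq.integrable_prod (Lp.memLp f)
  set g : X → X → ℂ := fun x y => (q x y : ℂ) * (star (f y) * f x) with hg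
  have h1 : inner ℂ (intOp hq f) f = ∫ x, ∫ y, g x y ∂ρ ∂ρ := by
    rw [L2.inner_def]
    refine integral_congr_ae ?_
    filter_upwards [coeFn_intOp hq f] with x hx
    rw [hx, RCLike.inner_apply, intFun, ← integral_conj, mul_comm, ← integral_mul_const]
    congr 1; ext y
    simp [hg, mul_assoc]
  have h2 : (starRingEnd ℂ) (∫ x, ∫ y, g x y ∂ρ ∂ρ) = ∫ x, ∫ y, g x y ∂ρ ∂ρ := by
    have h3 := integral_integral_swap (μ := ρ) (ν := ρ) (f := g) hint
    rw [← integral_conj]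
    conv_rhs => rw [h3]
    congr 1; ext x
    rw [← integral_conj]
    congr 1; ext y
    simp only [hg, map_mul, Complex.conj_ofReal, hs x y]
    simp [mul_comm]
  rw [h1]
  exact Complex.conj_eq_iff_im.1 h2

/-- Multiplication by a bounded real function on `L²`. -/
lemma exists_mulOp [IsFiniteMeasure ρ] {Ω : X → ℝ} (hΩ : Measurable Ω) {M : ℝ} (hM : ∀ x, |Ω x| ≤ M) :
    ∃ T : Lp ℂ 2 ρ →L[ℂ] Lp ℂ 2 ρ, (∀ f, T f =ᵐ[ρ] fun x => (Ω x : ℂ) * f x) ∧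
      ∀ f, (inner ℂ (T f) f).im = 0 := by
  have hb : ∀ x, ‖(Ω x : ℂ)‖ ≤ M := fun x => by simpa using hM x
  have hmem : ∀ f : Lp ℂ 2 ρ, MemLp (fun x => (Ω x : ℂ) * f x) 2 ρ := fun f =>
    (Lp.memLp f).of_le_mul (c := M)
      ((Complex.measurable_ofReal.comp hΩ).aestronglyMeasurable.mul (Lp.memLp f).1)
      (Eventually.of_forall fun x => by rw [norm_mul]; gcongr; exact hb x)
  let L : Lp ℂ 2 ρ →ₗ[ℂ] Lp ℂ 2 ρ :=
    { toFun := fun f => (hmem f).toLp _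
      map_add' := fun f g => by
        rw [← MemLp.toLp_add]
        refine MemLp.toLp_congr _ _ ?_
        filter_upwards [Lp.coeFn_add f g] with y hy
        rw [hy, Pi.add_apply, Pi.add_apply, mul_add]
      map_smul' := fun c f => by
        rw [RingHom.id_apply, ← MemLp.toLp_const_smul]
        refine MemLp.toLp_congr _ _ ?_
        filter_upwards [Lp.coeFn_smul c f] with y hy
        rw [hy, Pi.smul_apply, Pi.smul_apply, smul_eq_mul, smul_eq_mul]; ring }
  have hL : ∀ f, L f =ᵐ[ρ] fun x => (Ω x : ℂ) * f x := fun f => MemLp.coeFn_toLp (hmem f)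
  refine ⟨L.mkContinuous M fun f => ?_, hL, fun f => ?_⟩
  · refine Lp.norm_le_mul_norm_of_ae_le_mul ?_
    filter_upwards [hL f] with x hx
    rw [hx, norm_mul]; gcongr; exact hb x
  · change (inner ℂ (L f) f).im = 0
    rw [L2.inner_def]
    have : ∀ᵐ x ∂ρ, inner ℂ (L f x) (f x) = ((Ω x * ‖f x‖ ^ 2 : ℝ) : ℂ) := by
      filter_upwards [hL f] with x hx
      rw [hx, ← smul_eq_mul, inner_smul_left, inner_self_eq_norm_sq_to_K]
      simp
    rw [integral_congr_ae this, integral_complex_ofReal, Complex.ofReal_im]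

end IntegralOperator

lemma SchurKernel.mono {X : Type*} [MeasurableSpace X] {ρ : Measure X} {q q' : X → X → ℝ}
    {C : NNReal} (hq : SchurKernel ρ q C) (hm : Measurable (Function.uncurry q'))
    (h : ∀ x y, |q' x y| ≤ |q x y|) : SchurKernel ρ q' C := by
  have h' : ∀ x y, ‖q' x y‖ₑ ≤ ‖q x y‖ₑ := fun x y =>
    enorm_le_iff_norm_le.2 (h x y)
  exact ⟨hm, fun x => (lintegral_mono fun y => h' x y).trans (hq.row x),
    fun y => (lintegral_mono fun x => h' x y).trans (hq.col y)⟩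

lemma SchurKernel.of_bounded {X : Type*} [MeasurableSpace X] {ρ : Measure X} {q : X → X → ℝ}
    {δ : NNReal} (hρ : ρ univ ≤ 2) (hm : Measurable (Function.uncurry q))
    (h : ∀ x y, |q x y| ≤ δ) : SchurKernel ρ q (δ * 2) := by
  have h' : ∀ x y, ‖q x y‖ₑ ≤ δ := fun x y => by
    have := h x y
    rw [← Real.norm_eq_abs] at this
    rw [enorm_eq_nnnorm]
    exact_mod_cast this
  have key : ∫⁻ _ : X, (δ : ENNReal) ∂ρ ≤ ((δ * 2 : NNReal) : ENNReal) := by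
    rw [lintegral_const]; push_cast; gcongr
  exact ⟨hm, fun x => (lintegral_mono fun y => h' x y).trans key,
    fun y => (lintegral_mono fun x => h' x y).trans key⟩

/-! ### Reduction to two pieces of unit mass -/

/-- An integral operator on two pieces of unit mass, nearly of the form "double eigenvalue plus
skew coupling", has an eigenvalue in the upper half plane. -/
theorem exists_mode_of_two_pieces {X : Type} [MeasurableSpace X] {ρ : Measure X} [IsFiniteMeasure ρ]
    {S : Set X} (hS : MeasurableSet S) (hρ₁ : ρ S = 1) (hρ₂ : ρ Sᶜ = 1) {Ω : X → ℝ}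
    (hΩ : Measurable Ω) {M : ℝ} (hM : ∀ x, |Ω x| ≤ M) {K : X → X → ℝ} {C : NNReal}
    (hK : SchurKernel ρ K C) {a k : ℝ} {δ : NNReal} (hk : 0 < k) (hδ : (δ : ℝ) * 2 = k / 1536)
    (hsymm : ∀ x y, (x ∈ S ↔ y ∈ S) → K x y = K y x)
    (h₁₂ : ∀ x ∈ S, ∀ y ∉ S, |K x y + k| ≤ δ) (h₂₁ : ∀ x ∉ S, ∀ y ∈ S, |K x y - k| ≤ δ)
    (ha₁ : ∀ x ∈ S, |Ω x - (∫ y in S, K x y ∂ρ) - a| ≤ δ)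
    (ha₂ : ∀ x ∉ S, |Ω x - (∫ y in Sᶜ, K x y ∂ρ) - a| ≤ δ) :
    ∃ z : ℂ, 0 < z.im ∧ ∃ h : X → ℂ, MemLp h 2 ρ ∧ ¬ (h =ᵐ[ρ] 0) ∧
      ∀ᵐ x ∂ρ, (Ω x : ℂ) * h x - ∫ y, (K x y : ℂ) * h y ∂ρ = z * h x := by
  classical
  have hρ : ρ univ ≤ 2 := by
    rw [← union_compl_self S, measure_union disjoint_compl_right hS.compl, hρ₁, hρ₂]
    norm_num
  have hSS : MeasurableSet {p : X × X | p.1 ∈ S ↔ p.2 ∈ S} :=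
    (hS.preimage measurable_fst).iff (hS.preimage measurable_snd)
  -- the parts of the kernel coupling equal and different pieces
  set qs : X → X → ℝ := fun x y => if x ∈ S ↔ y ∈ S then K x y else 0 with hqs
  set qd : X → X → ℝ := fun x y => if x ∈ S ↔ y ∈ S then 0 else
    K x y - (if x ∈ S then -k else k) with hqd
  have hmS : Measurable fun p : X × X => if p.1 ∈ S then -k else k :=
    Measurable.ite (hS.preimage measurable_fst) measurable_const measurable_const
  have hqs' : SchurKernel ρ qs C := by
    refine hK.mono (Measurable.ite hSS hK.measurable measurable_const) fun x y => ?_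
    simp only [hqs]; split_ifs <;> simp
  have hqdb : ∀ x y, |qd x y| ≤ δ := by
    intro x y
    by_cases hx : x ∈ S <;> by_cases hy : y ∈ S <;> simp only [hqd, hx, hy] <;> simp
    · exact h₁₂ x hx y hy
    · exact h₂₁ x hx y hy
  have hqd' : SchurKernel ρ qd (δ * 2) := by
    refine SchurKernel.of_bounded hρ (Measurable.ite hSS measurable_const
      (hK.measurable.sub hmS)) hqdb
  obtain ⟨T, hT, hTim⟩ := exists_mulOp (ρ := ρ) hΩ hM
  -- B is the full operator with only the constant coupling ∓k between the pieces removed.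
  -- Multiplication by Ω and the kernel qs are self-adjoint, and qd has norm at most 2δ, as the
  -- total mass is 2.
  set B : Lp ℂ 2 ρ →L[ℂ] Lp ℂ 2 ρ := T - intOp hqs' - intOp hqd' with hB
  have hS1 : ρ S ≠ ⊤ := by simp [hρ₁]
  have hS2 : ρ Sᶜ ≠ ⊤ := by simp [hρ₂]
  set e₁ : Lp ℂ 2 ρ := indicatorConstLp 2 hS hS1 1 with he₁
  set e₂ : Lp ℂ 2 ρ := indicatorConstLp 2 hS.compl hS2 1 with he₂
  have n₁ : ‖e₁‖ = 1 := by
    rw [he₁, norm_indicatorConstLp (by simp) (by simp)]; simp [measureReal_def, hρ₁]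
  have n₂ : ‖e₂‖ = 1 := by
    rw [he₂, norm_indicatorConstLp (by simp) (by simp)]; simp [measureReal_def, hρ₂]
  have c₁ : e₁ =ᵐ[ρ] S.indicator fun _ => 1 := indicatorConstLp_coeFn
  have c₂ : e₂ =ᵐ[ρ] Sᶜ.indicator fun _ => 1 := indicatorConstLp_coeFn
  have i₁ : ∀ f : Lp ℂ 2 ρ, inner ℂ e₁ f = ∫ x in S, f x ∂ρ := fun f =>
    L2.inner_indicatorConstLp_one hS hS1 f
  have i₂ : ∀ f : Lp ℂ 2 ρ, inner ℂ e₂ f = ∫ x in Sᶜ, f x ∂ρ := fun f =>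
    L2.inner_indicatorConstLp_one hS.compl hS2 f
  have i₁₂ : inner ℂ e₁ e₂ = 0 := by
    rw [i₁, setIntegral_congr_ae (g := fun _ => (0 : ℂ)) hS]
    · simp
    · filter_upwards [c₂] with x hx hxS
      rw [hx, indicator_of_notMem (by simpa using hxS)]
  have hBf : ∀ f : Lp ℂ 2 ρ, B f =ᵐ[ρ] fun x => (Ω x : ℂ) * f x - intFun ρ qs f x -
      intFun ρ qd f x := by
    intro f
    have e : B f = T f - intOp hqs' f - intOp hqd' f := rfl
    rw [e]
    filter_upwards [Lp.coeFn_sub (T f - intOp hqs' f) (intOp hqd' f),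
      Lp.coeFn_sub (T f) (intOp hqs' f), hT f, coeFn_intOp hqs' f, coeFn_intOp hqd' f]
      with x h1 h2 h3 h4 h5
    rw [h1, Pi.sub_apply, h2, Pi.sub_apply, h3, h4, h5]
  have hδ' : ((δ * 2 : NNReal) : ℝ) = k / 1536 := by rw [← hδ]; push_cast; ring
  have him : ∀ f : Lp ℂ 2 ρ, |(inner ℂ (B f) f).im| ≤ k / 1536 * ‖f‖ ^ 2 := by
    intro f
    have e : B f = T f - intOp hqs' f - intOp hqd' f := rfl
    have hsym : ∀ x y, qs x y = qs y x := by
      intro x y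
      by_cases h : x ∈ S ↔ y ∈ S
      · simp only [hqs, if_pos h, if_pos h.symm]; exact hsymm x y h
      · simp only [hqs, if_neg h, if_neg (fun h' : y ∈ S ↔ x ∈ S => h h'.symm)]
    rw [e, inner_sub_left, inner_sub_left, Complex.sub_im, Complex.sub_im, hTim,
      im_inner_intOp hqs' hsym, sub_zero, zero_sub, abs_neg]
    calc _ ≤ ‖inner ℂ (intOp hqd' f) f‖ := Complex.abs_im_le_norm _
      _ ≤ ‖intOp hqd' f‖ * ‖f‖ := norm_inner_le_norm _ _
      _ ≤ (k / 1536 * ‖f‖) * ‖f‖ := by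
          rw [← hδ']; gcongr; exact norm_intOp_apply_le hqd' f
      _ = _ := by ring
  have hnorm : ∀ f : Lp ℂ 2 ρ, (∀ᵐ x ∂ρ, ‖f x‖ ≤ δ) → ‖f‖ ≤ k / 1536 := by
    intro f hf
    have h1 := Lp.norm_le_of_ae_bound (C := (δ : ℝ)) δ.2 hf
    refine h1.trans ?_
    rw [← hδ, mul_comm]
    gcongr
    have h2 : (measureUnivNNReal ρ : ℝ) ≤ 2 := by
      have h3 : ((measureUnivNNReal ρ : NNReal) : ENNReal) ≤ (2 : NNReal) := by
        rw [coe_measureUnivNNReal]; exact hρ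
      exact_mod_cast h3
    calc (measureUnivNNReal ρ : ℝ) ^ (ENNReal.toReal 2)⁻¹ ≤ 2 ^ (ENNReal.toReal 2)⁻¹ := by
          gcongr
      _ ≤ 2 ^ (1 : ℝ) := Real.rpow_le_rpow_of_exponent_le (by norm_num) (by norm_num)
      _ = 2 := by simp
  have hint : ∀ (q : X → X → ℝ) (x : X) (A : Set X), MeasurableSet A → ∀ f : Lp ℂ 2 ρ,
      (f =ᵐ[ρ] A.indicator fun _ => 1) → intFun ρ q f x = ((∫ y in A, q x y ∂ρ : ℝ) : ℂ) := by
    intro q x A hA f hf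
    rw [intFun, ← integral_complex_ofReal, ← integral_indicator hA]
    refine integral_congr_ae ?_
    filter_upwards [hf] with y hy
    rw [hy]
    by_cases h : y ∈ A <;> simp [h]
  -- On S the deviation of B e₁ from a e₁ is the hypothesis on Ω - ∫_S K; off S only the small
  -- kernel qd acts.
  have hB₁ : ‖B e₁ - (a : ℂ) • e₁‖ ≤ k / 1536 := by
    refine hnorm _ ?_
    filter_upwards [Lp.coeFn_sub (B e₁) ((a : ℂ) • e₁), Lp.coeFn_smul (a : ℂ) e₁, hBf e₁, c₁]
      with x h1 h2 h3 h4
    rw [h1, Pi.sub_apply, h2, Pi.smul_apply, h3, h4, hint qs x S hS e₁ c₁, hint qd x S hS e₁ c₁]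
    by_cases hx : x ∈ S
    · have q1 : ∫ y in S, qs x y ∂ρ = ∫ y in S, K x y ∂ρ :=
        setIntegral_congr_fun hS fun y hy => by simp [hqs, hx, hy]
      have q2 : ∫ y in S, qd x y ∂ρ = 0 := by
        rw [setIntegral_congr_fun (g := fun _ => (0 : ℝ)) hS fun y hy => by simp [hqd, hx, hy]]
        simp
      rw [q1, q2, indicator_of_mem hx]
      have := ha₁ x hx
      rw [← Real.norm_eq_abs, ← Complex.norm_real] at this
      simpa using this
    · have q1 : ∫ y in S, qs x y ∂ρ = 0 := by
        rw [setIntegral_congr_fun (g := fun _ => (0 : ℝ)) hS fun y hy => by simp [hqs, hx, hy]]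
        simp
      rw [q1, indicator_of_notMem hx]
      simp only [mul_zero, Complex.ofReal_zero, sub_zero, zero_sub, smul_zero, norm_neg,
        Complex.norm_real]
      refine (norm_setIntegral_le_of_norm_le_const (C := δ) (by simp [hρ₁])
        fun y _ => hqdb x y).trans ?_
      simp [measureReal_def, hρ₁]
  have hB₂ : ‖B e₂ - (a : ℂ) • e₂‖ ≤ k / 1536 := by
    refine hnorm _ ?_
    filter_upwards [Lp.coeFn_sub (B e₂) ((a : ℂ) • e₂), Lp.coeFn_smul (a : ℂ) e₂, hBf e₂, c₂]
      with x h1 h2 h3 h4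
    rw [h1, Pi.sub_apply, h2, Pi.smul_apply, h3, h4, hint qs x Sᶜ hS.compl e₂ c₂,
      hint qd x Sᶜ hS.compl e₂ c₂]
    by_cases hx : x ∈ S
    · have q1 : ∫ y in Sᶜ, qs x y ∂ρ = 0 := by
        rw [setIntegral_congr_fun (g := fun _ => (0 : ℝ)) hS.compl fun y hy => by
          have hy' : y ∉ S := hy
          simp [hqs, hx, hy']]
        simp
      rw [q1, indicator_of_notMem (by simpa using hx)]
      simp only [mul_zero, Complex.ofReal_zero, sub_zero, zero_sub, smul_zero, norm_neg,
        Complex.norm_real]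
      refine (norm_setIntegral_le_of_norm_le_const (C := δ) (by simp [hρ₂])
        fun y _ => hqdb x y).trans ?_
      simp [measureReal_def, hρ₂]
    · have q1 : ∫ y in Sᶜ, qs x y ∂ρ = ∫ y in Sᶜ, K x y ∂ρ :=
        setIntegral_congr_fun hS.compl fun y hy => by
          have hy' : y ∉ S := hy
          simp [hqs, hx, hy']
      have q2 : ∫ y in Sᶜ, qd x y ∂ρ = 0 := by
        rw [setIntegral_congr_fun (g := fun _ => (0 : ℝ)) hS.compl fun y hy => by
          have hy' : y ∉ S := hy
          simp [hqd, hx, hy']]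
        simp
      rw [q1, q2, indicator_of_mem (show x ∈ Sᶜ from hx)]
      have := ha₂ x hx
      rw [← Real.norm_eq_abs, ← Complex.norm_real] at this
      simpa using this
  obtain ⟨z, hz, f, hf0, hf⟩ := exists_eigenvector_of_coupling hk rfl B n₁ n₂ i₁₂ him hB₁ hB₂
  refine ⟨z, hz, f, Lp.memLp f, fun h0 => hf0 ((Lp.eq_zero_iff_ae_eq_zero).2 h0), ?_⟩
  have hfi : Integrable f ρ := (Lp.memLp f).integrable (by norm_num)
  have hl := Lp.coeFn_sub (B f) (z • f)
  rw [hf, i₁, i₂] at hl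
  set u := ∫ x in S, f x ∂ρ with hu
  set v := ∫ x in Sᶜ, f x ∂ρ with hv
  filter_upwards [hl, Lp.coeFn_smul z f, hBf f, c₁, c₂,
    Lp.coeFn_add ((-(k : ℂ) * v) • e₁) (((k : ℂ) * u) • e₂), Lp.coeFn_smul (-(k : ℂ) * v) e₁,
    Lp.coeFn_smul ((k : ℂ) * u) e₂, hqs'.ae_integrable (Lp.memLp f),
    hqd'.ae_integrable (Lp.memLp f)] with x h1 h2 h3 h4 h5 h6 h7 h8 j1 j2
  rw [Pi.sub_apply, h2, Pi.smul_apply, h3, h6, Pi.add_apply, h7, h8, Pi.smul_apply, Pi.smul_apply,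
    h4, h5] at h1
  have j12 : Integrable (fun y => (qs x y : ℂ) * f y + (qd x y : ℂ) * f y) ρ := j1.add j2
  -- Adding the rank-two coupling back to qs + qd restores K; on S it contributes -k ∫ f over the
  -- complement, off S it contributes k ∫ f over S.
  by_cases hx : x ∈ S
  · have key : ∫ y, (K x y : ℂ) * f y ∂ρ = intFun ρ qs f x + intFun ρ qd f x - k * v := by
      rw [intFun, intFun, ← integral_add j1 j2, hv, ← integral_const_mul,
        ← integral_indicator hS.compl, ← integral_sub j12
          ((hfi.const_mul (k : ℂ)).indicator hS.compl)]
      congr 1; ext y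
      by_cases hy : y ∈ S
      · simp [hqs, hqd, hx, hy]
      · simp [hqs, hqd, hx, hy]; ring
    rw [indicator_of_mem hx, indicator_of_notMem (by simpa using hx)] at h1
    simp only [smul_eq_mul] at h1
    rw [key]
    linear_combination -h1
  · have key : ∫ y, (K x y : ℂ) * f y ∂ρ = intFun ρ qs f x + intFun ρ qd f x + k * u := by
      rw [intFun, intFun, ← integral_add j1 j2, hu, ← integral_const_mul,
        ← integral_indicator hS, ← integral_add j12
          ((hfi.const_mul (k : ℂ)).indicator hS)]
      congr 1; ext y
      by_cases hy : y ∈ S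
      · simp [hqs, hqd, hx, hy]; ring
      · simp [hqs, hqd, hx, hy]
    rw [indicator_of_notMem hx, indicator_of_mem (show x ∈ Sᶜ from hx)] at h1
    simp only [smul_eq_mul] at h1
    rw [key]
    linear_combination -h1

/-! ### Smoothness of solutions of f = q (κ ⋆ f) -/

/-- Convolution on the line. -/
noncomputable def conv (κ f : ℝ → ℂ) (x : ℝ) : ℂ := ∫ t, κ t * f (x - t)

lemma conv_eq_convolution (κ f : ℝ → ℂ) :
    conv κ f = convolution κ f (ContinuousLinearMap.mul ℝ ℂ) volume := rfl

lemma conv_swap (κ f : ℝ → ℂ) (x : ℝ) : conv κ f x = ∫ t, κ (x - t) * f t := by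
  rw [conv_eq_convolution, convolution_eq_swap]; rfl

lemma contDiff_conv_right {κ f : ℝ → ℂ} (hκ : LocallyIntegrable κ) {n : ℕ∞} (hf : ContDiff ℝ n f)
    (hc : HasCompactSupport f) : ContDiff ℝ n (conv κ f) := by
  rw [conv_eq_convolution]; exact hc.contDiff_convolution_right _ hκ hf

lemma contDiff_conv_left {κ f : ℝ → ℂ} {n : ℕ∞} (hκ : ContDiff ℝ n κ) (hc : HasCompactSupport κ)
    (hf : LocallyIntegrable f) : ContDiff ℝ n (conv κ f) := by
  rw [conv_eq_convolution]; exact hc.contDiff_convolution_left _ hκ hf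

lemma hasCompactSupport_iteratedDeriv {f : ℝ → ℂ} (hc : HasCompactSupport f) (k : ℕ) :
    HasCompactSupport (iteratedDeriv k f) := by
  induction k with
  | zero => simpa using hc
  | succ k ih => rw [iteratedDeriv_succ]; exact ih.deriv

lemma iteratedDeriv_conv {κ f : ℝ → ℂ} (hκ : LocallyIntegrable κ) (hf : ContDiff ℝ ∞ f)
    (hc : HasCompactSupport f) (k : ℕ) :
    iteratedDeriv k (conv κ f) = conv κ (iteratedDeriv k f) := by
  induction k with
  | zero => simp
  | succ k ih =>
    rw [iteratedDeriv_succ, ih, iteratedDeriv_succ]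
    ext x
    have h1 : ContDiff ℝ 1 (iteratedDeriv k f) := by
      rw [iteratedDeriv_eq_iterate]
      exact ContDiff.iterate_deriv' 1 k (hf.of_le (by exact_mod_cast le_top))
    exact ((hasCompactSupport_iteratedDeriv hc k).hasDerivAt_convolution_right
      (ContinuousLinearMap.mul ℝ ℂ) hκ h1 x).deriv

lemma norm_conv_le {κ f : ℝ → ℂ} (hκ : Integrable κ) {A : ℝ} (hf : ∀ x, ‖f x‖ ≤ A) (x : ℝ) :
    ‖conv κ f x‖ ≤ (∫ t, ‖κ t‖) * A := by
  rw [← integral_mul_const]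
  refine norm_integral_le_of_norm_le (hκ.norm.mul_const A) (Eventually.of_forall fun t => ?_)
  rw [norm_mul]; gcongr; exact hf _

/-- A bound for the derivatives up to order `m` of a test function. -/
lemma exists_bound_iteratedDeriv {q : ℝ → ℂ} (hq : ContDiff ℝ ∞ q) (hc : HasCompactSupport q)
    (m : ℕ) : ∃ A : ℝ, 0 ≤ A ∧ ∀ i ≤ m, ∀ x, ‖iteratedDeriv i q x‖ ≤ A := by
  have h1 : ∀ i : ℕ, ∃ A : ℝ, ∀ x, ‖iteratedDeriv i q x‖ ≤ A := fun i =>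
    (hasCompactSupport_iteratedDeriv hc i).exists_bound_of_continuous
      (hq.continuous_iteratedDeriv i (by exact_mod_cast le_top))
  choose A hA using h1
  refine ⟨∑ i ∈ Finset.range (m + 1), |A i|, Finset.sum_nonneg fun i _ => abs_nonneg _,
    fun i hi x => ?_⟩
  refine (hA i x).trans ((le_abs_self _).trans ?_)
  exact Finset.single_le_sum (f := fun i => |A i|) (fun i _ => abs_nonneg _)
    (Finset.mem_range.2 (by omega))

/-- By Leibniz, with all derivatives of the convolution put on f. The kernel enters only through its
L¹ norm, so a kernel small in L¹ gives a contraction in C^m. -/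
lemma norm_iteratedDeriv_mul_conv_le {κ q f : ℝ → ℂ} (hκ : Integrable κ) (hq : ContDiff ℝ ∞ q)
    (hf : ContDiff ℝ ∞ f) (hc : HasCompactSupport f) {m : ℕ} {Q A : ℝ} (hQ0 : 0 ≤ Q)
    (hQ : ∀ i ≤ m, ∀ x, ‖iteratedDeriv i q x‖ ≤ Q) (hA : ∀ i ≤ m, ∀ x, ‖iteratedDeriv i f x‖ ≤ A)
    {i : ℕ} (hi : i ≤ m) (x : ℝ) :
    ‖iteratedDeriv i (fun y => q y * conv κ f y) x‖ ≤ (2 ^ m * Q * ∫ t, ‖κ t‖) * A := by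
  have hA0 : 0 ≤ A := (norm_nonneg _).trans (hA 0 (Nat.zero_le _) 0)
  have hI0 : 0 ≤ ∫ t, ‖κ t‖ := integral_nonneg fun _ => norm_nonneg _
  have h1 := norm_iteratedFDeriv_mul_le hq
    (contDiff_conv_right (n := ⊤) hκ.locallyIntegrable (by exact_mod_cast hf) hc) x (n := i)
    (by exact_mod_cast le_top)
  simp only [norm_iteratedFDeriv_eq_norm_iteratedDeriv] at h1
  refine h1.trans ?_
  calc _ ≤ ∑ j ∈ Finset.range (i + 1), (i.choose j : ℝ) * Q * ((∫ t, ‖κ t‖) * A) := by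
        refine Finset.sum_le_sum fun j hj => ?_
        have hj' := Finset.mem_range.1 hj
        gcongr
        · exact hQ j (by omega) x
        · rw [iteratedDeriv_conv hκ.locallyIntegrable hf hc]
          exact norm_conv_le hκ (hA _ (by omega)) x
    _ = 2 ^ i * Q * ((∫ t, ‖κ t‖) * A) := by
        rw [← Finset.sum_mul, ← Finset.sum_mul]
        congr 2
        exact_mod_cast Nat.sum_range_choose i
    _ ≤ 2 ^ m * Q * ((∫ t, ‖κ t‖) * A) := by
        gcongr
        norm_num
    _ = _ := by ring

/-- The iterates of `f ↦ q (κ ⋆ f)`. -/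
noncomputable def neumann (κ q F : ℝ → ℂ) : ℕ → ℝ → ℂ
  | 0 => F
  | j + 1 => fun x => q x * conv κ (neumann κ q F j) x

lemma neumann_smooth {κ q F : ℝ → ℂ} (hκ : Integrable κ) (hq : ContDiff ℝ ∞ q)
    (hqc : HasCompactSupport q) (hF : ContDiff ℝ ∞ F) (hFc : HasCompactSupport F) (j : ℕ) :
    ContDiff ℝ ∞ (neumann κ q F j) ∧ HasCompactSupport (neumann κ q F j) := by
  induction j with
  | zero => exact ⟨hF, hFc⟩
  | succ j ih =>
    exact ⟨hq.mul (contDiff_conv_right (n := ⊤) hκ.locallyIntegrable (by exact_mod_cast ih.1) ih.2),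
      hqc.mul_right⟩

lemma integral_norm_conv_le {κ f : ℝ → ℂ} (hκ : Integrable κ) (hf : Integrable f) :
    Integrable (conv κ f) ∧ ∫ x, ‖conv κ f x‖ ≤ (∫ t, ‖κ t‖) * ∫ x, ‖f x‖ := by
  have h0 : Integrable (conv κ f) := by
    rw [conv_eq_convolution]; exact hκ.integrable_convolution _ hf
  refine ⟨h0, ?_⟩
  have h1 := integral_convolution (μ := volume) (ν := volume) (ContinuousLinearMap.mul ℝ ℝ)
    hκ.norm hf.norm
  simp only [ContinuousLinearMap.mul_apply'] at h1
  rw [← h1]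
  refine integral_mono h0.norm (hκ.norm.integrable_convolution _ hf.norm) fun x => ?_
  refine (norm_integral_le_integral_norm _).trans (le_of_eq ?_)
  simp only [norm_mul]
  rfl

/-- An integrable solution of `f = q (κ ⋆ f)` with `κ` integrable and `q` a test function agrees
almost everywhere with a function of class `C^m`. -/
lemma exists_contDiff_of_eq_mul_conv {κ q f : ℝ → ℂ} (hκ : Integrable κ) (hq : ContDiff ℝ ∞ q)
    (hqc : HasCompactSupport q) (hf : Integrable f) (heq : f =ᵐ[volume] fun x => q x * conv κ f x)
    (m : ℕ) :
    ∃ g : ℝ → ℂ, ContDiff ℝ m g ∧ f =ᵐ[volume] g ∧ ∀ x, q x = 0 → g x = 0 := by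
  obtain ⟨Q, hQ0, hQ⟩ := exists_bound_iteratedDeriv hq hqc m
  -- Split κ into a test function κ₂ and a remainder κ₁ with 2^m Q ‖κ₁‖₁ ≤ 1/2. Then f = F + q (κ₁ ⋆
  -- f) with F smooth even though f is only integrable. The splitting depends on m.
  obtain ⟨κ₂, hκ₂c, hκ₂, hκ₂n⟩ := (memLp_one_iff_integrable.2 hκ).exist_eLpNorm_sub_le
    (by simp) le_rfl (ε := 1 / (2 * (2 ^ m * Q + 1))) (by positivity)
  have hκ₂i : Integrable κ₂ := hκ₂.continuous.integrable_of_hasCompactSupport hκ₂c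
  set κ₁ := κ - κ₂ with hκ₁
  have hκ₁i : Integrable κ₁ := hκ.sub hκ₂i
  have hκ₁n : ∫ t, ‖κ₁ t‖ ≤ 1 / (2 * (2 ^ m * Q + 1)) := by
    rw [eLpNorm_one_eq_lintegral_enorm] at hκ₂n
    rw [integral_norm_eq_lintegral_enorm hκ₁i.1]
    exact ENNReal.toReal_le_of_le_ofReal (by positivity) hκ₂n
  have hI0 : 0 ≤ ∫ t, ‖κ₁ t‖ := integral_nonneg fun _ => norm_nonneg _
  have hsmall : 2 ^ m * Q * ∫ t, ‖κ₁ t‖ ≤ 1 / 2 := by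
    calc _ ≤ (2 ^ m * Q + 1) * (1 / (2 * (2 ^ m * Q + 1))) := by gcongr; linarith
      _ = 1 / 2 := by field_simp
  have hsmall' : Q * ∫ t, ‖κ₁ t‖ ≤ 1 / 2 := by
    refine le_trans ?_ hsmall
    gcongr
    exact le_mul_of_one_le_left hQ0 (one_le_pow₀ (by norm_num))
  set F : ℝ → ℂ := fun x => q x * conv κ₂ f x with hF
  have hFs : ContDiff ℝ ∞ F :=
    hq.mul (contDiff_conv_left (n := ⊤) (by exact_mod_cast hκ₂) hκ₂c hf.locallyIntegrable)
  have hFc : HasCompactSupport F := hqc.mul_right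
  obtain ⟨A, hA0, hA⟩ := exists_bound_iteratedDeriv hFs hFc m
  have hN := neumann_smooth hκ₁i hq hqc hFs hFc
  have hNb : ∀ j, ∀ i ≤ m, ∀ x, ‖iteratedDeriv i (neumann κ₁ q F j) x‖ ≤ A * (1 / 2) ^ j := by
    intro j
    induction j with
    | zero => simpa [neumann] using hA
    | succ j ih =>
      intro i hi x
      refine (norm_iteratedDeriv_mul_conv_le hκ₁i hq (hN j).1 (hN j).2 hQ0 hQ ih hi x).trans ?_
      calc _ ≤ 1 / 2 * (A * (1 / 2) ^ j) := by gcongr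
        _ = _ := by ring
  have hNb0 : ∀ j x, ‖neumann κ₁ q F j x‖ ≤ A * (1 / 2) ^ j := fun j x => by
    simpa using hNb j 0 (Nat.zero_le _) x
  have hgeo : Summable fun j : ℕ => A * (1 / 2 : ℝ) ^ j :=
    (summable_geometric_of_lt_one (by norm_num) (by norm_num)).mul_left A
  -- The Neumann series converges geometrically with all derivatives up to order m. It agrees with f
  -- because the same equation is a contraction in L¹.
  set G : ℝ → ℂ := fun x => ∑' j, neumann κ₁ q F j x with hG
  have hGs : ContDiff ℝ m G := by
    refine contDiff_tsum (N := (m : ℕ∞)) (v := fun _ j => A * (1 / 2 : ℝ) ^ j)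
      (fun j => (hN j).1.of_le (by exact_mod_cast le_top)) (fun _ _ => hgeo) fun k j x hk => ?_
    rw [norm_iteratedFDeriv_eq_norm_iteratedDeriv]
    exact hNb j k (by exact_mod_cast hk) x
  have hGb : ∀ x, ‖G x‖ ≤ ∑' j, A * (1 / 2 : ℝ) ^ j := fun x =>
    tsum_of_norm_bounded hgeo.hasSum fun j => hNb0 j x
  -- the Neumann series solves the equation
  have hGeq : ∀ x, G x = F x + q x * conv κ₁ G x := by
    intro x
    have hs : Summable fun j => neumann κ₁ q F j x :=
      Summable.of_norm_bounded hgeo fun j => hNb0 j x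
    have h1 : HasSum (fun j => conv κ₁ (neumann κ₁ q F j) x) (conv κ₁ G x) := by
      have h2 : ∀ j, Integrable fun t => κ₁ t * neumann κ₁ q F j (x - t) := fun j =>
        hκ₁i.mul_bdd (c := A * (1 / 2) ^ j)
          ((hN j).1.continuous.comp (continuous_const.sub continuous_id)).aestronglyMeasurable
          (Eventually.of_forall fun t => hNb0 j _)
      have h3 := hasSum_integral_of_summable_integral_norm h2 (by
        refine Summable.of_nonneg_of_le (fun j => integral_nonneg fun _ => norm_nonneg _)
          (fun j => ?_) (hgeo.mul_left (∫ t, ‖κ₁ t‖))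
        rw [← integral_mul_const]
        refine integral_mono (h2 j).norm (hκ₁i.norm.mul_const _) fun t => ?_
        simp only [norm_mul]
        gcongr
        exact hNb0 j _)
      simp only [tsum_mul_left] at h3
      exact h3
    have h4 := (h1.mul_left (q x)).tsum_eq
    rw [hG]
    simp only
    rw [hs.tsum_eq_zero_add, ← h4]
    rfl
  have hG0 : ∀ x, q x = 0 → G x = 0 := fun x hx => by simp [hGeq x, hF, hx]
  refine ⟨G, hGs, ?_, hG0⟩
  have hGc : Integrable G := by
    refine Continuous.integrable_of_hasCompactSupport hGs.continuous ?_
    refine hqc.mono fun x hx => ?_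
    contrapose! hx
    have hx' : q x = 0 := by simpa using hx
    simp [hG0 x hx']
  -- uniqueness in `L¹`
  set D := f - G with hD
  have hDi : Integrable D := hf.sub hGc
  have hDeq : ∀ᵐ x, ‖D x‖ ≤ Q * ‖conv κ₁ D x‖ := by
    filter_upwards [heq, hκ.ae_convolution_exists (ContinuousLinearMap.mul ℝ ℂ) hf,
      hκ₂i.ae_convolution_exists (ContinuousLinearMap.mul ℝ ℂ) hf,
      hκ₁i.ae_convolution_exists (ContinuousLinearMap.mul ℝ ℂ) hf,
      hκ₁i.ae_convolution_exists (ContinuousLinearMap.mul ℝ ℂ) hGc] with x h1 h2 h3 h4 h5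
    have h3' : Integrable (fun t => κ₂ t * f (x - t)) := h3
    have h4' : Integrable (fun t => κ₁ t * f (x - t)) := h4
    have h5' : Integrable (fun t => κ₁ t * G (x - t)) := h5
    have e1 : conv κ f x = conv κ₁ f x + conv κ₂ f x := by
      rw [conv, conv, conv, ← integral_add h4' h3']
      congr 1; ext t; simp only [hκ₁, Pi.sub_apply]; ring
    have e2 : conv κ₁ D x = conv κ₁ f x - conv κ₁ G x := by
      rw [conv, conv, conv, ← integral_sub h4' h5']
      congr 1; ext t; simp only [hD, Pi.sub_apply]; ring
    have e3 : D x = q x * conv κ₁ D x := by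
      rw [e2, hD, Pi.sub_apply, h1, hGeq x, e1, hF]; ring
    calc ‖D x‖ = ‖q x‖ * ‖conv κ₁ D x‖ := by rw [← norm_mul, ← e3]
      _ ≤ _ := by gcongr; simpa using hQ 0 (Nat.zero_le _) x
  have hconv := integral_norm_conv_le hκ₁i hDi
  have h1 : ∫ x, ‖D x‖ ≤ 1 / 2 * ∫ x, ‖D x‖ := by
    calc _ ≤ ∫ x, Q * ‖conv κ₁ D x‖ := integral_mono_ae hDi.norm (hconv.1.norm.const_mul Q) hDeq
      _ = Q * ∫ x, ‖conv κ₁ D x‖ := integral_const_mul _ _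
      _ ≤ Q * ((∫ t, ‖κ₁ t‖) * ∫ x, ‖D x‖) := by gcongr; exact hconv.2
      _ = (Q * ∫ t, ‖κ₁ t‖) * ∫ x, ‖D x‖ := by ring
      _ ≤ _ := by gcongr
  have h2 : ∫ x, ‖D x‖ = 0 :=
    le_antisymm (by linarith) (integral_nonneg fun _ => norm_nonneg _)
  have h3 := (integral_eq_zero_iff_of_nonneg (fun _ => norm_nonneg _) hDi.norm).1 h2
  filter_upwards [h3] with x hx
  have : D x = 0 := by simpa using hx
  exact sub_eq_zero.1 this

/-- An integrable solution of `f = q (κ ⋆ f)` agrees almost everywhere with a smooth one. -/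
theorem exists_smooth_of_eq_mul_conv {κ q f : ℝ → ℂ} (hκ : Integrable κ) (hq : ContDiff ℝ ∞ q)
    (hqc : HasCompactSupport q) (hf : Integrable f)
    (heq : f =ᵐ[volume] fun x => q x * conv κ f x) :
    ∃ g : ℝ → ℂ, ContDiff ℝ ∞ g ∧ HasCompactSupport g ∧ f =ᵐ[volume] g ∧
      ∀ x, g x = q x * conv κ g x := by
  choose g hg hfg hg0 using exists_contDiff_of_eq_mul_conv hκ hq hqc hf heq
  -- The representatives found for different m are continuous and equal almost everywhere, hence one
  -- function, of class C^m for all m.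
  have hgg : ∀ m, g m = g 0 := fun m =>
    (Continuous.ae_eq_iff_eq volume (hg m).continuous (hg 0).continuous).1
      ((hfg m).symm.trans (hfg 0))
  have hs : ContDiff ℝ ∞ (g 0) := contDiff_infty.2 fun m => by rw [← hgg m]; exact hg m
  have hconv : conv κ f = conv κ (g 0) := by
    rw [conv_eq_convolution, conv_eq_convolution]
    exact convolution_congr _ (ae_eq_refl _) (hfg 0)
  have hae : g 0 =ᵐ[volume] fun x => q x * conv κ (g 0) x := by
    rw [← hconv]; exact (hfg 0).symm.trans heq
  have hc : HasCompactSupport (g 0) := hqc.mono fun x hx hqx => hx (hg0 0 x hqx)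
  have hcont : Continuous (conv κ (g 0)) :=
    (contDiff_conv_right (n := 0) hκ.locallyIntegrable (hs.of_le (by simp)) hc).continuous
  have heq' := (Continuous.ae_eq_iff_eq volume hs.continuous (hq.continuous.mul hcont)).1 hae
  exact ⟨g 0, hs, hc, hfg 0, fun x => congrFun heq' x⟩

/-! ### Two pieces, with hypotheses on a set of full measure -/

/-- A version of `exists_mode_of_two_pieces` where all hypotheses are made on a set of full
measure. -/
theorem exists_mode_of_two_pieces_on {X : Type} [MeasurableSpace X] {ρ : Measure X}
    [IsFiniteMeasure ρ] {S U : Set X} (hS : MeasurableSet S) (hU : MeasurableSet U)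
    (hρU : ∀ᵐ x ∂ρ, x ∈ U) (hρ₁ : ρ S = 1) (hρ₂ : ρ Sᶜ = 1) {Ω : X → ℝ}
    (hΩ : Measurable Ω) {M : ℝ} (hM : ∀ x ∈ U, |Ω x| ≤ M) {K : X → X → ℝ} {C : NNReal}
    (hKm : Measurable (Function.uncurry K)) (hrow : ∀ x ∈ U, ∫⁻ y, ‖K x y‖ₑ ∂ρ ≤ C)
    (hcol : ∀ y ∈ U, ∫⁻ x, ‖K x y‖ₑ ∂ρ ≤ C)
    {a k : ℝ} {δ : NNReal} (hk : 0 < k) (hδ : (δ : ℝ) * 2 = k / 1536)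
    (hsymm : ∀ x ∈ U, ∀ y ∈ U, (x ∈ S ↔ y ∈ S) → K x y = K y x)
    (h₁₂ : ∀ x ∈ S ∩ U, ∀ y ∈ Sᶜ ∩ U, |K x y + k| ≤ δ)
    (h₂₁ : ∀ x ∈ Sᶜ ∩ U, ∀ y ∈ S ∩ U, |K x y - k| ≤ δ)
    (ha₁ : ∀ x ∈ S ∩ U, |Ω x - (∫ y in S, K x y ∂ρ) - a| ≤ δ)
    (ha₂ : ∀ x ∈ Sᶜ ∩ U, |Ω x - (∫ y in Sᶜ, K x y ∂ρ) - a| ≤ δ) :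
    ∃ z : ℂ, 0 < z.im ∧ ∃ h : X → ℂ, MemLp h 2 ρ ∧ ¬ (h =ᵐ[ρ] 0) ∧
      ∀ᵐ x ∂ρ, (Ω x : ℂ) * h x - ∫ y, (K x y : ℂ) * h y ∂ρ = z * h x := by
  classical
  -- Off U the data are replaced by the exact model: coupling ∓k, no interaction within a piece, Ω
  -- equal to a. All hypotheses then hold everywhere, while the operator changes only on a null set.
  set N : X → X → ℝ := fun x y => if x ∈ S then (if y ∈ S then 0 else -k) else
    (if y ∈ S then k else 0) with hN
  set K' : X → X → ℝ := fun x y => if x ∈ U ∧ y ∈ U then K x y else N x y with hK'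
  set Ω' : X → ℝ := fun x => if x ∈ U then Ω x else a with hΩ'
  have hNb : ∀ x y, |N x y| ≤ k := by
    intro x y
    simp only [hN]; split_ifs <;> simp [abs_of_pos hk, hk.le]
  have hNm : Measurable (Function.uncurry N) :=
    Measurable.ite (hS.preimage measurable_fst)
      (Measurable.ite (hS.preimage measurable_snd) measurable_const measurable_const)
      (Measurable.ite (hS.preimage measurable_snd) measurable_const measurable_const)
  have hK'm : Measurable (Function.uncurry K') :=
    Measurable.ite ((hU.preimage measurable_fst).inter (hU.preimage measurable_snd)) hKm hNm
  have hρ : ρ univ ≤ 2 := by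
    rw [← union_compl_self S, measure_union disjoint_compl_right hS.compl, hρ₁, hρ₂]
    norm_num
  have hconst : ∀ g : X → ℝ, (∀ y, |g y| ≤ k) →
      ∫⁻ y, ‖g y‖ₑ ∂ρ ≤ ((C + 2 * k.toNNReal : NNReal) : ENNReal) := by
    intro g hg
    calc ∫⁻ y, ‖g y‖ₑ ∂ρ ≤ ∫⁻ _, ENNReal.ofReal k ∂ρ := lintegral_mono fun y => by
          rw [← ofReal_norm]; exact ENNReal.ofReal_le_ofReal (hg y)
      _ ≤ 2 * ENNReal.ofReal k := by rw [lintegral_const, mul_comm]; gcongr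
      _ ≤ _ := by push_cast; exact le_add_self
  have hSchur : SchurKernel ρ K' (C + 2 * k.toNNReal) := by
    refine ⟨hK'm, fun x => ?_, fun y => ?_⟩
    · by_cases hx : x ∈ U
      · calc ∫⁻ y, ‖K' x y‖ₑ ∂ρ = ∫⁻ y, ‖K x y‖ₑ ∂ρ := lintegral_congr_ae (by
              filter_upwards [hρU] with y hy
              simp [hK', hx, hy])
          _ ≤ C := hrow x hx
          _ ≤ _ := by push_cast; exact le_self_add
      · exact hconst _ fun y => by simp [hK', hx, hNb]
    · by_cases hy : y ∈ U
      · calc ∫⁻ x, ‖K' x y‖ₑ ∂ρ = ∫⁻ x, ‖K x y‖ₑ ∂ρ := lintegral_congr_ae (by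
              filter_upwards [hρU] with x hx
              simp [hK', hx, hy])
          _ ≤ C := hcol y hy
          _ ≤ _ := by push_cast; exact le_self_add
      · exact hconst _ fun x => by simp [hK', hy, hNb]
  have hint : ∀ x ∈ U, ∀ A : Set X, ∫ y in A, K' x y ∂ρ = ∫ y in A, K x y ∂ρ := by
    intro x hx A
    refine integral_congr_ae (ae_restrict_of_ae ?_)
    filter_upwards [hρU] with y hy
    simp [hK', hx, hy]
  have hN0 : ∀ x y, (x ∈ S ↔ y ∈ S) → N x y = 0 := by
    intro x y h
    by_cases hx : x ∈ S <;> by_cases hy : y ∈ S <;> simp_all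
  obtain ⟨z, hz, h, hh, hh0, heq⟩ := exists_mode_of_two_pieces (ρ := ρ) (Ω := Ω') (M := max M |a|)
    (K := K') (a := a) hS hρ₁ hρ₂ (Measurable.ite hU hΩ measurable_const)
    (fun x => by
      by_cases hx : x ∈ U
      · simp only [hΩ', if_pos hx]; exact (hM x hx).trans (le_max_left _ _)
      · simp only [hΩ', if_neg hx]; exact le_max_right _ _) hSchur hk hδ
    (fun x y hxy => by
      by_cases hU' : x ∈ U ∧ y ∈ U
      · simp only [hK', if_pos hU', if_pos hU'.symm]; exact hsymm x hU'.1 y hU'.2 hxy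
      · have hU'' : ¬ (y ∈ U ∧ x ∈ U) := fun h => hU' h.symm
        simp only [hK', if_neg hU', if_neg hU'', hN0 x y hxy, hN0 y x hxy.symm])
    (fun x hx y hy => by
      by_cases hU' : x ∈ U ∧ y ∈ U
      · simp only [hK', if_pos hU']; exact h₁₂ x ⟨hx, hU'.1⟩ y ⟨hy, hU'.2⟩
      · simp only [hK', if_neg hU', hN, if_pos hx, if_neg hy]; simp)
    (fun x hx y hy => by
      by_cases hU' : x ∈ U ∧ y ∈ U
      · simp only [hK', if_pos hU']; exact h₂₁ x ⟨hx, hU'.1⟩ y ⟨hy, hU'.2⟩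
      · simp only [hK', if_neg hU', hN, if_neg hx, if_pos hy]; simp)
    (fun x hx => by
      by_cases hxU : x ∈ U
      · rw [hint x hxU]; simp only [hΩ', if_pos hxU]; exact ha₁ x ⟨hx, hxU⟩
      · have : ∫ y in S, K' x y ∂ρ = 0 := by
          rw [setIntegral_congr_fun (g := fun _ => (0 : ℝ)) hS fun y hy => by
            simp [hK', hxU, hN, hx, hy]]
          simp
        simp [hΩ', hxU, this])
    (fun x hx => by
      by_cases hxU : x ∈ U
      · rw [hint x hxU]; simp only [hΩ', if_pos hxU]; exact ha₂ x ⟨hx, hxU⟩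
      · have : ∫ y in Sᶜ, K' x y ∂ρ = 0 := by
          rw [setIntegral_congr_fun (g := fun _ => (0 : ℝ)) hS.compl fun y hy => by
            have hy' : y ∉ S := hy
            simp [hK', hxU, hN, hx, hy']]
          simp
        simp [hΩ', hxU, this])
  refine ⟨z, hz, h, hh, hh0, ?_⟩
  filter_upwards [heq, hρU] with x hx hxU
  have e : ∫ y, (K x y : ℂ) * h y ∂ρ = ∫ y, (K' x y : ℂ) * h y ∂ρ := by
    refine integral_congr_ae ?_
    filter_upwards [hρU] with y hy
    simp [hK', hxU, hy]
  rw [e, ← hx]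
  simp [hΩ', hxU]

/-! ### Radial kernels -/

/-- The kernel `κ_m` with the radial weights. -/
noncomputable def radKer (s : ℝ) (m : ℕ) (x y : ℝ) : ℝ :=
  Real.exp (-(s * (x + y))) * angKer s m (x - y)

/-- The continuous difference of the weighted kernels of the modes `1` and `n`. -/
noncomputable def radGap (s : ℝ) (n : ℕ) (x y : ℝ) : ℝ :=
  Real.exp (-(s * (x + y))) * angGap s n (x - y)

/-- The angular velocity, up to a constant factor, generated by the vorticity gradient `γ`. -/
noncomputable def radOmega (s : ℝ) (γ : ℝ → ℝ) (x : ℝ) : ℝ := ∫ y, radKer s 1 x y * γ y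

lemma measurable_radKer (s : ℝ) (m : ℕ) : Measurable (Function.uncurry (radKer s m)) := by
  have h1 : Measurable fun p : ℝ × ℝ => Real.exp (-(s * (p.1 + p.2))) := by fun_prop
  have h2 : Measurable fun p : ℝ × ℝ => angKer s m (p.1 - p.2) :=
    (measurable_angKer s m).comp (measurable_fst.sub measurable_snd)
  exact h1.mul h2

lemma radKer_symm (s : ℝ) (m : ℕ) (x y : ℝ) : radKer s m x y = radKer s m y x := by
  rw [radKer, radKer, ← angKer_neg, neg_sub, add_comm]

lemma continuous_radGap {s : ℝ} (h1 : 1 ≤ s) (h2 : s ≤ 3 / 2) {n : ℕ} (hn : 1 ≤ n) :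
    Continuous fun p : ℝ × ℝ => radGap s n p.1 p.2 := by
  have := continuous_angGap h1 h2 hn
  unfold radGap; fun_prop

lemma continuousAt_radKer {s : ℝ} (h1 : 1 ≤ s) (h2 : s ≤ 3 / 2) (m : ℕ) {x y : ℝ} (hxy : x ≠ y) :
    ContinuousAt (fun p : ℝ × ℝ => radKer s m p.1 p.2) (x, y) := by
  have e1 : ContinuousAt (fun p : ℝ × ℝ => Real.exp (-(s * (p.1 + p.2)))) (x, y) :=
    Continuous.continuousAt (by fun_prop)
  have e2 : ContinuousAt (fun p : ℝ × ℝ => p.1 - p.2) (x, y) :=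
    Continuous.continuousAt (by fun_prop)
  have e3 : ContinuousAt (angKer s m) ((fun p : ℝ × ℝ => p.1 - p.2) (x, y)) :=
    continuousAt_angKer h1 h2 m (sub_ne_zero.2 hxy)
  exact e1.mul (ContinuousAt.comp (f := fun p : ℝ × ℝ => p.1 - p.2) e3 e2)

lemma radKer_one_sub {s : ℝ} (h1 : 1 ≤ s) (h2 : s ≤ 3 / 2) (n : ℕ) {x y : ℝ} (hxy : x ≠ y) :
    radKer s 1 x y - radKer s n x y = radGap s n x y := by
  rw [radKer, radKer, radGap, angKer_one_sub h1 h2 n (sub_ne_zero.2 hxy)]; ring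

lemma integrable_radKer_mul {s : ℝ} (h1 : 1 ≤ s) (h2 : s ≤ 3 / 2) (m : ℕ) (x : ℝ) {γ : ℝ → ℝ}
    (hγ : Continuous γ) (hc : HasCompactSupport γ) : Integrable fun y => radKer s m x y * γ y := by
  have h3 := (hc.mul_left (f := fun y => Real.exp (-(s * (x + y))))).convolutionExists_right
    (ContinuousLinearMap.mul ℝ ℝ) (locallyIntegrable_angKer h1 h2 m)
    (by fun_prop) x |>.integrable_swap
  refine h3.congr (Eventually.of_forall fun y => ?_)
  simp only [ContinuousLinearMap.mul_apply', Pi.mul_apply, radKer]; ring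

/-- The weight e^{-s(x+y)} factors, leaving the convolution of a locally integrable kernel with a
test function, so the diagonal singularity costs no regularity. -/
lemma contDiff_radOmega {s : ℝ} (h1 : 1 ≤ s) (h2 : s ≤ 3 / 2) {γ : ℝ → ℝ} (hγ : ContDiff ℝ ∞ γ)
    (hc : HasCompactSupport γ) : ContDiff ℝ ∞ (radOmega s γ) := by
  have h3 := (hc.mul_left (f := fun y => Real.exp (-(s * y)))).contDiff_convolution_right (n := ⊤)
    (ContinuousLinearMap.mul ℝ ℝ) (locallyIntegrable_angKer h1 h2 1)
    (ContDiff.mul (by fun_prop) (by exact_mod_cast hγ))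
  have h4 : radOmega s γ = fun x => Real.exp (-(s * x)) *
      convolution (angKer s 1) (fun y => Real.exp (-(s * y)) * γ y)
        (ContinuousLinearMap.mul ℝ ℝ) volume x := by
    ext x
    rw [convolution_eq_swap, radOmega, ← integral_const_mul]
    congr 1; ext y
    simp only [ContinuousLinearMap.mul_apply', radKer, mul_add, neg_add, Real.exp_add]; ring
  rw [h4]
  exact ContDiff.mul (by fun_prop) (by exact_mod_cast h3)

/-! ### The two-bump profile and its reference measure -/

/-- Two disjoint smooth bumps of unit mass. -/
structure BumpPair (t₁ t₂ ε : ℝ) where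
  η₁ : ℝ → ℝ
  η₂ : ℝ → ℝ
  smooth₁ : ContDiff ℝ ∞ η₁
  smooth₂ : ContDiff ℝ ∞ η₂
  nonneg₁ : ∀ x, 0 ≤ η₁ x
  nonneg₂ : ∀ x, 0 ≤ η₂ x
  compact₁ : HasCompactSupport η₁
  compact₂ : HasCompactSupport η₂
  integral₁ : ∫ x, η₁ x = 1
  integral₂ : ∫ x, η₂ x = 1
  zero₁ : ∀ x, ε ≤ |x - t₁| → η₁ x = 0
  zero₂ : ∀ x, ε ≤ |x - t₂| → η₂ x = 0
  pos : 0 < ε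
  sep : t₁ + ε ≤ t₂ - ε

lemma exists_bumpPair {t₁ t₂ ε : ℝ} (hε : 0 < ε) (hsep : t₁ + ε ≤ t₂ - ε) :
    Nonempty (BumpPair t₁ t₂ ε) := by
  have h : ∀ t : ℝ, ∃ η : ℝ → ℝ, ContDiff ℝ ∞ η ∧ (∀ x, 0 ≤ η x) ∧ HasCompactSupport η ∧
      ∫ x, η x = 1 ∧ ∀ x, ε ≤ |x - t| → η x = 0 := by
    intro t
    let f : ContDiffBump t := ⟨ε / 2, ε, by linarith, by linarith⟩
    refine ⟨f.normed volume, f.contDiff_normed, f.nonneg_normed, f.hasCompactSupport_normed,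
      f.integral_normed, fun x hx => ?_⟩
    have : x ∉ Function.support (f.normed volume) := by
      rw [f.support_normed_eq, Metric.mem_ball, Real.dist_eq]
      exact not_lt.2 hx
    simpa using this
  obtain ⟨η₁, a1, a2, a3, a4, a5⟩ := h t₁
  obtain ⟨η₂, b1, b2, b3, b4, b5⟩ := h t₂
  exact ⟨⟨η₁, η₂, a1, b1, a2, b2, a3, b3, a4, b4, a5, b5, hε, hsep⟩⟩

namespace BumpPair

variable {t₁ t₂ ε : ℝ} (b : BumpPair t₁ t₂ ε)

/-- The left half line, which carries the first bump. -/
def left (_ : BumpPair t₁ t₂ ε) : Set ℝ := Iio (t₁ + ε)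

/-- The region where the bumps may be nonzero. -/
def region (_ : BumpPair t₁ t₂ ε) : Set ℝ := Ioo (t₁ - ε) (t₁ + ε) ∪ Ioo (t₂ - ε) (t₂ + ε)

/-- The vorticity profile. -/
def γ (x : ℝ) : ℝ := b.η₁ x - b.η₂ x

/-- The density of the reference measure. -/
def dens (x : ℝ) : ℝ := b.η₁ x + b.η₂ x

/-- The reference measure. -/
noncomputable def meas : Measure ℝ := volume.withDensity fun x => ENNReal.ofReal (b.dens x)

open Classical in
/-- The sign of the vorticity. -/
noncomputable def sgn (x : ℝ) : ℝ := if x ∈ b.left then 1 else -1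

lemma measurableSet_left : MeasurableSet b.left := measurableSet_Iio

lemma measurableSet_region : MeasurableSet b.region := measurableSet_Ioo.union measurableSet_Ioo

lemma dens_nonneg (x : ℝ) : 0 ≤ b.dens x := add_nonneg (b.nonneg₁ x) (b.nonneg₂ x)

lemma smooth_dens : ContDiff ℝ ∞ b.dens := b.smooth₁.add b.smooth₂

lemma smooth_γ : ContDiff ℝ ∞ b.γ := b.smooth₁.sub b.smooth₂

lemma compact_γ : HasCompactSupport b.γ := b.compact₁.sub b.compact₂

lemma compact_dens : HasCompactSupport b.dens := b.compact₁.add b.compact₂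

lemma measurable_sgn : Measurable b.sgn :=
  Measurable.ite b.measurableSet_left measurable_const measurable_const

lemma abs_sgn (x : ℝ) : |b.sgn x| = 1 := by unfold sgn; split_ifs <;> simp

lemma η₂_eq_zero {x : ℝ} (hx : x ∈ b.left) : b.η₂ x = 0 := by
  refine b.zero₂ x ?_
  have h1 := b.sep
  have h2 : x < t₁ + ε := hx
  rw [abs_sub_comm]
  exact le_trans (by linarith) (le_abs_self _)

lemma η₁_eq_zero {x : ℝ} (hx : x ∉ b.left) : b.η₁ x = 0 := by
  refine b.zero₁ x ?_
  have h2 : t₁ + ε ≤ x := not_lt.1 hx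
  exact le_trans (by linarith) (le_abs_self _)

/-- The sign of γ moves from the measure into the kernel. With respect to the positive measure the
kernel becomes K_n(x, y) sgn(y): symmetric within each bump, with opposite signs across them. -/
lemma sgn_mul_dens (x : ℝ) : b.sgn x * b.dens x = b.γ x := by
  by_cases h : x ∈ b.left
  · simp [sgn, h, dens, γ, b.η₂_eq_zero h]
  · simp [sgn, h, dens, γ, b.η₁_eq_zero h]

lemma dens_eq_zero {x : ℝ} (hx : x ∉ b.region) : b.dens x = 0 := by
  simp only [region, mem_union, mem_Ioo, not_or, not_and, not_lt] at hx
  have e1 : b.η₁ x = 0 := b.zero₁ x <| by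
    by_contra! h
    obtain ⟨h1, h2⟩ := abs_lt.1 h
    linarith [hx.1 (by linarith)]
  have e2 : b.η₂ x = 0 := b.zero₂ x <| by
    by_contra! h
    obtain ⟨h1, h2⟩ := abs_lt.1 h
    linarith [hx.2 (by linarith)]
  simp [dens, e1, e2]

lemma γ_eq_zero_iff (x : ℝ) : b.γ x = 0 ↔ b.dens x = 0 := by
  rw [← sgn_mul_dens, mul_eq_zero, or_iff_right]
  intro h
  have := b.abs_sgn x
  rw [h] at this; simp at this

lemma mem_region_left {x : ℝ} (hx : x ∈ b.left) (hx' : x ∈ b.region) : |x - t₁| < ε := by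
  have h1 : x < t₁ + ε := hx
  have h2 := b.sep
  rcases hx' with h | h
  · exact abs_lt.2 ⟨by linarith [h.1], by linarith⟩
  · linarith [h.1]

lemma mem_region_right {x : ℝ} (hx : x ∉ b.left) (hx' : x ∈ b.region) : |x - t₂| < ε := by
  have h1 : t₁ + ε ≤ x := not_lt.1 hx
  rcases hx' with h | h
  · linarith [h.2]
  · exact abs_lt.2 ⟨by linarith [h.1], by linarith [h.2]⟩

lemma measurable_ofReal_dens : Measurable fun x => ENNReal.ofReal (b.dens x) :=
  b.smooth_dens.continuous.measurable.ennreal_ofReal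

lemma ae_meas_iff {p : ℝ → Prop} :
    (∀ᵐ x ∂b.meas, p x) ↔ ∀ᵐ x, b.dens x ≠ 0 → p x := by
  rw [meas, ae_withDensity_iff b.measurable_ofReal_dens]
  refine eventually_congr (Eventually.of_forall fun x => ?_)
  rw [ne_eq, ENNReal.ofReal_eq_zero, not_le]
  exact ⟨fun h h0 => h ((b.dens_nonneg x).lt_of_ne' h0), fun h h0 => h h0.ne'⟩

lemma ae_mem_region : ∀ᵐ x ∂b.meas, x ∈ b.region := by
  rw [ae_meas_iff]
  refine Eventually.of_forall fun x hx => ?_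
  by_contra h
  exact hx (b.dens_eq_zero h)

lemma integral_meas (f : ℝ → ℂ) : ∫ x, f x ∂b.meas = ∫ x, (b.dens x : ℂ) * f x := by
  rw [meas, integral_withDensity_eq_integral_toReal_smul b.measurable_ofReal_dens (by simp)]
  congr 1; ext x
  rw [ENNReal.toReal_ofReal (b.dens_nonneg x)]; simp

lemma integral_meas_real (f : ℝ → ℝ) : ∫ x, f x ∂b.meas = ∫ x, b.dens x * f x := by
  rw [meas, integral_withDensity_eq_integral_toReal_smul b.measurable_ofReal_dens (by simp)]
  congr 1; ext x
  rw [ENNReal.toReal_ofReal (b.dens_nonneg x)]; simp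

lemma integrable_meas_iff {f : ℝ → ℝ} :
    Integrable f b.meas ↔ Integrable fun x => b.dens x * f x := by
  rw [meas, integrable_withDensity_iff_integrable_smul' b.measurable_ofReal_dens (by simp)]
  refine integrable_congr (Eventually.of_forall fun x => ?_)
  simp only [ENNReal.toReal_ofReal (b.dens_nonneg x), smul_eq_mul]

lemma integrable_meas_iff' {f : ℝ → ℂ} :
    Integrable f b.meas ↔ Integrable fun x => (b.dens x : ℂ) * f x := by
  rw [meas, integrable_withDensity_iff_integrable_smul' b.measurable_ofReal_dens (by simp)]
  refine integrable_congr (Eventually.of_forall fun x => ?_)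
  simp only [ENNReal.toReal_ofReal (b.dens_nonneg x), Complex.real_smul]

lemma lintegral_indicator_dens {A : Set ℝ} (hA : MeasurableSet A) {η : ℝ → ℝ}
    (hη : Continuous η) (hc : HasCompactSupport η) (h0 : ∀ x, 0 ≤ η x) (h1 : ∫ x, η x = 1)
    (hA' : ∀ x, η x = A.indicator b.dens x) : b.meas A = 1 := by
  rw [meas, withDensity_apply _ hA, ← lintegral_indicator hA]
  have : ∀ x, A.indicator (fun x => ENNReal.ofReal (b.dens x)) x = ENNReal.ofReal (η x) := by
    intro x
    rw [hA']
    by_cases h : x ∈ A <;> simp [h]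
  simp_rw [this]
  rw [← ofReal_integral_eq_lintegral_ofReal (hη.integrable_of_hasCompactSupport hc)
    (Eventually.of_forall h0), h1, ENNReal.ofReal_one]

lemma meas_left : b.meas b.left = 1 := by
  refine b.lintegral_indicator_dens b.measurableSet_left b.smooth₁.continuous b.compact₁ b.nonneg₁
    b.integral₁ fun x => ?_
  by_cases h : x ∈ b.left
  · simp [h, dens, b.η₂_eq_zero h]
  · simp [h, b.η₁_eq_zero h]

lemma meas_right : b.meas b.leftᶜ = 1 := by
  refine b.lintegral_indicator_dens b.measurableSet_left.compl b.smooth₂.continuous b.compact₂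
    b.nonneg₂ b.integral₂ fun x => ?_
  by_cases h : x ∈ b.left
  · simp [h, b.η₂_eq_zero h]
  · simp [h, dens, b.η₁_eq_zero h]

instance : IsFiniteMeasure b.meas := by
  refine ⟨?_⟩
  rw [← union_compl_self b.left, measure_union disjoint_compl_right b.measurableSet_left.compl,
    meas_left, meas_right]
  norm_num

lemma integral_γ : ∫ x, b.γ x = 0 := by
  simp only [γ]
  rw [integral_sub (b.smooth₁.continuous.integrable_of_hasCompactSupport b.compact₁)
    (b.smooth₂.continuous.integrable_of_hasCompactSupport b.compact₂), b.integral₁, b.integral₂,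
    sub_self]

/-- The kernel of the linearized operator with respect to the reference measure. -/
noncomputable def kernel (s : ℝ) (n : ℕ) (x y : ℝ) : ℝ := radKer s n x y * b.sgn y

lemma measurable_kernel (s : ℝ) (n : ℕ) : Measurable (Function.uncurry (b.kernel s n)) :=
  (measurable_radKer s n).mul (b.measurable_sgn.comp measurable_snd)

/-- The kernel `κ_m`, cut off far from the diagonal. -/
noncomputable def cutKer (_ : BumpPair t₁ t₂ ε) (s : ℝ) (m : ℕ) (x : ℝ) : ℝ :=
  (Icc (-(t₂ - t₁ + 2 * ε)) (t₂ - t₁ + 2 * ε)).indicator (angKer s m) x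

lemma integrable_cutKer {s : ℝ} (h1 : 1 ≤ s) (h2 : s ≤ 3 / 2) (m : ℕ) :
    Integrable (b.cutKer s m) :=
  (integrable_indicator_iff measurableSet_Icc).2
    ((locallyIntegrable_angKer h1 h2 m).integrableOn_isCompact isCompact_Icc)

lemma cutKer_sub (s : ℝ) (m : ℕ) {x y : ℝ} (hx : x ∈ b.region) (hy : y ∈ b.region) :
    b.cutKer s m (x - y) = angKer s m (x - y) := by
  refine indicator_of_mem ?_ _
  have h1 := b.sep
  have h0 := b.pos
  rcases hx with hx | hx <;> rcases hy with hy | hy <;>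
    exact ⟨by linarith [hx.1, hx.2, hy.1, hy.2], by linarith [hx.1, hx.2, hy.1, hy.2]⟩

lemma region_pos (hε : ε ≤ t₁) {x : ℝ} (hx : x ∈ b.region) : 0 < x := by
  have h1 := b.sep
  rcases hx with hx | hx <;> linarith [hx.1, b.pos]

/-- On the region x and y are positive, so the weight e^{-s(x+y)} is at most 1. The cut-off makes
the majorant an integrable function of x - y. -/
lemma enorm_kernel_le (hε : ε ≤ t₁) {s : ℝ} (hs : 0 ≤ s) (n : ℕ) {x y : ℝ} (hx : x ∈ b.region)
    (hy : y ∈ b.region) : ‖b.kernel s n x y‖ₑ ≤ ‖b.cutKer s n (x - y)‖ₑ := by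
  rw [b.cutKer_sub s n hx hy, enorm_le_iff_norm_le, kernel, radKer, norm_mul, norm_mul]
  rw [Real.norm_eq_abs (b.sgn y), abs_sgn, mul_one]
  refine mul_le_of_le_one_left (norm_nonneg _) ?_
  rw [Real.norm_of_nonneg (Real.exp_pos _).le, Real.exp_le_one_iff]
  have := b.region_pos hε hx
  have := b.region_pos hε hy
  have : 0 ≤ s * (x + y) := by positivity
  linarith

/-- C involves the supremum of the density and need not be uniform as the bumps shrink. It serves
only to define a bounded operator; the smallness in the perturbation argument does not involve it.
-/
lemma exists_schur_bound (hε : ε ≤ t₁) {s : ℝ} (h1 : 1 ≤ s) (h2 : s ≤ 3 / 2) (n : ℕ) :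
    ∃ C : NNReal, (∀ x ∈ b.region, ∫⁻ y, ‖b.kernel s n x y‖ₑ ∂b.meas ≤ C) ∧
      ∀ y ∈ b.region, ∫⁻ x, ‖b.kernel s n x y‖ₑ ∂b.meas ≤ C := by
  obtain ⟨D, hD⟩ := b.compact_dens.exists_bound_of_continuous b.smooth_dens.continuous
  have hI := (b.integrable_cutKer h1 h2 n).2
  rw [hasFiniteIntegral_iff_enorm] at hI
  have hmk : Measurable (b.cutKer s n) := (measurable_angKer s n).indicator measurableSet_Icc
  have key : ∀ g : ℝ → ENNReal, ∀ φ : ℝ → ℝ, MeasurePreserving φ →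
      (∀ y ∈ b.region, g y ≤ ‖b.cutKer s n (φ y)‖ₑ) →
      ∫⁻ y, g y ∂b.meas ≤ ENNReal.ofReal D * ∫⁻ t, ‖b.cutKer s n t‖ₑ := by
    intro g φ hφ hg
    calc ∫⁻ y, g y ∂b.meas ≤ ∫⁻ y, ‖b.cutKer s n (φ y)‖ₑ ∂b.meas := by
          refine lintegral_mono_ae ?_
          filter_upwards [b.ae_mem_region] with y hy
          exact hg y hy
      _ = ∫⁻ y, ENNReal.ofReal (b.dens y) * ‖b.cutKer s n (φ y)‖ₑ := by
          exact lintegral_withDensity_eq_lintegral_mul _ b.measurable_ofReal_dens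
            ((hmk.comp hφ.measurable).enorm)
      _ ≤ ∫⁻ y, ENNReal.ofReal D * ‖b.cutKer s n (φ y)‖ₑ := by
          gcongr with y; exact (le_abs_self _).trans (hD y)
      _ = ENNReal.ofReal D * ∫⁻ y, ‖b.cutKer s n (φ y)‖ₑ :=
          lintegral_const_mul' _ _ ENNReal.ofReal_ne_top
      _ = _ := by rw [hφ.lintegral_comp hmk.enorm]
  have hfin : ENNReal.ofReal D * ∫⁻ t, ‖b.cutKer s n t‖ₑ ≠ ⊤ :=
    (ENNReal.mul_lt_top ENNReal.ofReal_lt_top hI).ne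
  refine ⟨(ENNReal.ofReal D * ∫⁻ t, ‖b.cutKer s n t‖ₑ).toNNReal, fun x hx => ?_, fun y hy => ?_⟩
  · rw [ENNReal.coe_toNNReal hfin]
    exact key _ (fun y => x - y) (Measure.measurePreserving_sub_left volume x) fun y hy =>
      b.enorm_kernel_le hε (by linarith) n hx hy
  · rw [ENNReal.coe_toNNReal hfin]
    exact key _ (fun x => x - y) (measurePreserving_sub_right volume y) fun x hx =>
      b.enorm_kernel_le hε (by linarith) n hx hy

lemma integrable_radKer {s : ℝ} (h1 : 1 ≤ s) (h2 : s ≤ 3 / 2) (m : ℕ) (x : ℝ) :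
    Integrable (radKer s m x) b.meas := by
  rw [integrable_meas_iff]
  simpa only [mul_comm] using
    integrable_radKer_mul h1 h2 m x b.smooth_dens.continuous b.compact_dens

lemma radOmega_eq {s : ℝ} (h1 : 1 ≤ s) (h2 : s ≤ 3 / 2) (x : ℝ) :
    radOmega s b.γ x = (∫ y in b.left, radKer s 1 x y ∂b.meas) -
      ∫ y in b.leftᶜ, radKer s 1 x y ∂b.meas := by
  have hi := b.integrable_radKer h1 h2 1 x
  have e : radOmega s b.γ x = ∫ y, radKer s 1 x y * b.sgn y ∂b.meas := by
    rw [integral_meas_real, radOmega]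
    congr 1; ext y
    rw [← sgn_mul_dens]; ring
  have hi' : Integrable (fun y => radKer s 1 x y * b.sgn y) b.meas :=
    hi.mul_bdd (c := 1) b.measurable_sgn.aestronglyMeasurable
      (Eventually.of_forall fun y => by rw [Real.norm_eq_abs, abs_sgn])
  rw [e, ← integral_add_compl b.measurableSet_left hi', sub_eq_add_neg, ← integral_neg]
  congr 1
  · refine setIntegral_congr_fun b.measurableSet_left fun y hy => ?_
    simp [sgn, hy]
  · refine setIntegral_congr_fun b.measurableSet_left.compl fun y hy => ?_
    have : y ∉ b.left := hy
    simp [sgn, this]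

lemma abs_setIntegral_sub_le {A : Set ℝ} (hA : MeasurableSet A) (hA1 : b.meas A = 1)
    {g : ℝ → ℝ} (hg : Integrable g b.meas) {c δ : ℝ}
    (h : ∀ᵐ y ∂b.meas, y ∈ A → |g y - c| ≤ δ) : |(∫ y in A, g y ∂b.meas) - c| ≤ δ := by
  have e : (∫ y in A, g y ∂b.meas) - c = ∫ y in A, (g y - c) ∂b.meas := by
    rw [integral_sub hg.integrableOn (integrable_const _)]
    simp [measureReal_def, hA1]
  rw [e]
  have := norm_setIntegral_le_of_norm_le_const_ae (μ := b.meas) (s := A) (f := fun y => g y - c)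
    (C := δ) (by simp [hA1]) (by
      rw [ae_restrict_iff' hA]; exact h)
  simpa [measureReal_def, hA1] using this

lemma integrable_radGap {s : ℝ} (h1 : 1 ≤ s) (h2 : s ≤ 3 / 2) {n : ℕ} (hn : 1 ≤ n) (x : ℝ) :
    Integrable (radGap s n x) b.meas := by
  rw [integrable_meas_iff]
  have h := continuous_radGap h1 h2 hn
  have h' : Continuous (radGap s n x) := h.comp (continuous_const.prodMk continuous_id)
  exact (b.smooth_dens.continuous.mul h').integrable_of_hasCompactSupport b.compact_dens.mul_right

/-- The kernels may be singular on the diagonal, but only their difference appears in the diagonal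
entries of the limiting matrix, and it is the continuous gap off a null set. -/
lemma setIntegral_radKer_sub {s : ℝ} (h1 : 1 ≤ s) (h2 : s ≤ 3 / 2) (n : ℕ) (x : ℝ) (A : Set ℝ) :
    (∫ y in A, radKer s 1 x y ∂b.meas) - ∫ y in A, radKer s n x y ∂b.meas =
      ∫ y in A, radGap s n x y ∂b.meas := by
  rw [← integral_sub (b.integrable_radKer h1 h2 1 x).integrableOn
    (b.integrable_radKer h1 h2 n x).integrableOn]
  refine integral_congr_ae (ae_restrict_of_ae ?_)
  rw [ae_meas_iff]
  have : ∀ᵐ y : ℝ, y ≠ x := by simp [ae_iff]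
  filter_upwards [this] with y hy _
  exact radKer_one_sub h1 h2 n hy.symm

end BumpPair

/-! ### The growing mode of the two-bump profile -/

namespace BumpPair

variable {t₁ t₂ ε : ℝ} (b : BumpPair t₁ t₂ ε)

/-- On the left bump, Ω minus the self-interaction is the integral of the gap over that bump minus
that of K_1 over the other, hence close to g₁ - m. On the right bump all signs are reversed and the
value is close to m - g₂. The resonance `hres` makes both equal to a = g₁ - m. -/
lemma exists_mode (hε : ε ≤ t₁) {s : ℝ} (h1 : 1 ≤ s) (h2 : s ≤ 3 / 2) {n : ℕ} (hn : 1 ≤ n)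
    {k m g₁ g₂ : ℝ} {δ : NNReal} (hk : 0 < k) (hδ : (δ : ℝ) * 2 = k / 1536)
    (hkn : ∀ x y, |x - t₁| < ε → |y - t₂| < ε → |radKer s n x y - k| ≤ δ)
    (hk1 : ∀ x y, |x - t₁| < ε → |y - t₂| < ε → |radKer s 1 x y - m| ≤ δ / 2)
    (hg₁ : ∀ x y, |x - t₁| < ε → |y - t₁| < ε → |radGap s n x y - g₁| ≤ δ / 2)
    (hg₂ : ∀ x y, |x - t₂| < ε → |y - t₂| < ε → |radGap s n x y - g₂| ≤ δ / 2)
    (hres : g₁ + g₂ = 2 * m) :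
    ∃ z : ℂ, 0 < z.im ∧ ∃ h : ℝ → ℂ, MemLp h 2 b.meas ∧ ¬ (h =ᵐ[b.meas] 0) ∧
      ∀ᵐ x ∂b.meas, (radOmega s b.γ x : ℂ) * h x - ∫ y, (b.kernel s n x y : ℂ) * h y ∂b.meas =
        z * h x := by
  have hΩ := (contDiff_radOmega h1 h2 b.smooth_γ b.compact_γ).continuous
  obtain ⟨C, hrow, hcol⟩ := b.exists_schur_bound hε h1 h2 n
  obtain ⟨M, hM⟩ := (isCompact_Icc (a := t₁ - ε) (b := t₂ + ε)).exists_bound_of_continuousOn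
    hΩ.continuousOn
  have hsub : ∀ x ∈ b.region, x ∈ Icc (t₁ - ε) (t₂ + ε) := by
    intro x hx
    have h1 := b.sep
    have h0 := b.pos
    rcases hx with hx | hx <;> exact ⟨by linarith [hx.1, hx.2], by linarith [hx.1, hx.2]⟩
  have kl : ∀ x, ∀ y ∈ b.left, b.kernel s n x y = radKer s n x y := fun x y hy => by
    simp [kernel, sgn, hy]
  have kr : ∀ x, ∀ y ∈ b.leftᶜ, b.kernel s n x y = -radKer s n x y := fun x y hy => by
    have : y ∉ b.left := hy
    simp [kernel, sgn, this]
  refine exists_mode_of_two_pieces_on (a := g₁ - m) b.measurableSet_left b.measurableSet_region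
    b.ae_mem_region b.meas_left b.meas_right hΩ.measurable (M := M)
    (fun x hx => hM x (hsub x hx)) (b.measurable_kernel s n) hrow hcol hk hδ ?_ ?_ ?_ ?_ ?_
  · intro x _ y _ hxy
    by_cases hx : x ∈ b.left
    · rw [kl x y (hxy.1 hx), kl y x hx, radKer_symm]
    · have hy : y ∉ b.left := fun hy => hx (hxy.2 hy)
      rw [kr x y hy, kr y x hx, radKer_symm]
  · rintro x ⟨hx, hxU⟩ y ⟨hy, hyU⟩
    rw [kr x y hy, neg_add_eq_sub, abs_sub_comm]
    exact hkn x y (b.mem_region_left hx hxU) (b.mem_region_right hy hyU)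
  · rintro x ⟨hx, hxU⟩ y ⟨hy, hyU⟩
    rw [kl x y hy, radKer_symm]
    exact hkn y x (b.mem_region_left hy hyU) (b.mem_region_right hx hxU)
  · rintro x ⟨hx, hxU⟩
    have hx' := b.mem_region_left hx hxU
    rw [setIntegral_congr_fun b.measurableSet_left (kl x), radOmega_eq b h1 h2]
    have e1 := b.setIntegral_radKer_sub h1 h2 n x b.left
    have e2 := b.abs_setIntegral_sub_le b.measurableSet_left b.meas_left
      (b.integrable_radGap h1 h2 hn x) (c := g₁) (δ := δ / 2) (by
        filter_upwards [b.ae_mem_region] with y hyU hy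
        exact hg₁ x y hx' (b.mem_region_left hy hyU))
    have e3 := b.abs_setIntegral_sub_le b.measurableSet_left.compl b.meas_right
      (b.integrable_radKer h1 h2 1 x) (c := m) (δ := δ / 2) (by
        filter_upwards [b.ae_mem_region] with y hyU hy
        exact hk1 x y hx' (b.mem_region_right hy hyU))
    rw [abs_le] at e2 e3 ⊢
    constructor <;> linarith [e2.1, e2.2, e3.1, e3.2]
  · rintro x ⟨hx, hxU⟩
    have hx' := b.mem_region_right hx hxU
    rw [setIntegral_congr_fun b.measurableSet_left.compl (kr x), radOmega_eq b h1 h2, integral_neg]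
    have e1 := b.setIntegral_radKer_sub h1 h2 n x b.leftᶜ
    have e2 := b.abs_setIntegral_sub_le b.measurableSet_left.compl b.meas_right
      (b.integrable_radGap h1 h2 hn x) (c := g₂) (δ := δ / 2) (by
        filter_upwards [b.ae_mem_region] with y hyU hy
        exact hg₂ x y hx' (b.mem_region_right hy hyU))
    have e3 := b.abs_setIntegral_sub_le b.measurableSet_left b.meas_left
      (b.integrable_radKer h1 h2 1 x) (c := m) (δ := δ / 2) (by
        filter_upwards [b.ae_mem_region] with y hyU hy
        rw [radKer_symm]
        exact hk1 y x (b.mem_region_left hy hyU) hx')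
    rw [abs_le] at e2 e3 ⊢
    constructor <;> linarith [e2.1, e2.2, e3.1, e3.2]

/-- The function f₁ = E γ h, with E(t) = e^{-st}, solves f₁ = q (κ ⋆ f₁) for a convolution kernel κ.
The coefficient q is smooth because Ω is real and Im z > 0. Dividing the smooth representative by E
gives f, which is γ h up to a null set, and the equation now holds at every point. -/
lemma exists_smooth_mode (hε : ε ≤ t₁) {s : ℝ} (h1 : 1 ≤ s) (h2 : s ≤ 3 / 2) (n : ℕ)
    {z : ℂ} (hz : 0 < z.im) {h : ℝ → ℂ} (hh : MemLp h 2 b.meas) (hh0 : ¬ (h =ᵐ[b.meas] 0))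
    (heq : ∀ᵐ x ∂b.meas, (radOmega s b.γ x : ℂ) * h x -
      ∫ y, (b.kernel s n x y : ℂ) * h y ∂b.meas = z * h x) :
    ∃ f : ℝ → ℂ, ContDiff ℝ ∞ f ∧ HasCompactSupport f ∧ (∀ t, b.γ t = 0 → f t = 0) ∧ f ≠ 0 ∧
      ∀ t, ((radOmega s b.γ t : ℂ) - z) * f t = b.γ t * ∫ y, (radKer s n t y : ℂ) * f y := by
  have hγ := b.smooth_γ
  set E : ℝ → ℂ := fun t => ((Real.exp (-(s * t)) : ℝ) : ℂ) with hE
  have hEs : ContDiff ℝ ∞ E := by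
    have : ContDiff ℝ ∞ fun t : ℝ => Real.exp (-(s * t)) := by fun_prop
    exact Complex.ofRealCLM.contDiff.comp this
  have hγs : ContDiff ℝ ∞ fun t => (b.γ t : ℂ) := Complex.ofRealCLM.contDiff.comp hγ
  have hΩs : ContDiff ℝ ∞ fun t => (radOmega s b.γ t : ℂ) :=
    Complex.ofRealCLM.contDiff.comp (contDiff_radOmega h1 h2 b.smooth_γ b.compact_γ)
  have hne : ∀ t, (radOmega s b.γ t : ℂ) - z ≠ 0 := by
    intro t h0
    have := congrArg Complex.im h0
    simp at this
    exact hz.ne' this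
  have hE0 : ∀ t, E t ≠ 0 := fun t => by simp [hE]
  set q : ℝ → ℂ := fun t => b.γ t * (E t * E t * ((radOmega s b.γ t : ℂ) - z)⁻¹) with hq
  have hqs : ContDiff ℝ ∞ q :=
    hγs.mul ((hEs.mul hEs).mul ((hΩs.sub contDiff_const).inv hne))
  have hγc : HasCompactSupport fun t => (b.γ t : ℂ) :=
    b.compact_γ.comp_left (g := fun x : ℝ => (x : ℂ)) (by simp)
  have hqc : HasCompactSupport q := hγc.mul_right
  have hreg : ∀ t, b.γ t ≠ 0 → t ∈ b.region := by
    intro t ht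
    by_contra hc
    exact ht ((b.γ_eq_zero_iff t).2 (b.dens_eq_zero hc))
  set κ : ℝ → ℂ := fun t => (b.cutKer s n t : ℂ) with hκdef
  have hκ : Integrable κ := (b.integrable_cutKer h1 h2 n).ofReal
  set f₁ : ℝ → ℂ := fun t => E t * b.γ t * h t with hf₁def
  have hf₁ : Integrable f₁ := by
    have i1 : Integrable fun x => (b.dens x : ℂ) * h x :=
      b.integrable_meas_iff'.1 (hh.integrable one_le_two)
    -- e^{-sx} is unbounded on the line, but on the region x > 0 and the minimum with 1 changes
    -- nothing there; off the region the density vanishes.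
    have i2 : Integrable fun x => (b.dens x : ℂ) * h x *
        ((min 1 (Real.exp (-(s * x))) * b.sgn x : ℝ) : ℂ) := by
      refine i1.mul_bdd (c := 1) ?_ (Eventually.of_forall fun x => ?_)
      · have : Measurable fun x => min 1 (Real.exp (-(s * x))) * b.sgn x :=
          (Measurable.min measurable_const (by fun_prop)).mul b.measurable_sgn
        exact (Complex.measurable_ofReal.comp this).aestronglyMeasurable
      · rw [Complex.norm_real, norm_mul, Real.norm_eq_abs (b.sgn x), abs_sgn, mul_one,
          Real.norm_of_nonneg (le_min zero_le_one (Real.exp_pos _).le)]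
        exact min_le_left _ _
    refine i2.congr (Eventually.of_forall fun x => ?_)
    simp only [hf₁def]
    by_cases hx : x ∈ b.region
    · have hx0 := b.region_pos hε hx
      have : Real.exp (-(s * x)) ≤ 1 := by
        rw [Real.exp_le_one_iff]
        have : 0 ≤ s * x := by positivity
        linarith
      rw [min_eq_right this, ← sgn_mul_dens]
      simp only [hE]; push_cast; ring
    · have h0 := b.dens_eq_zero hx
      rw [(b.γ_eq_zero_iff x).2 h0, h0]; simp
  -- Cutting κ_n off far from the diagonal makes it integrable without changing the equation, since
  -- only differences of points of the region occur.
  have hcut : ∀ g : ℝ → ℂ, (∀ y, b.γ y = 0 → g y = 0) → ∀ t, b.γ t ≠ 0 →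
      conv κ g t = ∫ y, (angKer s n (t - y) : ℂ) * g y := by
    intro g hg t ht
    rw [conv_swap]
    congr 1; ext y
    by_cases hy : b.γ y = 0
    · simp [hg y hy]
    · simp only [hκdef]
      rw [b.cutKer_sub s n (hreg t ht) (hreg y hy)]
  have hrad : ∀ t y, (radKer s n t y : ℂ) = E t * (E y * angKer s n (t - y)) := by
    intro t y
    simp only [radKer, hE, mul_add, neg_add, Real.exp_add]; push_cast; ring
  have heq₁ : f₁ =ᵐ[volume] fun x => q x * conv κ f₁ x := by
    rw [ae_meas_iff] at heq
    filter_upwards [heq] with x hx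
    by_cases hx0 : b.γ x = 0
    · simp [hf₁def, hq, hx0]
    · rw [hcut f₁ (fun y hy => by simp [hf₁def, hy]) x hx0]
      have hx := hx (fun h0 => hx0 ((b.γ_eq_zero_iff x).2 h0))
      have e : ∫ y, (b.kernel s n x y : ℂ) * h y ∂b.meas =
          E x * ∫ y, (angKer s n (x - y) : ℂ) * f₁ y := by
        rw [integral_meas, ← integral_const_mul]
        congr 1; ext y
        simp only [kernel, hf₁def, ← sgn_mul_dens, ofReal_mul, hrad]
        ring
      rw [e] at hx
      have hx2 : E x * ∫ y, (angKer s n (x - y) : ℂ) * f₁ y =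
          ((radOmega s b.γ x : ℂ) - z) * h x := by linear_combination -hx
      have h3 := hne x
      calc f₁ x = E x * b.γ x * (((radOmega s b.γ x : ℂ) - z)⁻¹ *
            (((radOmega s b.γ x : ℂ) - z) * h x)) := by
              rw [inv_mul_cancel_left₀ h3]
        _ = _ := by rw [← hx2]; simp only [hq]; ring
  obtain ⟨g, hgs, hgc, hfg, hgeq⟩ := exists_smooth_of_eq_mul_conv hκ hqs hqc hf₁ heq₁
  have hg0 : ∀ y, b.γ y = 0 → g y = 0 := fun y hy => by rw [hgeq]; simp [hq, hy]
  refine ⟨fun t => g t * (E t)⁻¹, hgs.mul (hEs.inv hE0), hgc.mul_right,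
    fun t ht => by simp [hg0 t ht], ?_, ?_⟩
  · intro h0
    refine hh0 ?_
    change ∀ᵐ x ∂b.meas, h x = 0
    rw [ae_meas_iff]
    filter_upwards [hfg] with x hx hd
    have hgx : g x = 0 := by
      have := congrFun h0 x
      simpa [hE0 x] using this
    rw [hgx] at hx
    have hγx : b.γ x ≠ 0 := fun h0 => hd ((b.γ_eq_zero_iff x).1 h0)
    simpa [hf₁def, hE0 x, hγx] using hx
  · intro t
    by_cases ht : b.γ t = 0
    · simp [ht, hg0 t ht]
    · have e : ∫ y, (radKer s n t y : ℂ) * (g y * (E y)⁻¹) = E t * conv κ g t := by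
        rw [hcut g hg0 t ht, ← integral_const_mul]
        congr 1; ext y
        rw [hrad]
        have := hE0 y
        field_simp
      simp only
      rw [e, hgeq t]
      have h3 := hne t
      have h4 := hE0 t
      simp only [hq]
      field_simp

end BumpPair

/-- The existence of a growing mode for the radial problem. -/
theorem exists_radial_mode {s : ℝ} (h1 : 1 ≤ s) (h2 : s ≤ 3 / 2) {n : ℕ} (hn : 2 ≤ n) :
    ∃ γ : ℝ → ℝ, ContDiff ℝ ∞ γ ∧ HasCompactSupport γ ∧ (∀ t ≤ 1 / 2, γ t = 0) ∧
      ∫ t, γ t = 0 ∧ ∃ c : ℂ, 0 < c.im ∧ ∃ f : ℝ → ℂ, ContDiff ℝ ∞ f ∧ HasCompactSupport f ∧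
        (∀ t, γ t = 0 → f t = 0) ∧ f ≠ 0 ∧
        ∀ t, ((radOmega s γ t : ℂ) - c) * f t = γ t * ∫ y, (radKer s n t y : ℂ) * f y := by
  obtain ⟨τ, hτ, hres⟩ := exists_resonance h1 h2 hn
  have hn1 : 1 ≤ n := by omega
  set k := radKer s n 1 (1 + τ) with hk
  have hk0 : 0 < k := mul_pos (Real.exp_pos _)
    (angKer_pos (by linarith) hn1 (by simpa using hτ.ne'))
  -- This choice satisfies 2δ = k/1536, the margin of the perturbation theorem.
  set δ : NNReal := (k / 3072).toNNReal with hδ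
  have hδ' : (δ : ℝ) = k / 3072 := Real.coe_toNNReal _ (by positivity)
  have hδ0 : (0 : ℝ) < δ / 2 := by rw [hδ']; positivity
  have hne : (1 : ℝ) ≠ 1 + τ := by linarith
  have near : ∀ (F : ℝ × ℝ → ℝ) (a c : ℝ), ContinuousAt F (a, c) →
      ∀ᶠ ε in 𝓝[>] (0 : ℝ), ∀ x y, |x - a| < ε → |y - c| < ε → |F (x, y) - F (a, c)| ≤ δ / 2 := by
    intro F a c hF
    obtain ⟨r, hr, hr'⟩ := Metric.continuousAt_iff.1 hF (δ / 2) hδ0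
    filter_upwards [Ioo_mem_nhdsGT hr] with ε hε x y hx hy
    refine (hr' (x := (x, y)) ?_).le
    rw [Prod.dist_eq, max_lt_iff]
    exact ⟨hx.trans hε.2, hy.trans hε.2⟩
  have hG := (continuous_radGap h1 h2 hn1)
  -- All four kernels are nearly constant on thin bumps: K_n and K_1 off the diagonal, the gap also
  -- on it. The bound ε < 1/2 keeps the bumps to the right of 1/2, and ε < τ/4 keeps them apart.
  obtain ⟨ε, ⟨⟨hkn, hk1⟩, hg₁, hg₂⟩, hε⟩ :=
    (((near _ 1 (1 + τ) (continuousAt_radKer h1 h2 n hne)).and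
      (near _ 1 (1 + τ) (continuousAt_radKer h1 h2 1 hne))).and
      ((near _ 1 1 hG.continuousAt).and (near _ (1 + τ) (1 + τ) hG.continuousAt))).and
      (Ioo_mem_nhdsGT (show (0 : ℝ) < min (1 / 2) (τ / 4) by positivity)) |>.exists
  have hε1 := hε.2.trans_le (min_le_left _ _)
  have hε2 := hε.2.trans_le (min_le_right _ _)
  obtain ⟨b⟩ := exists_bumpPair hε.1 (show (1 : ℝ) + ε ≤ 1 + τ - ε by linarith)
  -- After factoring out e^{-s(t₁+t₂)}, the condition g₁ + g₂ = 2m reads G(0) (e^{sτ} + e^{-sτ}) = 2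
  -- κ_1(τ), the resonance.
  obtain ⟨z, hz, h, hh, hh0, heq⟩ := b.exists_mode (by linarith) h1 h2 hn1 hk0 (δ := δ)
    (m := radKer s 1 1 (1 + τ)) (g₁ := radGap s n 1 1) (g₂ := radGap s n (1 + τ) (1 + τ))
    (by rw [hδ']; ring) (fun x y hx hy => (hkn x y hx hy).trans (by linarith)) hk1 hg₁ hg₂ (by
      simp only [radKer, radGap, sub_self]
      rw [show (1 : ℝ) - (1 + τ) = -τ by ring, angKer_neg, hres, Real.cosh_eq,
        show -(s * (1 + 1)) = -(s * (1 + (1 + τ))) + s * τ by ring,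
        show -(s * (1 + τ + (1 + τ))) = -(s * (1 + (1 + τ))) + -(s * τ) by ring,
        Real.exp_add, Real.exp_add]
      ring)
  obtain ⟨f, hf⟩ := b.exists_smooth_mode (by linarith) h1 h2 n hz hh hh0 heq
  refine ⟨b.γ, b.smooth_γ, b.compact_γ, fun t ht => ?_, b.integral_γ, z, hz, f, hf⟩
  rw [b.γ_eq_zero_iff]
  refine b.dens_eq_zero fun hc => ?_
  rcases hc with hc | hc <;> linarith [hc.1]

/-! ### The principal value and its regularization -/

lemma measurable_bsKernel (α : ℝ) (j : Fin 2) : Measurable fun z => bsKernel α z j := by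
  have h : Measurable fun z : ℂ => ‖z‖ ^ (2 + α) := measurable_norm.pow_const _
  fin_cases j
  · exact measurable_im.neg.div h
  · exact measurable_re.div h

lemma bsKernel_neg (α : ℝ) (z : ℂ) (j : Fin 2) : bsKernel α (-z) j = -bsKernel α z j := by
  fin_cases j <;> simp [bsKernel, neg_div]

lemma abs_bsKernel_le {α : ℝ} (z : ℂ) (j : Fin 2) : |bsKernel α z j| ≤ ‖z‖ / ‖z‖ ^ (2 + α) := by
  have h : 0 ≤ ‖z‖ ^ (2 + α) := by positivity
  fin_cases j
  · simp only [bsKernel]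
    simp only [Fin.zero_eta, Matrix.cons_val_zero]
    rw [abs_div, abs_neg, abs_of_nonneg h]
    exact div_le_div_of_nonneg_right (abs_im_le_norm z) h
  · simp only [bsKernel]
    simp only [Fin.mk_one, Matrix.cons_val_one, Matrix.cons_val_fin_one]
    rw [abs_div, abs_of_nonneg h]
    exact div_le_div_of_nonneg_right (abs_re_le_norm z) h

lemma abs_bsKernel_mul_norm_le {α : ℝ} (z : ℂ) (j : Fin 2) :
    |bsKernel α z j| * ‖z‖ ≤ ‖z‖ ^ (-α) := by
  rcases eq_or_ne z 0 with rfl | hz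
  · simp; positivity
  have h : 0 < ‖z‖ := norm_pos_iff.2 hz
  calc |bsKernel α z j| * ‖z‖ ≤ ‖z‖ / ‖z‖ ^ (2 + α) * ‖z‖ := by
        gcongr; exact abs_bsKernel_le z j
    _ = ‖z‖ ^ (-α) := by
        rw [Real.rpow_add h, Real.rpow_neg h.le, Real.rpow_two]
        have := Real.rpow_pos_of_pos h α
        field_simp

/-- The Biot-Savart integral without its constant, as an absolutely convergent integral. -/
noncomputable def symmVelocity (α : ℝ) (θ : ℂ → ℂ) (x : ℂ) (j : Fin 2) : ℂ :=
  1 / 2 * ∫ z, (bsKernel α z j : ℂ) * (θ (x - z) - θ (x + z))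

section

variable {α : ℝ} {θ : ℂ → ℂ}

/-- The kernel is at most |z|^{-1-α} and the symmetric difference at most 2L|z|; the product
|z|^{-α} is locally integrable in the plane for α ≤ 1. Large z do not contribute, by compact
support. -/
lemma exists_bound_symmetric_difference (hα₁ : α ≤ 1) (hθ : ContDiff ℝ 1 θ)
    (hc : HasCompactSupport θ) (x : ℂ) (j : Fin 2) :
    ∃ g : ℂ → ℝ, Integrable g ∧
      ∀ z, ‖(bsKernel α z j : ℂ) * (θ (x - z) - θ (x + z))‖ ≤ g z := by
  obtain ⟨L, hL⟩ := hθ.lipschitzWith_of_hasCompactSupport hc one_ne_zero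
  obtain ⟨ρ, hρ⟩ := hc.isCompact.isBounded.subset_closedBall x
  have hloc : LocallyIntegrable (fun z : ℂ => ‖z‖ ^ (-α)) volume := by
    refine locallyIntegrable_of_norm_le_rpow (C := 1) (α := α) (by simp) ?_ ?_ ?_
    · rw [Complex.finrank_real_complex]; norm_num; linarith
    · refine Eventually.of_forall fun z => ?_
      rw [Real.norm_of_nonneg (by positivity), one_mul]
    · exact (measurable_norm.pow_const _).aestronglyMeasurable
  refine ⟨(Metric.closedBall 0 ρ).indicator fun z => 2 * L * ‖z‖ ^ (-α), ?_, fun z => ?_⟩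
  · rw [integrable_indicator_iff Metric.isClosed_closedBall.measurableSet]
    exact (hloc.integrableOn_isCompact (isCompact_closedBall 0 ρ)).const_mul _
  · have hz : z ∉ Metric.closedBall (0 : ℂ) ρ → θ (x - z) = 0 ∧ θ (x + z) = 0 := by
      intro hz
      rw [mem_closedBall_zero_iff, not_le] at hz
      constructor
      · refine image_eq_zero_of_notMem_tsupport fun h => ?_
        have := hρ h
        rw [Metric.mem_closedBall, dist_eq_norm] at this
        simp at this; linarith
      · refine image_eq_zero_of_notMem_tsupport fun h => ?_
        have := hρ h
        rw [Metric.mem_closedBall, dist_eq_norm] at this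
        simp at this; linarith
    by_cases hz' : z ∈ Metric.closedBall (0 : ℂ) ρ
    · rw [indicator_of_mem hz', norm_mul, Complex.norm_real, Real.norm_eq_abs]
      have h1 : ‖θ (x - z) - θ (x + z)‖ ≤ L * (2 * ‖z‖) := by
        have := hL.dist_le_mul (x - z) (x + z)
        rw [dist_eq_norm, dist_eq_norm] at this
        refine this.trans_eq ?_
        rw [show x - z - (x + z) = -(2 * z) by ring, norm_neg, norm_mul]
        simp
      calc |bsKernel α z j| * ‖θ (x - z) - θ (x + z)‖ ≤ |bsKernel α z j| * (L * (2 * ‖z‖)) := by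
            gcongr
        _ = 2 * L * (|bsKernel α z j| * ‖z‖) := by ring
        _ ≤ 2 * L * ‖z‖ ^ (-α) := by gcongr; exact abs_bsKernel_mul_norm_le z j
    · rw [indicator_of_notMem hz', (hz hz').1, (hz hz').2]; simp

/-- Even approximations of the Biot-Savart kernel all give the same velocity. -/
lemma tendsto_symmVelocity (hα₁ : α ≤ 1) (hθ : ContDiff ℝ 1 θ)
    (hc : HasCompactSupport θ) (x : ℂ) (j : Fin 2) {c : ℝ → ℂ → ℝ} (heven : ∀ p z, c p (-z) = c p z)
    (hle : ∀ p > 0, ∀ z, |c p z| ≤ 1) (hm : ∀ p, Measurable (c p))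
    (hlim : ∀ z, z ≠ 0 → Tendsto (fun p => c p z) (𝓝[>] 0) (𝓝 1))
    (hint : ∀ p > 0, Integrable fun z => ((bsKernel α z j * c p z : ℝ) : ℂ) * θ (x - z)) :
    Tendsto (fun p => ∫ z, ((bsKernel α z j * c p z : ℝ) : ℂ) * θ (x - z)) (𝓝[>] 0)
      (𝓝 (symmVelocity α θ x j)) := by
  -- The kernel is odd and the factor c even, so averaging the integral with its image under z ↦ -z
  -- produces the symmetric difference.
  have hsymm : ∀ p > 0, ∫ z, ((bsKernel α z j * c p z : ℝ) : ℂ) * θ (x - z) =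
      1 / 2 * ∫ z, (c p z : ℂ) * ((bsKernel α z j : ℂ) * (θ (x - z) - θ (x + z))) := by
    intro p hp
    have h1 := hint p hp
    have h2 : ∫ z, ((bsKernel α z j * c p z : ℝ) : ℂ) * θ (x - z) =
        ∫ z, -(((bsKernel α z j * c p z : ℝ) : ℂ) * θ (x + z)) := by
      rw [← integral_neg_eq_self]
      congr 1; ext z
      rw [bsKernel_neg, heven, sub_neg_eq_add]; push_cast; ring
    have h3 : Integrable fun z => -(((bsKernel α z j * c p z : ℝ) : ℂ) * θ (x + z)) := by
      refine h1.comp_neg.congr (Eventually.of_forall fun z => ?_)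
      simp only
      rw [bsKernel_neg, heven, sub_neg_eq_add]; push_cast; ring
    have h4 : ∫ z, (c p z : ℂ) * ((bsKernel α z j : ℂ) * (θ (x - z) - θ (x + z))) =
        (∫ z, ((bsKernel α z j * c p z : ℝ) : ℂ) * θ (x - z)) +
        ∫ z, -(((bsKernel α z j * c p z : ℝ) : ℂ) * θ (x + z)) := by
      rw [← integral_add h1 h3]
      congr 1; ext z; push_cast; ring
    rw [h4, ← h2]; ring
  refine Tendsto.congr' (f₁ := fun p =>
    1 / 2 * ∫ z, (c p z : ℂ) * ((bsKernel α z j : ℂ) * (θ (x - z) - θ (x + z)))) ?_ ?_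
  · filter_upwards [self_mem_nhdsWithin] with p hp using (hsymm p hp).symm
  · refine Tendsto.const_mul _ ?_
    obtain ⟨g, hg, hg'⟩ := exists_bound_symmetric_difference hα₁ hθ hc x j
    refine tendsto_integral_filter_of_dominated_convergence g ?_ ?_ hg ?_
    · refine Eventually.of_forall fun p => ?_
      have := measurable_bsKernel α j
      have h2 := hθ.continuous
      have h3 : Measurable fun z => θ (x - z) - θ (x + z) :=
        Continuous.measurable (by fun_prop)
      exact ((measurable_ofReal.comp (hm p)).mul
        ((measurable_ofReal.comp this).mul h3)).aestronglyMeasurable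
    · filter_upwards [self_mem_nhdsWithin] with p hp
      refine Eventually.of_forall fun z => ?_
      rw [norm_mul, Complex.norm_real]
      exact (mul_le_of_le_one_left (norm_nonneg _) (hle p hp z)).trans (hg' z)
    · have : ∀ᵐ z : ℂ, z ≠ 0 := by simp [ae_iff]
      filter_upwards [this] with z hz
      have h1 : Tendsto (fun p => (c p z : ℂ)) (𝓝[>] 0) (𝓝 ((1 : ℝ) : ℂ)) :=
        (continuous_ofReal.tendsto 1).comp (hlim z hz)
      simpa using h1.mul_const ((bsKernel α z j : ℂ) * (θ (x - z) - θ (x + z)))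

/-- Removing a ball is the even approximation given by the indicator of |z| > ε. -/
lemma isVelocity_symmVelocity (hα₀ : 0 ≤ α) (hα₁ : α ≤ 1) (hθ : ContDiff ℝ 1 θ)
    (hc : HasCompactSupport θ) :
    IsVelocity α θ fun x j => (bsConst α : ℂ) * symmVelocity α θ x j := by
  intro x j
  refine Tendsto.const_mul _ ?_
  classical
  have hmS : ∀ p : ℝ, MeasurableSet {z : ℂ | p < ‖z‖} := fun p =>
    measurableSet_lt measurable_const measurable_norm
  refine (tendsto_symmVelocity hα₁ hθ hc x j
    (c := fun p => {z : ℂ | p < ‖z‖}.indicator fun _ => 1) (fun p z => ?_) (fun p _ z => ?_)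
    (fun p => measurable_const.indicator (hmS p)) (fun z hz => ?_) (fun p hp => ?_)).congr
    fun p => ?_
  · simp [indicator]
  · by_cases h : p < ‖z‖ <;> simp [h]
  · refine tendsto_const_nhds.congr' ?_
    have : ∀ᶠ p in 𝓝[>] (0 : ℝ), p < ‖z‖ :=
      by
      filter_upwards [Ioo_mem_nhdsGT (norm_pos_iff.2 hz)] with p hp using hp.2
    filter_upwards [this] with p hp
    simp [hp]
  · have hi : Integrable fun z => θ (x - z) :=
      (hθ.continuous.integrable_of_hasCompactSupport hc).comp_sub_left x
    refine hi.bdd_mul (c := p ^ (-(1 + α))) ?_ (Eventually.of_forall fun z => ?_)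
    · exact (measurable_ofReal.comp ((measurable_bsKernel α j).mul
        (measurable_const.indicator (hmS p)))).aestronglyMeasurable
    · rw [Complex.norm_real, norm_mul]
      by_cases h : p < ‖z‖
      · have h0 : 0 < ‖z‖ := hp.trans h
        simp only [indicator, mem_ofPred_eq, h, if_true, norm_one, mul_one, Real.norm_eq_abs]
        calc |bsKernel α z j| ≤ ‖z‖ / ‖z‖ ^ (2 + α) := abs_bsKernel_le z j
          _ = ‖z‖ ^ (-(1 + α)) := by
            rw [← Real.rpow_one_sub' h0.le (by linarith)]; congr 1; ring
          _ ≤ p ^ (-(1 + α)) := Real.rpow_le_rpow_of_nonpos hp h.le (by linarith)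
      · simp only [indicator, mem_ofPred_eq, h, if_false, norm_zero, mul_zero]
        exact Real.rpow_nonneg hp.le _
  · rw [← integral_sub_left_eq_self (fun y => (_ : ℂ)) volume x,
      ← integral_indicator (by
        exact measurableSet_lt measurable_const (by fun_prop))]
    congr 1; ext y
    by_cases h : p < ‖x - y‖ <;> simp [indicator, h]

lemma velocity_eq (hα₀ : 0 ≤ α) (hα₁ : α ≤ 1) (hθ : ContDiff ℝ 1 θ)
    (hc : HasCompactSupport θ) :
    velocity α θ = fun x j => (bsConst α : ℂ) * symmVelocity α θ x j := by
  ext x j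
  exact (isVelocity_symmVelocity hα₀ hα₁ hθ hc x j).limUnder_eq

lemma isVelocity_velocity (hα₀ : 0 ≤ α) (hα₁ : α ≤ 1) (hθ : ContDiff ℝ 1 θ)
    (hc : HasCompactSupport θ) : IsVelocity α θ (velocity α θ) := by
  rw [velocity_eq hα₀ hα₁ hθ hc]
  exact isVelocity_symmVelocity hα₀ hα₁ hθ hc

/-- The regularized kernel `x^⊥ / (|x|² + δ)^s`. -/
noncomputable def regKernel (s δ : ℝ) (x : ℂ) : Fin 2 → ℝ :=
  ![-x.im * (normSq x + δ) ^ (-s), x.re * (normSq x + δ) ^ (-s)]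

lemma continuous_regKernel {s δ : ℝ} (hδ : 0 < δ) (j : Fin 2) :
    Continuous fun x => regKernel s δ x j := by
  have h : Continuous fun x : ℂ => (normSq x + δ) ^ (-s) :=
    (continuous_normSq.add continuous_const).rpow_const fun x =>
      Or.inl (by have := normSq_nonneg x; linarith : 0 < normSq x + δ).ne'
  fin_cases j
  · exact continuous_im.neg.mul h
  · exact continuous_re.mul h

/-- The ratio |z|^{2s} (|z|² + δ)^{-s} of the two kernels is even, at most 1, and tends to 1 off the
origin. The regularization therefore has the same limit as the truncation defining the principal
value. -/
lemma tendsto_regKernel (hα₀ : 0 ≤ α) (hα₁ : α ≤ 1) (hθ : ContDiff ℝ 1 θ)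
    (hc : HasCompactSupport θ) (x : ℂ) (j : Fin 2) :
    Tendsto (fun δ => ∫ y, (regKernel (1 + α / 2) δ (x - y) j : ℂ) * θ y) (𝓝[>] 0)
      (𝓝 (symmVelocity α θ x j)) := by
  set s := 1 + α / 2 with hs
  have hs0 : 0 < s := by positivity
  have hpow : ∀ z : ℂ, normSq z ^ s = ‖z‖ ^ (2 + α) := fun z => by
    rw [normSq_eq_norm_sq, ← Real.rpow_two, ← Real.rpow_mul (norm_nonneg z)]
    congr 1; rw [hs]; ring
  have hker : ∀ δ z, bsKernel α z j * (normSq z ^ s * (normSq z + δ) ^ (-s)) =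
      regKernel s δ z j := by
    intro δ z
    rcases eq_or_ne z 0 with rfl | hz
    · fin_cases j <;> simp [bsKernel, regKernel]
    have h : 0 < ‖z‖ ^ (2 + α) := Real.rpow_pos_of_pos (norm_pos_iff.2 hz) _
    rw [hpow]
    fin_cases j
    · simp [bsKernel, regKernel]; field_simp
    · simp [bsKernel, regKernel]; field_simp
  have hsw : ∀ δ, ∫ z, ((bsKernel α z j * (normSq z ^ s * (normSq z + δ) ^ (-s)) : ℝ) : ℂ) *
      θ (x - z) = ∫ y, (regKernel s δ (x - y) j : ℂ) * θ y := by
    intro δ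
    rw [← integral_sub_left_eq_self (fun y => (regKernel s δ (x - y) j : ℂ) * θ y) volume x]
    congr 1; ext z
    rw [hker, sub_sub_cancel]
  refine (tendsto_symmVelocity hα₁ hθ hc x j
    (c := fun δ z => normSq z ^ s * (normSq z + δ) ^ (-s)) (fun p z => by simp)
    (fun p hp z => ?_) (fun p => ?_) (fun z hz => ?_) (fun p hp => ?_)).congr hsw
  · have h0 := normSq_nonneg z
    have h1 : 0 < normSq z + p := by positivity
    rw [abs_of_nonneg (by positivity), Real.rpow_neg h1.le, ← div_eq_mul_inv]
    exact div_le_one_of_le₀ (Real.rpow_le_rpow h0 (by linarith [show (0 : ℝ) < p from hp]) hs0.le)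
      (by positivity)
  · exact (continuous_normSq.measurable.pow_const _).mul
      ((continuous_normSq.measurable.add_const _).pow_const _)
  · have h0 : 0 < normSq z := normSq_pos.2 hz
    have hcont : ContinuousAt (fun δ => normSq z ^ s * (normSq z + δ) ^ (-s)) 0 :=
      continuousAt_const.mul ((continuousAt_const.add continuousAt_id).rpow_const
        (Or.inl (by simpa using h0.ne')))
    have := hcont.tendsto.mono_left (nhdsWithin_le_nhds (s := Ioi (0 : ℝ)))
    rwa [add_zero, Real.rpow_neg h0.le, mul_inv_cancel₀ (Real.rpow_pos_of_pos h0 s).ne'] at this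
  · simp only [hker]
    have hk := continuous_regKernel (s := s) hp j
    refine Continuous.integrable_of_hasCompactSupport ?_ ?_
    · have := hθ.continuous
      exact (continuous_ofReal.comp hk).mul (by fun_prop)
    · exact (hc.comp_homeomorph (Homeomorph.subLeft x)).mul_left

end

/-! ### Logarithmic polar coordinates and the radial velocity -/

lemma integral_rotation (f : ℂ → ℂ) (φ : ℝ) : ∫ y, f y = ∫ y, f (exp (φ * I) * y) := by
  have h := (rotation (Circle.exp φ)).measurePreserving.integral_comp
    (rotation (Circle.exp φ)).toHomeomorph.measurableEmbedding f
  rw [← h]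
  simp [Circle.coe_exp]

/-- Integration over the plane in the coordinates `y = exp (t + i (φ + β))`. -/
lemma integral_eq_logPolar {f : ℂ → ℂ} (hf : Continuous f) (hc : HasCompactSupport f) (φ : ℝ) :
    ∫ y, f y = ∫ t : ℝ, ∫ β in Ioo (-Real.pi) Real.pi,
      (Real.exp t : ℂ) ^ 2 * f (exp (t + (φ + β : ℝ) * I)) := by
  obtain ⟨C, hC⟩ := hc.exists_bound_of_continuous hf
  obtain ⟨ρ, hρ0, hρ⟩ := hc.isCompact.isBounded.subset_closedBall_lt 0 0
  -- Rotating first makes β the angle relative to the direction of the evaluation point, so the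
  -- angular range is the same for every φ.
  rw [integral_rotation f φ, ← Complex.integral_comp_polarCoord_symm, polarCoord_target,
    Measure.volume_eq_prod, setIntegral_prod]
  · have e := integral_image_eq_integral_abs_deriv_smul (f := Real.exp) (f' := Real.exp)
      MeasurableSet.univ (fun x _ => (Real.hasDerivAt_exp x).hasDerivWithinAt)
      Real.exp_injective.injOn fun S => ∫ β in Ioo (-Real.pi) Real.pi,
        S • f (exp (φ * I) * Complex.polarCoord.symm (S, β))
    rw [image_univ, Real.range_exp] at e
    rw [e, setIntegral_univ]
    congr 1; ext t
    rw [← integral_smul]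
    congr 1; ext β
    rw [abs_of_pos (Real.exp_pos t), smul_smul, real_smul]
    simp only [Complex.polarCoord_symm_apply]
    congr 1
    · push_cast; ring
    · congr 1
      rw [ofReal_exp, ofReal_cos, ofReal_sin, ← Complex.exp_mul_I, ← Complex.exp_add,
        ← Complex.exp_add]
      congr 1; push_cast; ring
  · have hcont : Continuous fun p : ℝ × ℝ =>
        p.1 • f (exp (φ * I) * Complex.polarCoord.symm p) := by
      simp only [Complex.polarCoord_symm_apply]
      fun_prop
    have hs : IntegrableOn (fun p : ℝ × ℝ => p.1 • f (exp (φ * I) * Complex.polarCoord.symm p))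
        (Icc 0 ρ ×ˢ Icc (-Real.pi) Real.pi) :=
      hcont.continuousOn.integrableOn_compact (isCompact_Icc.prod isCompact_Icc)
    refine IntegrableOn.of_forall_sdiff_eq_zero (s := (Icc 0 ρ ×ˢ Icc (-Real.pi) Real.pi)) hs
      (measurableSet_Ioi.prod measurableSet_Ioo) ?_
    rintro ⟨S, β⟩ ⟨⟨hS, hβ⟩, hn⟩
    have hS' : ρ < S := by
      by_contra! h
      exact hn ⟨⟨(show (0 : ℝ) < S from hS).le, h⟩, ⟨hβ.1.le, hβ.2.le⟩⟩
    have : f (exp (φ * I) * Complex.polarCoord.symm (S, β)) = 0 := by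
      refine image_eq_zero_of_notMem_tsupport fun h => ?_
      have := hρ h
      rw [mem_closedBall_zero_iff, norm_mul, Complex.norm_exp_ofReal_mul_I, one_mul,
        Complex.norm_polarCoord_symm] at this
      exact absurd ((le_abs_self S).trans this) (not_le.2 hS')
    simp only [this, smul_zero]

/-- The regularization of the weighted kernel of the `m`-th mode. -/
noncomputable def regKer (s : ℝ) (m : ℕ) (δ r t : ℝ) : ℝ :=
  ∫ β in Ioo (-Real.pi) Real.pi,
    angWeight m β * (Real.exp (r + t) * angDen (r - t) β + δ) ^ (-s)

lemma rpow_angDen_eq (s r t β : ℝ) : (Real.exp (r + t) * angDen (r - t) β) ^ (-s) =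
    Real.exp (-(s * (r + t))) * angDen (r - t) β ^ (-s) := by
  rw [Real.mul_rpow (Real.exp_pos _).le (angDen_nonneg _ _), ← Real.exp_mul]
  congr 2; ring

lemma abs_regInt_le {s : ℝ} (hs : 0 ≤ s) (m : ℕ) {δ : ℝ} (hδ : 0 ≤ δ) {r t : ℝ} (hrt : r ≠ t)
    (β : ℝ) : |angWeight m β * (Real.exp (r + t) * angDen (r - t) β + δ) ^ (-s)| ≤
      Real.exp (-(s * (r + t))) * (angWeight 1 β * angDen (r - t) β ^ (-s)) := by
  have h0 : 0 < Real.exp (r + t) * angDen (r - t) β :=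
    mul_pos (Real.exp_pos _) (angDen_pos_of_ne (sub_ne_zero.2 hrt) β)
  rw [abs_mul, abs_of_nonneg (Real.rpow_nonneg (by linarith) _), angWeight_one]
  calc |angWeight m β| * (Real.exp (r + t) * angDen (r - t) β + δ) ^ (-s)
      ≤ Real.sin β ^ 2 * (Real.exp (r + t) * angDen (r - t) β) ^ (-s) := by
        refine mul_le_mul (abs_angWeight_le m β) ?_ (Real.rpow_nonneg (by linarith) _)
          (sq_nonneg _)
        exact Real.rpow_le_rpow_of_nonpos h0 (by linarith) (by linarith)
    _ = _ := by rw [rpow_angDen_eq]; ring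

lemma aestronglyMeasurable_regInt (s : ℝ) (m : ℕ) (δ r t : ℝ) (μ : Measure ℝ) :
    AEStronglyMeasurable (fun β => angWeight m β *
      (Real.exp (r + t) * angDen (r - t) β + δ) ^ (-s)) μ := by
  have h : Continuous fun β => Real.exp (r + t) * angDen (r - t) β + δ := by
    unfold angDen; fun_prop
  exact ((continuous_angWeight m).measurable.mul (h.measurable.pow_const _)).aestronglyMeasurable

/-- Adding δ only decreases the negative power, and the first weight dominates all others. The
majorant is independent of δ and locally integrable in t, which permits δ → 0. -/
lemma abs_regKer_le {s : ℝ} (h1 : 1 ≤ s) (h2 : s ≤ 3 / 2) (m : ℕ) {δ : ℝ} (hδ : 0 ≤ δ) {r t : ℝ}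
    (hrt : r ≠ t) : |regKer s m δ r t| ≤ radKer s 1 r t := by
  rw [regKer, radKer, angKer, ← integral_const_mul]
  exact norm_integral_le_of_norm_le (f := fun β => angWeight m β *
      (Real.exp (r + t) * angDen (r - t) β + δ) ^ (-s))
    ((integrableOn_angInt h1 h2 1 (sub_ne_zero.2 hrt)).const_mul _)
    (Eventually.of_forall fun β => abs_regInt_le (by linarith) m hδ hrt β)

lemma tendsto_regKer {s : ℝ} (h1 : 1 ≤ s) (h2 : s ≤ 3 / 2) (m : ℕ) {r t : ℝ} (hrt : r ≠ t) :
    Tendsto (fun δ => regKer s m δ r t) (𝓝[>] 0) (𝓝 (radKer s m r t)) := by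
  rw [radKer, angKer, ← integral_const_mul]
  refine tendsto_integral_filter_of_dominated_convergence _
    (Eventually.of_forall fun δ => aestronglyMeasurable_regInt s m δ r t _) ?_
    ((integrableOn_angInt h1 h2 1 (sub_ne_zero.2 hrt)).const_mul (Real.exp (-(s * (r + t)))))
    (Eventually.of_forall fun β => ?_)
  · filter_upwards [self_mem_nhdsWithin] with δ hδ
    exact Eventually.of_forall fun β => abs_regInt_le (by linarith) m (le_of_lt hδ) hrt β
  · have h0 : 0 < Real.exp (r + t) * angDen (r - t) β :=
      mul_pos (Real.exp_pos _) (angDen_pos_of_ne (sub_ne_zero.2 hrt) β)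
    have hcont : ContinuousAt (fun δ => angWeight m β *
        (Real.exp (r + t) * angDen (r - t) β + δ) ^ (-s)) 0 :=
      continuousAt_const.mul ((continuousAt_const.add continuousAt_id).rpow_const
        (Or.inl (by simpa using h0.ne')))
    have := hcont.tendsto.mono_left (nhdsWithin_le_nhds (s := Ioi (0 : ℝ)))
    rw [add_zero, rpow_angDen_eq] at this
    convert this using 2
    ring

lemma measurable_regKer (s : ℝ) (m : ℕ) (δ r : ℝ) : Measurable (regKer s m δ r) := by
  unfold regKer
  refine StronglyMeasurable.measurable (StronglyMeasurable.integral_prod_right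
    (f := fun t β => angWeight m β * (Real.exp (r + t) * angDen (r - t) β + δ) ^ (-s)) ?_)
  have h : Continuous fun p : ℝ × ℝ => Real.exp (r + p.1) * angDen (r - p.1) p.2 + δ := by
    unfold angDen; fun_prop
  exact (((continuous_angWeight m).measurable.comp measurable_snd).mul
    (h.measurable.pow_const _)).stronglyMeasurable

lemma tendsto_integral_regKer {s : ℝ} (h1 : 1 ≤ s) (h2 : s ≤ 3 / 2) (m : ℕ) (r : ℝ) {G : ℝ → ℂ}
    (hG : Continuous G) (hc : HasCompactSupport G) :
    Tendsto (fun δ => ∫ t, (regKer s m δ r t : ℂ) * G t) (𝓝[>] 0)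
      (𝓝 (∫ t, (radKer s m r t : ℂ) * G t)) := by
  have hne : ∀ᵐ t : ℝ, r ≠ t := by
    have : ∀ᵐ t : ℝ, t ≠ r := by simp [ae_iff]
    filter_upwards [this] with t ht using ht.symm
  refine tendsto_integral_filter_of_dominated_convergence (fun t => radKer s 1 r t * ‖G t‖)
    (Eventually.of_forall fun δ => ?_) ?_ (integrable_radKer_mul h1 h2 1 r hG.norm hc.norm) ?_
  · exact ((measurable_ofReal.comp (measurable_regKer s m δ r)).mul
      hG.measurable).aestronglyMeasurable
  · filter_upwards [self_mem_nhdsWithin] with δ hδ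
    filter_upwards [hne] with t ht
    rw [norm_mul, Complex.norm_real]
    exact mul_le_mul_of_nonneg_right (abs_regKer_le h1 h2 m (le_of_lt hδ) ht) (norm_nonneg _)
  · filter_upwards [hne] with t ht
    exact ((continuous_ofReal.tendsto _).comp (tendsto_regKer h1 h2 m ht)).mul_const _

lemma normSq_sub_logPolar (r t φ β : ℝ) :
    normSq (exp (r + φ * I) - exp (t + (φ + β : ℝ) * I)) =
      Real.exp (r + t) * angDen (r - t) β := by
  have h1 := Real.sin_sq_add_cos_sq φ
  have h2 := Real.sin_sq_add_cos_sq (φ + β)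
  have h3 : Real.cos β = Real.cos φ * Real.cos (φ + β) + Real.sin φ * Real.sin (φ + β) := by
    rw [← Real.cos_sub, ← Real.cos_neg]; ring_nf
  have h4 : Real.exp (r + t) * (2 * Real.cosh (r - t)) = Real.exp r ^ 2 + Real.exp t ^ 2 := by
    rw [Real.cosh_eq, mul_div_cancel₀ _ two_ne_zero, mul_add, ← Real.exp_add, ← Real.exp_add,
      ← Real.exp_nat_mul, ← Real.exp_nat_mul]
    congr 2 <;> (push_cast; ring)
  rw [angDen, mul_sub, h4, h3, normSq_apply, Real.exp_add]
  simp only [sub_re, sub_im, Complex.exp_re, Complex.exp_im, add_re, add_im, ofReal_re, ofReal_im,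
    mul_re, mul_im, I_re, I_im, mul_zero, mul_one, sub_zero, zero_add, add_zero]
  linear_combination Real.exp r ^ 2 * h1 + Real.exp t ^ 2 * h2

/-- X · (X - y)^⊥ is this cross product, so it is the factor of the kernel in the radial component
of the velocity. -/
lemma cross_logPolar (r t φ β : ℝ) :
    (exp (r + φ * I)).re * (exp (t + (φ + β : ℝ) * I)).im -
      (exp (r + φ * I)).im * (exp (t + (φ + β : ℝ) * I)).re = Real.exp (r + t) * Real.sin β := by
  have h3 : Real.sin β = Real.sin (φ + β) * Real.cos φ - Real.cos (φ + β) * Real.sin φ := by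
    rw [← Real.sin_sub]; ring_nf
  rw [h3, Real.exp_add]
  simp only [Complex.exp_re, Complex.exp_im, add_re, add_im, ofReal_re, ofReal_im,
    mul_re, mul_im, I_re, I_im, mul_zero, mul_one, sub_zero, zero_add, add_zero]
  ring

/-- X^⊥ · (X - y)^⊥ = |X|² - X · y, hence this product governs the angular component. -/
lemma dot_logPolar (r t φ β : ℝ) :
    (exp (r + φ * I)).re * (exp (t + (φ + β : ℝ) * I)).re +
      (exp (r + φ * I)).im * (exp (t + (φ + β : ℝ) * I)).im = Real.exp (r + t) * Real.cos β := by
  have h3 : Real.cos β = Real.cos φ * Real.cos (φ + β) + Real.sin φ * Real.sin (φ + β) := by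
    rw [← Real.cos_sub, ← Real.cos_neg]; ring_nf
  rw [h3, Real.exp_add]
  simp only [Complex.exp_re, Complex.exp_im, add_re, add_im, ofReal_re, ofReal_im,
    mul_re, mul_im, I_re, I_im, mul_zero, mul_one, sub_zero, zero_add, add_zero]
  ring

lemma setIntegral_odd {g : ℝ → ℂ} {a : ℝ}
    (h : ∀ x, g (-x) = -g x) : ∫ x in Ioo (-a) a, g x = 0 := by
  have e : ∫ x in Ioo (-a) a, g x = -∫ x in Ioo (-a) a, g x := by
    rw [← integral_indicator measurableSet_Ioo, ← integral_neg, ← integral_neg_eq_self]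
    congr 1; ext x
    by_cases hx : x ∈ Ioo (-a) a
    · have : -x ∈ Ioo (-a) a := ⟨by linarith [hx.2], by linarith [hx.1]⟩
      simp [hx, this, h]
    · have : -x ∉ Ioo (-a) a := fun hx' => hx ⟨by linarith [hx'.2], by linarith [hx'.1]⟩
      simp [hx, this]
  exact self_eq_neg.1 e

lemma integrable_regKernel_mul {s δ : ℝ} (hδ : 0 < δ) {θ : ℂ → ℂ} (hθ : Continuous θ)
    (hc : HasCompactSupport θ) (x : ℂ) (j : Fin 2) :
    Integrable fun y => (regKernel s δ (x - y) j : ℂ) * θ y := by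
  have hk : Continuous fun y => regKernel s δ (x - y) j :=
    (continuous_regKernel hδ j).comp (continuous_const.sub continuous_id)
  exact ((continuous_ofReal.comp hk).mul hθ).integrable_of_hasCompactSupport hc.mul_left

/-- The radial component of the regularized velocity of a purely `n`-fold symmetric function. -/
lemma radial_regKernel {s δ : ℝ} (hδ : 0 < δ) (n : ℕ) {W : ℂ → ℂ} (hW : Continuous W)
    (hc : HasCompactSupport W) {w : ℝ → ℂ}
    (hw : ∀ t φ : ℝ, W (exp (t + φ * I)) = w t * exp (n * φ * I)) (r φ : ℝ) :
    ((exp (r + φ * I)).re : ℂ) * (∫ y, (regKernel s δ (exp (r + φ * I) - y) 0 : ℂ) * W y) +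
      ((exp (r + φ * I)).im : ℂ) * (∫ y, (regKernel s δ (exp (r + φ * I) - y) 1 : ℂ) * W y) =
    I * n * exp (n * φ * I) * ∫ t, (regKer s n δ r t : ℂ) *
      ((Real.exp r : ℂ) * ((Real.exp t : ℂ) ^ 3 * w t)) := by
  set X := exp (r + φ * I) with hX
  rw [← integral_const_mul, ← integral_const_mul, ← integral_add
    ((integrable_regKernel_mul hδ hW hc X 0).const_mul _)
    ((integrable_regKernel_mul hδ hW hc X 1).const_mul _)]
  have e1 : ∀ y, (X.re : ℂ) * ((regKernel s δ (X - y) 0 : ℂ) * W y) +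
      (X.im : ℂ) * ((regKernel s δ (X - y) 1 : ℂ) * W y) =
      (((X.re * y.im - X.im * y.re) * (normSq (X - y) + δ) ^ (-s) : ℝ) : ℂ) * W y := by
    intro y
    simp only [regKernel, Matrix.cons_val_zero, Matrix.cons_val_one, Matrix.cons_val_fin_one,
      sub_re, sub_im]
    push_cast; ring
  simp only [e1]
  have hcont : Continuous fun y : ℂ => (normSq (X - y) + δ) ^ (-s) :=
    ((continuous_normSq.comp (continuous_const.sub continuous_id)).add
      continuous_const).rpow_const fun x =>
      Or.inl (by have := normSq_nonneg (X - x); simp; linarith : 0 < normSq (X - x) + δ).ne'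
  rw [integral_eq_logPolar (f := fun y => (((X.re * y.im - X.im * y.re) *
    (normSq (X - y) + δ) ^ (-s) : ℝ) : ℂ) * W y) (by fun_prop) hc.mul_left φ, ← integral_const_mul]
  congr 1; ext t
  simp only [cross_logPolar, hX, normSq_sub_logPolar, hw]
  set Q : ℝ → ℝ := fun β => (Real.exp (r + t) * angDen (r - t) β + δ) ^ (-s) with hQ
  have hD : Continuous fun β => Real.exp (r + t) * angDen (r - t) β + δ := by
    unfold angDen; fun_prop
  have hQc : Continuous Q := hD.rpow_const fun β => Or.inl (by
    have := mul_nonneg (Real.exp_pos (r + t)).le (angDen_nonneg (r - t) β)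
    linarith : 0 < Real.exp (r + t) * angDen (r - t) β + δ).ne'
  have hi : ∀ g : ℝ → ℝ, Continuous g → IntegrableOn (fun β => ((g β * Q β : ℝ) : ℂ))
      (Ioo (-Real.pi) Real.pi) := fun g hg =>
    ((continuous_ofReal.comp (hg.mul hQc)).integrableOn_Icc).mono_set Ioo_subset_Icc_self
  -- Of e^{inβ} only the sine part survives against the odd factor sin β; this is the source of the
  -- factor i and of the weight sin β sin(nβ).
  have hodd : ∫ β in Ioo (-Real.pi) Real.pi,
      ((Real.sin β * Real.cos (n * β) * Q β : ℝ) : ℂ) = 0 := by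
    refine setIntegral_odd fun β => ?_
    simp [hQ, angDen]
  have hsin : ∀ β, Real.sin β * Real.sin (n * β) = n * angWeight n β := by
    intro β
    rcases Nat.eq_zero_or_pos n with rfl | hn
    · simp
    · have : (n : ℝ) ≠ 0 := by positivity
      rw [angWeight]; field_simp
  calc _ = ∫ β in Ioo (-Real.pi) Real.pi, ((Real.exp t : ℂ) ^ 2 * Real.exp (r + t) * w t *
        exp (n * φ * I)) * (((Real.sin β * Real.cos (n * β) * Q β : ℝ) : ℂ) +
          I * ((Real.sin β * Real.sin (n * β) * Q β : ℝ) : ℂ)) := by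
        congr 1; ext β
        have : exp ((n : ℂ) * ((φ + β : ℝ) : ℂ) * I) = exp (n * φ * I) *
            (((Real.cos (n * β) : ℝ) : ℂ) + ((Real.sin (n * β) : ℝ) : ℂ) * I) := by
          rw [ofReal_cos, ofReal_sin, ← Complex.exp_mul_I, ← Complex.exp_add]
          congr 1; push_cast; ring
        rw [this]
        simp only [hQ]; push_cast; ring
    _ = (Real.exp t : ℂ) ^ 2 * Real.exp (r + t) * w t * exp (n * φ * I) * (I *
          (n * (regKer s n δ r t : ℂ))) := by
        rw [integral_const_mul, integral_add (hi _ (by fun_prop)) ((hi _ (by fun_prop)).const_mul I),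
          hodd, zero_add, integral_const_mul, integral_complex_ofReal]
        simp only [hsin, mul_assoc, integral_const_mul, regKer]
        push_cast; rfl
    _ = _ := by rw [Real.exp_add]; push_cast; ring

/-! ### The angular velocity of a vortex through its gradient -/

/-- The regularized squared distance in polar coordinates. -/
noncomputable def regDen (δ r t β : ℝ) : ℝ :=
  Real.exp r ^ 2 + Real.exp t ^ 2 - 2 * (Real.exp r * Real.exp t) * Real.cos β + δ

lemma regDen_eq (δ r t β : ℝ) : regDen δ r t β = Real.exp (r + t) * angDen (r - t) β + δ := by
  have h4 : Real.exp (r + t) * (2 * Real.cosh (r - t)) = Real.exp r ^ 2 + Real.exp t ^ 2 := by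
    rw [Real.cosh_eq, mul_div_cancel₀ _ two_ne_zero, mul_add, ← Real.exp_add, ← Real.exp_add,
      ← Real.exp_nat_mul, ← Real.exp_nat_mul]
    congr 2 <;> (push_cast; ring)
  rw [angDen, mul_sub, h4, regDen, Real.exp_add]; ring

lemma le_regDen (δ r t β : ℝ) : δ ≤ regDen δ r t β := by
  rw [regDen_eq]
  have := mul_nonneg (Real.exp_pos (r + t)).le (angDen_nonneg (r - t) β)
  linarith

lemma regDen_pos {δ : ℝ} (hδ : 0 < δ) (r t β : ℝ) : 0 < regDen δ r t β :=
  hδ.trans_le (le_regDen δ r t β)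

lemma continuous_regDen_rpow {δ : ℝ} (hδ : 0 < δ) (r e : ℝ) :
    Continuous fun p : ℝ × ℝ => regDen δ r p.1 p.2 ^ e := by
  refine Continuous.rpow_const (by unfold regDen; fun_prop) fun p =>
    Or.inl (regDen_pos hδ r p.1 p.2).ne'

/-- The radial flux `R² S² sin² β D^{-s}`. -/
noncomputable def fluxRad (s δ r t β : ℝ) : ℝ :=
  Real.exp r ^ 2 * Real.exp t ^ 2 * Real.sin β ^ 2 * regDen δ r t β ^ (-s)

/-- The radial derivative of `fluxRad`. -/
noncomputable def fluxRadDeriv (s δ r t β : ℝ) : ℝ :=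
  Real.exp r ^ 2 * Real.exp t ^ 2 * Real.sin β ^ 2 * (2 * regDen δ r t β ^ (-s) -
    s * (2 * Real.exp t ^ 2 - 2 * (Real.exp r * Real.exp t) * Real.cos β) *
      regDen δ r t β ^ (-s - 1))

/-- The angular flux `R S sin β (S² - R S cos β) D^{-s}`. -/
noncomputable def fluxAng (s δ r t β : ℝ) : ℝ :=
  Real.exp r * Real.exp t * (Real.sin β * (Real.exp t ^ 2 - Real.exp r * Real.exp t * Real.cos β)) *
    regDen δ r t β ^ (-s)

/-- The integrand of the angular component of the regularized velocity. -/
noncomputable def tangInt (s δ r t β : ℝ) : ℝ :=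
  Real.exp t ^ 2 * (Real.exp r ^ 2 - Real.exp r * Real.exp t * Real.cos β) *
    regDen δ r t β ^ (-s)

lemma hasDerivAt_fluxRad {δ : ℝ} (hδ : 0 < δ) (s r t β : ℝ) :
    HasDerivAt (fun t => fluxRad s δ r t β) (fluxRadDeriv s δ r t β) t := by
  have h1 := Real.hasDerivAt_exp t
  have hD : HasDerivAt (fun t => regDen δ r t β)
      (2 * Real.exp t * Real.exp t - 2 * (Real.exp r * Real.exp t) * Real.cos β) t := by
    have := (((h1.pow 2).const_add (Real.exp r ^ 2)).sub
      (((h1.const_mul (Real.exp r)).const_mul 2).mul_const (Real.cos β))).add_const δ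
    refine this.congr_deriv ?_
    push_cast; ring
  have := (((h1.pow 2).const_mul (Real.exp r ^ 2)).mul_const (Real.sin β ^ 2)).mul
    (hD.rpow_const (p := -s) (Or.inl (regDen_pos hδ r t β).ne'))
  refine this.congr_deriv ?_
  simp only [fluxRadDeriv, Pi.pow_apply]; push_cast; ring

/-- Together with `hasDerivAt_fluxRad` this says that `tangInt` is a divergence, ∂_t of the radial
flux minus ∂_β of the angular one. It is the identity behind the appearance of the mode-1 kernel in
the angular velocity. -/
lemma hasDerivAt_fluxAng {δ : ℝ} (hδ : 0 < δ) (s r t β : ℝ) :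
    HasDerivAt (fun β => fluxAng s δ r t β) (fluxRadDeriv s δ r t β - tangInt s δ r t β) β := by
  have h1 := Real.hasDerivAt_sin β
  have h2 := Real.hasDerivAt_cos β
  have hD : HasDerivAt (fun β => regDen δ r t β)
      (2 * (Real.exp r * Real.exp t) * Real.sin β) β := by
    have := ((h2.const_mul (2 * (Real.exp r * Real.exp t))).const_sub
      (Real.exp r ^ 2 + Real.exp t ^ 2)).add_const δ
    refine this.congr_deriv ?_
    ring
  have := ((h1.mul ((h2.const_mul (Real.exp r * Real.exp t)).const_sub
    (Real.exp t ^ 2))).const_mul (Real.exp r * Real.exp t)).mul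
    (hD.rpow_const (p := -s) (Or.inl (regDen_pos hδ r t β).ne'))
  refine this.congr_deriv ?_
  have hc := Real.cos_sq' β
  have e : Real.exp r ^ 2 * Real.exp t ^ 2 * Real.cos β ^ 2 =
    Real.exp r ^ 2 * Real.exp t ^ 2 * (1 - Real.sin β ^ 2) := by rw [hc]
  simp only [fluxRadDeriv, tangInt, Pi.mul_apply]
  linear_combination (-regDen δ r t β ^ (-s)) * e

lemma continuous_fluxRad {δ : ℝ} (hδ : 0 < δ) (s r : ℝ) :
    Continuous fun p : ℝ × ℝ => fluxRad s δ r p.1 p.2 := by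
  have := continuous_regDen_rpow hδ r (-s)
  unfold fluxRad; fun_prop

lemma continuous_fluxRadDeriv {δ : ℝ} (hδ : 0 < δ) (s r : ℝ) :
    Continuous fun p : ℝ × ℝ => fluxRadDeriv s δ r p.1 p.2 := by
  have := continuous_regDen_rpow hδ r (-s)
  have := continuous_regDen_rpow hδ r (-s - 1)
  unfold fluxRadDeriv; fun_prop

lemma continuous_tangInt {δ : ℝ} (hδ : 0 < δ) (s r : ℝ) :
    Continuous fun p : ℝ × ℝ => tangInt s δ r p.1 p.2 := by
  have := continuous_regDen_rpow hδ r (-s)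
  unfold tangInt; fun_prop

/-- The angular flux carries a factor sin β and vanishes at β = ±π. -/
lemma setIntegral_tangInt {δ : ℝ} (hδ : 0 < δ) (s r t : ℝ) :
    ∫ β in Ioo (-Real.pi) Real.pi, tangInt s δ r t β =
      ∫ β in Ioo (-Real.pi) Real.pi, fluxRadDeriv s δ r t β := by
  have hpi := Real.pi_pos
  have c1 : Continuous fun β => fluxRadDeriv s δ r t β :=
    (continuous_fluxRadDeriv hδ s r).comp (continuous_const.prodMk continuous_id)
  have c2 : Continuous fun β => tangInt s δ r t β :=
    (continuous_tangInt hδ s r).comp (continuous_const.prodMk continuous_id)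
  have h := intervalIntegral.integral_eq_sub_of_hasDerivAt (a := -Real.pi) (b := Real.pi)
    (fun β _ => hasDerivAt_fluxAng hδ s r t β) ((c1.sub c2).intervalIntegrable _ _)
  rw [intervalIntegral.integral_sub (c1.intervalIntegrable _ _) (c2.intervalIntegrable _ _)] at h
  simp only [fluxAng, Real.sin_pi, Real.sin_neg, neg_zero, zero_mul, mul_zero, sub_zero] at h
  rw [intervalIntegral.integral_of_le (by linarith), intervalIntegral.integral_of_le (by linarith),
    integral_Ioc_eq_integral_Ioo, integral_Ioc_eq_integral_Ioo] at h
  linarith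

/-- The factor e^{2t} is integrable at t → -∞, where the vortex profile need not vanish; at the
other end the profile is zero. -/
lemma exists_bound_flux {s δ : ℝ} (hs : 0 ≤ s) (hδ : 0 < δ) (r T : ℝ) :
    ∃ C, ∀ t ≤ T, ∀ β, |fluxRad s δ r t β| ≤ C * Real.exp (2 * t) ∧
      |fluxRadDeriv s δ r t β| ≤ C * Real.exp (2 * t) := by
  set R := Real.exp r with hR
  set M := Real.exp T with hM
  have hR0 : 0 < R := Real.exp_pos r
  have hM0 : 0 < M := Real.exp_pos T
  refine ⟨R ^ 2 * (2 * δ ^ (-s) + s * (2 * M ^ 2 + 2 * (R * M)) * δ ^ (-s - 1)),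
    fun t ht β => ?_⟩
  have hS0 := Real.exp_pos t
  have hS : Real.exp t ≤ M := Real.exp_le_exp.2 ht
  have e2 : Real.exp (2 * t) = Real.exp t ^ 2 := by
    rw [← Real.exp_nat_mul]; norm_num
  have hsin : Real.sin β ^ 2 ≤ 1 := Real.sin_sq_le_one β
  have p1 : 0 ≤ regDen δ r t β ^ (-s) := Real.rpow_nonneg (regDen_pos hδ r t β).le _
  have p2 : 0 ≤ regDen δ r t β ^ (-s - 1) := Real.rpow_nonneg (regDen_pos hδ r t β).le _
  have q1 : regDen δ r t β ^ (-s) ≤ δ ^ (-s) :=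
    Real.rpow_le_rpow_of_nonpos hδ (le_regDen δ r t β) (by linarith)
  have q2 : regDen δ r t β ^ (-s - 1) ≤ δ ^ (-s - 1) :=
    Real.rpow_le_rpow_of_nonpos hδ (le_regDen δ r t β) (by linarith)
  have d1 : 0 ≤ δ ^ (-s) := Real.rpow_nonneg hδ.le _
  have d2 : 0 ≤ δ ^ (-s - 1) := Real.rpow_nonneg hδ.le _
  have hbr : |2 * Real.exp t ^ 2 - 2 * (R * Real.exp t) * Real.cos β| ≤ 2 * M ^ 2 + 2 * (R * M) := by
    calc _ ≤ |2 * Real.exp t ^ 2| + |2 * (R * Real.exp t) * Real.cos β| := abs_sub _ _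
      _ ≤ 2 * M ^ 2 + 2 * (R * M) := by
        rw [abs_of_nonneg (by positivity), abs_mul, abs_of_nonneg (by positivity)]
        have := Real.abs_cos_le_one β
        have : 2 * (R * Real.exp t) * |Real.cos β| ≤ 2 * (R * M) * 1 := by gcongr
        have : 2 * Real.exp t ^ 2 ≤ 2 * M ^ 2 := by gcongr
        linarith
  have hpre : ∀ A B : ℝ, |A| ≤ B → 0 ≤ B →
      |R ^ 2 * Real.exp t ^ 2 * Real.sin β ^ 2 * A| ≤ R ^ 2 * B * Real.exp (2 * t) := by
    intro A B hA hB
    rw [abs_mul, abs_of_nonneg (by positivity), e2]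
    calc R ^ 2 * Real.exp t ^ 2 * Real.sin β ^ 2 * |A| ≤ R ^ 2 * Real.exp t ^ 2 * 1 * B := by gcongr
      _ = _ := by ring
  constructor
  · refine hpre _ _ ?_ (by positivity)
    rw [abs_of_nonneg p1]
    have : 0 ≤ s * (2 * M ^ 2 + 2 * (R * M)) * δ ^ (-s - 1) := by positivity
    linarith
  · refine hpre _ _ ?_ (by positivity)
    refine (abs_sub _ _).trans (add_le_add ?_ ?_)
    · rw [abs_of_nonneg (by positivity)]; linarith
    · rw [abs_mul, abs_mul, abs_of_nonneg hs, abs_of_nonneg p2]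
      gcongr

lemma integral_mul_tangInt {s δ : ℝ} (hs : 0 ≤ s) (hδ : 0 < δ) {F γ : ℝ → ℝ} {T : ℝ}
    (hF : ∀ t, HasDerivAt F (-(γ t * Real.exp (-2 * t))) t) (hFT : ∀ t, T ≤ t → F t = 0)
    {M : ℝ} (hM : ∀ t, |F t| ≤ M) (hγ : Continuous γ) (hc : HasCompactSupport γ) (r : ℝ) :
    ∫ t, ∫ β in Ioo (-Real.pi) Real.pi, tangInt s δ r t β * F t =
      Real.exp r ^ 2 * ∫ t, regKer s 1 δ r t * γ t := by
  have hFc : Continuous F := continuous_iff_continuousAt.2 fun t => (hF t).continuousAt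
  obtain ⟨C, hC⟩ := exists_bound_flux hs hδ r T
  have hM0 : 0 ≤ M := (abs_nonneg _).trans (hM 0)
  have hg : Integrable ((Iic T).indicator fun t => M * (C * Real.exp (2 * t))) := by
    rw [integrable_indicator_iff measurableSet_Iic]
    exact ((integrableOn_exp_mul_Iic two_pos T).const_mul C).const_mul M
  have hbound : ∀ A : ℝ → ℝ, (∀ t ≤ T, |A t| ≤ C * Real.exp (2 * t)) → ∀ t,
      ‖F t * A t‖ ≤ (Iic T).indicator (fun t => M * (C * Real.exp (2 * t))) t := by
    intro A hA t
    by_cases ht : t ≤ T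
    · rw [indicator_of_mem (show t ∈ Iic T from ht), norm_mul]
      exact mul_le_mul (hM t) (hA t ht) (abs_nonneg _) hM0
    · rw [hFT t (not_le.1 ht).le]; simp [ht]
  -- The boundary terms vanish: F is zero beyond T and the flux decays at -∞. The factor e^{-2t} in
  -- F' cancels the e^{2t} of the flux and leaves sin² β, the first angular weight.
  have hparts : ∀ β, ∫ t, F t * fluxRadDeriv s δ r t β =
      ∫ t, Real.exp r ^ 2 * (Real.sin β ^ 2 * regDen δ r t β ^ (-s)) * γ t := by
    intro β
    have c1 : Continuous fun t => fluxRadDeriv s δ r t β :=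
      (continuous_fluxRadDeriv hδ s r).comp (continuous_id.prodMk continuous_const)
    have c2 : Continuous fun t => fluxRad s δ r t β :=
      (continuous_fluxRad hδ s r).comp (continuous_id.prodMk continuous_const)
    have := integral_mul_deriv_eq_deriv_mul_of_integrable (u := F)
      (u' := fun t => -(γ t * Real.exp (-2 * t)))
      (v := fun t => fluxRad s δ r t β) (v' := fun t => fluxRadDeriv s δ r t β)
      (fun t _ => hF t) (fun t _ => hasDerivAt_fluxRad hδ s r t β)
      (hg.mono' (hFc.mul c1).aestronglyMeasurable
        (Eventually.of_forall (hbound _ fun t ht => (hC t ht β).2)))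
      (Continuous.integrable_of_hasCompactSupport (by fun_prop) hc.mul_right.neg.mul_right)
      (hg.mono' (hFc.mul c2).aestronglyMeasurable
        (Eventually.of_forall (hbound _ fun t ht => (hC t ht β).1)))
    rw [this, ← integral_neg]
    congr 1; ext t
    have : Real.exp (-2 * t) * Real.exp t ^ 2 = 1 := by
      rw [← Real.exp_nat_mul, ← Real.exp_add]; simp
    rw [fluxRad]
    linear_combination (γ t * Real.exp r ^ 2 * Real.sin β ^ 2 * regDen δ r t β ^ (-s)) * this
  have hfin : IsFiniteMeasure (volume.restrict (Ioo (-Real.pi) Real.pi)) := inferInstance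
  calc ∫ t, ∫ β in Ioo (-Real.pi) Real.pi, tangInt s δ r t β * F t
      = ∫ t, ∫ β in Ioo (-Real.pi) Real.pi, F t * fluxRadDeriv s δ r t β := by
        congr 1; ext t
        rw [integral_mul_const, setIntegral_tangInt hδ, integral_const_mul, mul_comm]
    _ = ∫ β in Ioo (-Real.pi) Real.pi, ∫ t, F t * fluxRadDeriv s δ r t β := by
        refine integral_integral_swap ?_
        refine (hg.comp_fst (volume.restrict (Ioo (-Real.pi) Real.pi))).mono' ?_ ?_
        · exact ((hFc.comp continuous_fst).mul
            (continuous_fluxRadDeriv hδ s r)).aestronglyMeasurable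
        · exact Eventually.of_forall fun p => hbound _ (fun t ht => (hC t ht p.2).2) p.1
    _ = ∫ β in Ioo (-Real.pi) Real.pi, ∫ t,
          Real.exp r ^ 2 * (Real.sin β ^ 2 * regDen δ r t β ^ (-s)) * γ t := by simp only [hparts]
    _ = ∫ t, ∫ β in Ioo (-Real.pi) Real.pi,
          Real.exp r ^ 2 * (Real.sin β ^ 2 * regDen δ r t β ^ (-s)) * γ t := by
        refine integral_integral_swap ?_
        have hi : Integrable fun t => Real.exp r ^ 2 * δ ^ (-s) * |γ t| :=
          (hγ.integrable_of_hasCompactSupport hc).abs.const_mul _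
        refine (hi.comp_snd (volume.restrict (Ioo (-Real.pi) Real.pi))).mono' ?_ ?_
        · have := (continuous_regDen_rpow hδ r (-s)).comp continuous_swap
          have h2 : Continuous fun p : ℝ × ℝ => regDen δ r p.2 p.1 ^ (-s) := this
          exact Continuous.aestronglyMeasurable (by
            unfold Function.uncurry; fun_prop)
        · refine Eventually.of_forall fun p => ?_
          simp only [Function.uncurry]
          have p1 : 0 ≤ regDen δ r p.2 p.1 ^ (-s) := Real.rpow_nonneg (regDen_pos hδ r _ _).le _
          have q1 : regDen δ r p.2 p.1 ^ (-s) ≤ δ ^ (-s) :=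
            Real.rpow_le_rpow_of_nonpos hδ (le_regDen δ r _ _) (by linarith)
          rw [norm_mul, Real.norm_of_nonneg (by positivity), Real.norm_eq_abs]
          have := Real.sin_sq_le_one p.1
          have : Real.sin p.1 ^ 2 * regDen δ r p.2 p.1 ^ (-s) ≤ 1 * δ ^ (-s) := by gcongr
          rw [one_mul] at this
          gcongr
    _ = _ := by
        rw [← integral_const_mul]
        congr 1; ext t
        rw [integral_mul_const, integral_const_mul, regKer, mul_assoc]
        simp only [angWeight_one, regDen_eq]

/-- The angular component of the regularized velocity of a radial function. -/
lemma angular_regKernel {s δ : ℝ} (hs : 0 ≤ s) (hδ : 0 < δ) {Θ : ℂ → ℂ} (hΘ : Continuous Θ)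
    (hΘc : HasCompactSupport Θ) {F γ : ℝ → ℝ} {T : ℝ}
    (hw : ∀ t φ : ℝ, Θ (exp (t + φ * I)) = F t)
    (hF : ∀ t, HasDerivAt F (-(γ t * Real.exp (-2 * t))) t) (hFT : ∀ t, T ≤ t → F t = 0)
    {M : ℝ} (hM : ∀ t, |F t| ≤ M) (hγ : Continuous γ) (hc : HasCompactSupport γ) (r φ : ℝ) :
    -((exp (r + φ * I)).im : ℂ) * (∫ y, (regKernel s δ (exp (r + φ * I) - y) 0 : ℂ) * Θ y) +
      ((exp (r + φ * I)).re : ℂ) * (∫ y, (regKernel s δ (exp (r + φ * I) - y) 1 : ℂ) * Θ y) =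
    (Real.exp r : ℂ) ^ 2 * ∫ t, (regKer s 1 δ r t : ℂ) * γ t := by
  set X := exp (r + φ * I) with hX
  rw [← integral_const_mul, ← integral_const_mul, ← integral_add
    ((integrable_regKernel_mul hδ hΘ hΘc X 0).const_mul _)
    ((integrable_regKernel_mul hδ hΘ hΘc X 1).const_mul _)]
  have e1 : ∀ y, -(X.im : ℂ) * ((regKernel s δ (X - y) 0 : ℂ) * Θ y) +
      (X.re : ℂ) * ((regKernel s δ (X - y) 1 : ℂ) * Θ y) =
      ((((X.re * X.re + X.im * X.im) - (X.re * y.re + X.im * y.im)) *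
        (normSq (X - y) + δ) ^ (-s) : ℝ) : ℂ) * Θ y := by
    intro y
    simp only [regKernel, Matrix.cons_val_zero, Matrix.cons_val_one, Matrix.cons_val_fin_one,
      sub_re, sub_im]
    push_cast; ring
  simp only [e1]
  have hcont : Continuous fun y : ℂ => (normSq (X - y) + δ) ^ (-s) :=
    ((continuous_normSq.comp (continuous_const.sub continuous_id)).add
      continuous_const).rpow_const fun x =>
      Or.inl (by have := normSq_nonneg (X - x); simp; linarith : 0 < normSq (X - x) + δ).ne'
  have hXX : X.re * X.re + X.im * X.im = Real.exp r ^ 2 := by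
    rw [← normSq_apply, normSq_eq_norm_sq, hX, Complex.norm_exp]; simp
  rw [integral_eq_logPolar (f := fun y => ((((X.re * X.re + X.im * X.im) -
    (X.re * y.re + X.im * y.im)) * (normSq (X - y) + δ) ^ (-s) : ℝ) : ℂ) * Θ y)
    (by fun_prop) hΘc.mul_left φ]
  have hmain := congrArg (fun x : ℝ => (x : ℂ))
    (integral_mul_tangInt hs hδ hF hFT hM hγ hc r)
  simp only [ofReal_mul, ofReal_pow] at hmain
  rw [← integral_complex_ofReal, ← integral_complex_ofReal] at hmain
  simp only [ofReal_mul] at hmain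
  rw [← hmain]
  congr 1; ext t
  rw [← integral_complex_ofReal]
  congr 1; ext β
  rw [hXX]
  simp only [hX, dot_logPolar, normSq_sub_logPolar, hw, tangInt, regDen_eq]
  rw [Real.exp_add]; push_cast; ring

/-! ### Velocity components in the limit of vanishing regularization -/

section

variable {α : ℝ}

/-- The radial component of the velocity of a purely `n`-fold symmetric function. -/
lemma radial_symmVelocity (hα₀ : 0 ≤ α) (hα₁ : α ≤ 1) (n : ℕ) {W : ℂ → ℂ} (hW : ContDiff ℝ 1 W)
    (hc : HasCompactSupport W) {f : ℝ → ℂ} (hf : Continuous f) (hfc : HasCompactSupport f)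
    (hw : ∀ t φ : ℝ, W (exp (t + φ * I)) = f t * (Real.exp t : ℂ)⁻¹ ^ 3 * exp (n * φ * I))
    (r φ : ℝ) :
    ((exp (r + φ * I)).re : ℂ) * symmVelocity α W (exp (r + φ * I)) 0 +
      ((exp (r + φ * I)).im : ℂ) * symmVelocity α W (exp (r + φ * I)) 1 =
    I * n * exp (n * φ * I) * (Real.exp r * ∫ t, (radKer (1 + α / 2) n r t : ℂ) * f t) := by
  set X := exp (r + φ * I) with hX
  have h0 := (tendsto_regKernel hα₀ hα₁ hW hc X 0).const_mul (X.re : ℂ)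
  have h1 := (tendsto_regKernel hα₀ hα₁ hW hc X 1).const_mul (X.im : ℂ)
  refine tendsto_nhds_unique (h0.add h1) ?_
  have h2 := (((tendsto_integral_regKer (s := 1 + α / 2) (by linarith) (by linarith) n r hf
    hfc).const_mul (Real.exp r : ℂ)).const_mul (I * n * exp (n * φ * I)))
  refine h2.congr' ?_
  filter_upwards [self_mem_nhdsWithin] with δ hδ
  rw [radial_regKernel hδ n hW.continuous hc hw r φ, ← integral_const_mul]
  congr 2; ext t
  have : (Real.exp t : ℂ) ≠ 0 := by exact_mod_cast (Real.exp_pos t).ne'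
  field_simp

/-- The radial component of the velocity of a radial function vanishes. -/
lemma radial_symmVelocity_of_radial (hα₀ : 0 ≤ α) (hα₁ : α ≤ 1) {Θ : ℂ → ℂ}
    (hΘ : ContDiff ℝ 1 Θ) (hΘc : HasCompactSupport Θ) {F : ℝ → ℂ}
    (hw : ∀ t φ : ℝ, Θ (exp (t + φ * I)) = F t) (r φ : ℝ) :
    ((exp (r + φ * I)).re : ℂ) * symmVelocity α Θ (exp (r + φ * I)) 0 +
      ((exp (r + φ * I)).im : ℂ) * symmVelocity α Θ (exp (r + φ * I)) 1 = 0 := by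
  set X := exp (r + φ * I) with hX
  have h0 := (tendsto_regKernel hα₀ hα₁ hΘ hΘc X 0).const_mul (X.re : ℂ)
  have h1 := (tendsto_regKernel hα₀ hα₁ hΘ hΘc X 1).const_mul (X.im : ℂ)
  refine tendsto_nhds_unique (h0.add h1) (tendsto_const_nhds.congr' ?_)
  filter_upwards [self_mem_nhdsWithin] with δ hδ
  rw [radial_regKernel (w := F) hδ 0 hΘ.continuous hΘc (by simpa using hw) r φ]
  simp

/-- The angular component of the velocity of a radial function. -/
lemma angular_symmVelocity (hα₀ : 0 ≤ α) (hα₁ : α ≤ 1) {Θ : ℂ → ℂ}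
    (hΘ : ContDiff ℝ 1 Θ) (hΘc : HasCompactSupport Θ) {F γ : ℝ → ℝ} {T : ℝ}
    (hw : ∀ t φ : ℝ, Θ (exp (t + φ * I)) = F t)
    (hF : ∀ t, HasDerivAt F (-(γ t * Real.exp (-2 * t))) t) (hFT : ∀ t, T ≤ t → F t = 0)
    {M : ℝ} (hM : ∀ t, |F t| ≤ M) (hγ : Continuous γ) (hc : HasCompactSupport γ) (r φ : ℝ) :
    -((exp (r + φ * I)).im : ℂ) * symmVelocity α Θ (exp (r + φ * I)) 0 +
      ((exp (r + φ * I)).re : ℂ) * symmVelocity α Θ (exp (r + φ * I)) 1 =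
    (Real.exp r : ℂ) ^ 2 * radOmega (1 + α / 2) γ r := by
  set X := exp (r + φ * I) with hX
  have h0 := (tendsto_regKernel hα₀ hα₁ hΘ hΘc X 0).const_mul (-(X.im : ℂ))
  have h1 := (tendsto_regKernel hα₀ hα₁ hΘ hΘc X 1).const_mul (X.re : ℂ)
  refine tendsto_nhds_unique (h0.add h1) ?_
  have h2 := (tendsto_integral_regKer (s := 1 + α / 2) (by linarith) (by linarith) 1 r
    (G := fun t => (γ t : ℂ)) (by fun_prop)
    (hc.comp_left (g := fun x : ℝ => (x : ℂ)) (by simp))).const_mul ((Real.exp r : ℂ) ^ 2)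
  have e : ∫ t, (radKer (1 + α / 2) 1 r t : ℂ) * γ t = radOmega (1 + α / 2) γ r := by
    rw [radOmega, ← integral_complex_ofReal]; simp
  rw [e] at h2
  refine h2.congr' ?_
  filter_upwards [self_mem_nhdsWithin] with δ hδ
  rw [angular_regKernel (by positivity) hδ hΘ.continuous hΘc hw hF hFT hM hγ hc r φ]

end

/-! ### Advection in polar coordinates -/

lemma bsConst_pos {α : ℝ} (hα₀ : 0 ≤ α) (hα₁ : α ≤ 1) : 0 < bsConst α := by
  have h1 : 0 < Real.Gamma (1 + α / 2) := Real.Gamma_pos_of_pos (by linarith)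
  have h2 : 0 < Real.Gamma (1 - α / 2) := Real.Gamma_pos_of_pos (by linarith)
  have := Real.pi_pos
  unfold bsConst; positivity

lemma exists_eq_exp {X : ℂ} (hX : X ≠ 0) : ∃ r φ : ℝ, X = exp (r + φ * I) := by
  refine ⟨(log X).re, (log X).im, ?_⟩
  rw [re_add_im, exp_log hX]

lemma norm_exp_logPolar (r φ : ℝ) : ‖exp (r + φ * I)‖ = Real.exp r := by
  rw [Complex.norm_exp]; simp

/-- The advection operator in terms of the radial and angular components of the velocity. -/
lemma norm_sq_mul_advect (V : ℂ → Fin 2 → ℂ) (g : ℂ → ℂ) (X : ℂ) :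
    (‖X‖ : ℂ) ^ 2 * advect V g X =
      ((X.re : ℂ) * V X 0 + (X.im : ℂ) * V X 1) * fderiv ℝ g X X +
      (-(X.im : ℂ) * V X 0 + (X.re : ℂ) * V X 1) * fderiv ℝ g X (I * X) := by
  have hX : X = X.re • (1 : ℂ) + X.im • I := by simp [re_add_im]
  have hIX : I * X = (-X.im) • (1 : ℂ) + X.re • I := by
    apply Complex.ext <;> simp
  have e1 : fderiv ℝ g X X = (X.re : ℂ) * fderiv ℝ g X 1 + (X.im : ℂ) * fderiv ℝ g X I := by
    conv_lhs => rw [show fderiv ℝ g X X = fderiv ℝ g X (X.re • (1 : ℂ) + X.im • I) by rw [← hX]]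
    rw [map_add, map_smul, map_smul, real_smul, real_smul]
  have e2 : fderiv ℝ g X (I * X) = -(X.im : ℂ) * fderiv ℝ g X 1 + (X.re : ℂ) * fderiv ℝ g X I := by
    rw [hIX, map_add, map_smul, map_smul, real_smul, real_smul, ofReal_neg]
  have e3 : (‖X‖ : ℂ) ^ 2 = (X.re : ℂ) * X.re + (X.im : ℂ) * X.im := by
    have := normSq_apply X
    rw [normSq_eq_norm_sq] at this
    exact_mod_cast this
  rw [e1, e2, e3, advect]; ring

lemma hasDerivAt_exp_radial (r φ : ℝ) :
    HasDerivAt (fun t : ℝ => exp (t + φ * I)) (exp (r + φ * I)) r := by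
  have : HasDerivAt (fun t : ℝ => (t : ℂ) + φ * I) 1 r := (Complex.ofRealCLM.hasDerivAt (x := r)).add_const _
  simpa using this.cexp

lemma hasDerivAt_exp_angular (r φ : ℝ) :
    HasDerivAt (fun t : ℝ => exp (r + t * I)) (I * exp (r + φ * I)) φ := by
  have : HasDerivAt (fun t : ℝ => (r : ℂ) + t * I) I φ := by
    simpa using ((Complex.ofRealCLM.hasDerivAt (x := φ)).mul_const I).const_add (r : ℂ)
  simpa [mul_comm] using this.cexp

lemma fderiv_apply_radial {g : ℂ → ℂ} {r φ : ℝ} (hg : DifferentiableAt ℝ g (exp (r + φ * I)))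
    {G : ℝ → ℂ} (hG : ∀ t : ℝ, g (exp (t + φ * I)) = G t) {G' : ℂ} (hG' : HasDerivAt G G' r) :
    fderiv ℝ g (exp (r + φ * I)) (exp (r + φ * I)) = G' := by
  have h := hg.hasFDerivAt.comp_hasDerivAt r (hasDerivAt_exp_radial r φ)
  refine h.unique (hG'.congr_of_eventuallyEq (Eventually.of_forall fun t => hG t))

lemma fderiv_apply_angular {g : ℂ → ℂ} {r φ : ℝ} (hg : DifferentiableAt ℝ g (exp (r + φ * I)))
    {G : ℝ → ℂ} (hG : ∀ t : ℝ, g (exp (r + t * I)) = G t) {G' : ℂ} (hG' : HasDerivAt G G' φ) :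
    fderiv ℝ g (exp (r + φ * I)) (I * exp (r + φ * I)) = G' := by
  have h := hg.hasFDerivAt.comp_hasDerivAt φ (hasDerivAt_exp_angular r φ)
  refine h.unique (hG'.congr_of_eventuallyEq (Eventually.of_forall fun t => hG t))

/-- The default value log 0 = 0 also lies below 1/2, so profiles that are constant up to t = 1/2
take the right value at the origin. -/
lemma log_norm_le_half {X : ℂ} (hX : ‖X‖ < 1) : Real.log ‖X‖ ≤ 1 / 2 :=
  (Real.log_nonpos (norm_nonneg X) hX.le).trans (by norm_num)

lemma contDiff_of_eventually_const {E : Type*} [NormedAddCommGroup E] [NormedSpace ℝ E]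
    {g : ℂ → E} (h0 : ∀ X, ‖X‖ < 1 → g X = g 0) (h : ∀ X ≠ 0, ContDiffAt ℝ ∞ g X) :
    ContDiff ℝ ∞ g := by
  rw [contDiff_iff_contDiffAt]
  intro X
  rcases eq_or_ne X 0 with rfl | hX
  · refine (contDiffAt_const (c := g 0)).congr_of_eventuallyEq ?_
    filter_upwards [Metric.ball_mem_nhds (0 : ℂ) one_pos] with X hX
    exact h0 X (by simpa using hX)
  · exact h X hX

lemma contDiffAt_log_norm {X : ℂ} (hX : X ≠ 0) : ContDiffAt ℝ ∞ (fun X : ℂ => Real.log ‖X‖) X :=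
  (contDiffAt_norm ℝ hX).log (norm_ne_zero_iff.2 hX)

lemma hasCompactSupport_of_log_norm {E : Type*} [NormedAddCommGroup E] {g : ℂ → E} {T : ℝ}
    (h : ∀ X, X ≠ 0 → T ≤ Real.log ‖X‖ → g X = 0) : HasCompactSupport g := by
  refine HasCompactSupport.intro (isCompact_closedBall (0 : ℂ) (Real.exp T)) fun X hX => ?_
  rw [mem_closedBall_zero_iff, not_le] at hX
  have h0 : 0 < ‖X‖ := (Real.exp_pos T).trans hX
  exact h X (norm_pos_iff.1 h0) ((Real.le_log_iff_exp_le h0).2 hX.le)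

lemma exists_eq_zero_of_le {E : Type*} [NormedAddCommGroup E] {g : ℝ → E}
    (hc : HasCompactSupport g) : ∃ T, 1 ≤ T ∧ ∀ t, T ≤ t → g t = 0 := by
  obtain ⟨ρ, hρ0, hρ⟩ := hc.isCompact.isBounded.subset_closedBall_lt 0 0
  refine ⟨ρ + 1, by linarith, fun t ht => image_eq_zero_of_notMem_tsupport fun h => ?_⟩
  have := (le_abs_self t).trans (mem_closedBall_zero_iff.1 (hρ h))
  linarith

/-! ### The vortex -/

/-- The radial profile of the vortex with vorticity gradient `-γ(log R) R⁻³`, as a function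
of `log R`. -/
noncomputable def vortexProfile (γ : ℝ → ℝ) (T t : ℝ) : ℝ :=
  ∫ x in t..T, γ x * Real.exp (-2 * x)

section

variable {γ : ℝ → ℝ} {T : ℝ}

lemma hasDerivAt_vortexProfile (hγ : Continuous γ) (t : ℝ) :
    HasDerivAt (vortexProfile γ T) (-(γ t * Real.exp (-2 * t))) t := by
  have hc : Continuous fun x => γ x * Real.exp (-2 * x) := by fun_prop
  exact intervalIntegral.integral_hasDerivAt_left (hc.intervalIntegrable _ _)
    hc.stronglyMeasurable.stronglyMeasurableAtFilter hc.continuousAt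

lemma contDiff_vortexProfile (hγ : ContDiff ℝ ∞ γ) : ContDiff ℝ ∞ (vortexProfile γ T) := by
  rw [contDiff_infty_iff_deriv]
  refine ⟨fun t => (hasDerivAt_vortexProfile hγ.continuous t).differentiableAt, ?_⟩
  have : deriv (vortexProfile γ T) = fun t => -(γ t * Real.exp (-2 * t)) :=
    funext fun t => (hasDerivAt_vortexProfile hγ.continuous t).deriv
  rw [this]
  exact (hγ.mul (by fun_prop)).neg

lemma vortexProfile_eq_zero (hT : ∀ t, T ≤ t → γ t = 0) {t : ℝ} (ht : T ≤ t) :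
    vortexProfile γ T t = 0 := by
  refine (intervalIntegral.integral_congr (g := fun _ => 0) fun x hx => ?_).trans
    intervalIntegral.integral_zero
  rw [uIcc_of_ge ht] at hx
  simp [hT x hx.1]

lemma vortexProfile_eq_half (hγ : Continuous γ) (h0 : ∀ t ≤ 1 / 2, γ t = 0) {t : ℝ}
    (ht : t ≤ 1 / 2) : vortexProfile γ T t = vortexProfile γ T (1 / 2) := by
  have hc : Continuous fun x => γ x * Real.exp (-2 * x) := by fun_prop
  rw [vortexProfile, ← intervalIntegral.integral_add_adjacent_intervals
    (hc.intervalIntegrable t (1 / 2)) (hc.intervalIntegrable (1 / 2) T)]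
  rw [intervalIntegral.integral_congr (g := fun _ => 0) fun x hx => ?_,
    intervalIntegral.integral_zero, zero_add, vortexProfile]
  rw [uIcc_of_le ht] at hx
  simp [h0 x hx.2]

lemma exists_bound_vortexProfile (hγ : Continuous γ) (hc : HasCompactSupport γ) :
    ∃ M, ∀ t, |vortexProfile γ T t| ≤ M := by
  have hi : Integrable fun x => γ x * Real.exp (-2 * x) :=
    Continuous.integrable_of_hasCompactSupport (by fun_prop) hc.mul_right
  refine ⟨∫ x, ‖γ x * Real.exp (-2 * x)‖, fun t => ?_⟩
  exact (intervalIntegral.norm_integral_le_integral_norm_uIoc).trans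
    (setIntegral_le_integral hi.norm (Eventually.of_forall fun x => norm_nonneg _))

/-- The radial vortex. -/
noncomputable def vortex (γ : ℝ → ℝ) (T : ℝ) (X : ℂ) : ℝ := vortexProfile γ T (Real.log ‖X‖)

lemma vortex_exp (r φ : ℝ) : vortex γ T (exp (r + φ * I)) = vortexProfile γ T r := by
  rw [vortex, norm_exp_logPolar, Real.log_exp]

lemma vortex_eq_at_zero (hγ : Continuous γ) (h0 : ∀ t ≤ 1 / 2, γ t = 0) {X : ℂ} (hX : ‖X‖ < 1) :
    vortex γ T X = vortex γ T 0 := by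
  rw [vortex, vortex, vortexProfile_eq_half hγ h0 (log_norm_le_half hX),
    vortexProfile_eq_half hγ h0 (t := Real.log ‖(0 : ℂ)‖) (log_norm_le_half (by simp))]

lemma isTestFunction_vortex (hγ : ContDiff ℝ ∞ γ) (h0 : ∀ t ≤ 1 / 2, γ t = 0)
    (hT : ∀ t, T ≤ t → γ t = 0) : IsTestFunction (vortex γ T) := by
  refine ⟨contDiff_of_eventually_const (fun X hX => vortex_eq_at_zero hγ.continuous h0 hX)
    fun X hX => ?_, hasCompactSupport_of_log_norm (T := T) fun X _ hX =>
      vortexProfile_eq_zero hT hX⟩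
  exact (contDiff_vortexProfile hγ).contDiffAt.comp X (contDiffAt_log_norm hX)

/-- With R = e^t the mean is ∫ F e^{2t} dt, and integration by parts turns it into half of ∫ γ. -/
lemma integral_vortex (hγ : Continuous γ) (hc : HasCompactSupport γ)
    (hT : ∀ t, T ≤ t → γ t = 0) (hint : ∫ t, γ t = 0) :
    ∫ R in Ioi (0 : ℝ), vortex γ T (R : ℂ) * R = 0 := by
  have e := integral_image_eq_integral_abs_deriv_smul (f := Real.exp) (f' := Real.exp)
      MeasurableSet.univ (fun x _ => (Real.hasDerivAt_exp x).hasDerivWithinAt)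
      Real.exp_injective.injOn fun R => vortex γ T (R : ℂ) * R
  rw [image_univ, Real.range_exp, setIntegral_univ] at e
  rw [e]
  obtain ⟨M, hM⟩ := exists_bound_vortexProfile (T := T) hγ hc
  have hd := fun t => hasDerivAt_vortexProfile (T := T) hγ t
  have hFc : Continuous (vortexProfile γ T) :=
    continuous_iff_continuousAt.2 fun t => (hd t).continuousAt
  have hg : Integrable ((Iic T).indicator fun t => M * Real.exp (2 * t)) := by
    rw [integrable_indicator_iff measurableSet_Iic]
    exact (integrableOn_exp_mul_Iic two_pos T).const_mul M
  have huv : Integrable fun t => vortexProfile γ T t * Real.exp (2 * t) := by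
    refine hg.mono' (hFc.mul (by fun_prop)).aestronglyMeasurable (Eventually.of_forall fun t => ?_)
    by_cases ht : t ≤ T
    · rw [indicator_of_mem (show t ∈ Iic T from ht), norm_mul,
        Real.norm_of_nonneg (Real.exp_pos _).le]
      exact mul_le_mul_of_nonneg_right (hM t) (Real.exp_pos _).le
    · rw [vortexProfile_eq_zero hT (not_le.1 ht).le]; simp [ht]
  have hv : ∀ t : ℝ, HasDerivAt (fun t => Real.exp (2 * t)) (Real.exp (2 * t) * 2) t := fun t => by
    simpa using ((hasDerivAt_id t).const_mul 2).exp
  have hp := integral_mul_deriv_eq_deriv_mul_of_integrable (u := vortexProfile γ T)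
    (u' := fun t => -(γ t * Real.exp (-2 * t))) (v := fun t => Real.exp (2 * t))
    (v' := fun t => Real.exp (2 * t) * 2) (fun t _ => hd t) (fun t _ => hv t)
    ((huv.mul_const 2).congr (Eventually.of_forall fun t => by simp; ring))
    (Continuous.integrable_of_hasCompactSupport (by fun_prop) hc.mul_right.neg.mul_right) huv
  have e2 : ∀ t, -(γ t * Real.exp (-2 * t)) * Real.exp (2 * t) = -γ t := fun t => by
    have : Real.exp (-2 * t) * Real.exp (2 * t) = 1 := by rw [← Real.exp_add]; simp
    linear_combination (-γ t) * this
  simp only [e2, integral_neg, hint, ← mul_assoc, integral_mul_const] at hp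
  have e3 : ∀ t : ℝ, |Real.exp t| • (vortex γ T ((Real.exp t : ℝ) : ℂ) * Real.exp t) =
      vortexProfile γ T t * Real.exp (2 * t) := fun t => by
    rw [abs_of_pos (Real.exp_pos t), vortex, Complex.norm_real,
      Real.norm_of_nonneg (Real.exp_pos t).le, Real.log_exp, two_mul, Real.exp_add, smul_eq_mul]
    ring
  simp only [e3]
  linarith

lemma vortex_mem_vortexSpace (hγ : ContDiff ℝ ∞ γ) (hc : HasCompactSupport γ)
    (h0 : ∀ t ≤ 1 / 2, γ t = 0) (hT : ∀ t, T ≤ t → γ t = 0) (hint : ∫ t, γ t = 0) :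
    vortex γ T ∈ vortexSpace := by
  obtain ⟨h1, h2⟩ := isTestFunction_vortex hγ h0 hT
  refine ⟨h1.continuous.memLp_of_hasCompactSupport h2, fun X Y hXY => ?_, ?_,
    integral_vortex hγ.continuous hc hT hint⟩
  · rw [vortex, vortex, hXY]
  · refine Integrable.integrableOn (Continuous.integrable_of_hasCompactSupport ?_ ?_)
    · have := h1.continuous
      fun_prop
    · exact (h2.comp_isClosedEmbedding Complex.isometry_ofReal.isClosedEmbedding).mul_right

end

/-! ### The unstable mode -/

/-- The `n`-fold symmetric function with radial profile `f(log R) R⁻³`. -/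
noncomputable def modeFun (n : ℕ) (f : ℝ → ℂ) (X : ℂ) : ℂ :=
  f (Real.log ‖X‖) * (‖X‖ : ℂ)⁻¹ ^ 3 * (X * (‖X‖ : ℂ)⁻¹) ^ n

section

variable {n : ℕ} {f : ℝ → ℂ}

lemma modeFun_exp (r φ : ℝ) : modeFun n f (exp (r + φ * I)) =
    f r * (Real.exp r : ℂ)⁻¹ ^ 3 * exp (n * φ * I) := by
  have h : (Real.exp r : ℂ) ≠ 0 := by exact_mod_cast (Real.exp_pos r).ne'
  have e : exp (r + φ * I) * (Real.exp r : ℂ)⁻¹ = exp (φ * I) := by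
    rw [Complex.exp_add, ← ofReal_exp]; field_simp
  rw [modeFun, norm_exp_logPolar, Real.log_exp, e, ← Complex.exp_nat_mul]
  congr 2; ring

lemma modeFun_eq_zero (h0 : ∀ t ≤ 1 / 2, f t = 0) {X : ℂ} (hX : ‖X‖ < 1) : modeFun n f X = 0 := by
  simp [modeFun, h0 _ (log_norm_le_half hX)]

lemma isTestFunction_modeFun (hf : ContDiff ℝ ∞ f) (hc : HasCompactSupport f)
    (h0 : ∀ t ≤ 1 / 2, f t = 0) : IsTestFunction (modeFun n f) := by
  obtain ⟨T, -, hT⟩ := exists_eq_zero_of_le hc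
  refine ⟨contDiff_of_eventually_const (fun X hX => ?_) fun X hX => ?_,
    hasCompactSupport_of_log_norm (T := T) fun X _ hX => by simp [modeFun, hT _ hX]⟩
  · rw [modeFun_eq_zero h0 hX, modeFun_eq_zero h0 (by simp)]
  · have hN : ContDiffAt ℝ ∞ (fun X : ℂ => (‖X‖ : ℂ)⁻¹) X :=
      (Complex.ofRealCLM.contDiff.contDiffAt.comp X (contDiffAt_norm ℝ hX)).inv
        (by simpa using hX)
    have hF : ContDiffAt ℝ ∞ (fun X : ℂ => f (Real.log ‖X‖)) X :=
      hf.contDiffAt.comp X (contDiffAt_log_norm hX)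
    exact (hF.mul (hN.pow 3)).mul ((contDiffAt_id.mul hN).pow n)

lemma modeFun_ne_zero (hf : f ≠ 0) : modeFun n f ≠ 0 := by
  obtain ⟨t, ht⟩ := Function.ne_iff.1 hf
  intro h
  have := congrFun h (exp (t + (0 : ℝ) * I))
  rw [modeFun_exp] at this
  simp [ofReal_exp] at this
  exact ht this

lemma modeFun_mem_pureSymmetric (hf : ContDiff ℝ ∞ f) (hc : HasCompactSupport f)
    (h0 : ∀ t ≤ 1 / 2, f t = 0) : modeFun n f ∈ pureSymmetric n := by
  obtain ⟨h1, h2⟩ := isTestFunction_modeFun (n := n) hf hc h0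
  refine ⟨h1.continuous.memLp_of_hasCompactSupport h2,
    fun R => f (Real.log R) * (R : ℂ)⁻¹ ^ 3, fun R hR φ => ?_⟩
  have e : (R : ℂ) * exp (I * φ) = exp ((Real.log R : ℝ) + φ * I) := by
    rw [Complex.exp_add, ← ofReal_exp, Real.exp_log hR, mul_comm I]
  rw [e, modeFun_exp, Real.exp_log hR]
  congr 2
  push_cast; ring

end

/-! ### From the radial problem to the linearization -/

/-- A growing mode of the radial problem gives an eigenfunction of the linearization. -/
lemma linearization_modeFun {α : ℝ} (hα₀ : 0 ≤ α) (hα₁ : α ≤ 1) {n : ℕ} {γ : ℝ → ℝ} {T : ℝ}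
    (hγ : ContDiff ℝ ∞ γ) (hc : HasCompactSupport γ) (h0 : ∀ t ≤ 1 / 2, γ t = 0)
    (hT : ∀ t, T ≤ t → γ t = 0) {f : ℝ → ℂ} (hf : ContDiff ℝ ∞ f) (hfc : HasCompactSupport f)
    (hf0 : ∀ t ≤ 1 / 2, f t = 0) {c : ℂ}
    (heq : ∀ t, ((radOmega (1 + α / 2) γ t : ℂ) - c) * f t =
      γ t * ∫ y, (radKer (1 + α / 2) n t y : ℂ) * f y) (X : ℂ) :
    linearization α (vortex γ T) (modeFun n f) X =
      -(I * n * bsConst α * c) * modeFun n f X := by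
  obtain ⟨hΘ, hΘc⟩ := isTestFunction_vortex hγ h0 hT
  obtain ⟨hW, hWc⟩ := isTestFunction_modeFun (n := n) hf hfc hf0
  have hΘ' : ContDiff ℝ ∞ fun Y => (vortex γ T Y : ℂ) := Complex.ofRealCLM.contDiff.comp hΘ
  have hΘc' : HasCompactSupport fun Y => (vortex γ T Y : ℂ) :=
    hΘc.comp_left (g := fun x : ℝ => (x : ℂ)) (by simp)
  have one_le : (1 : WithTop ℕ∞) ≤ ∞ := by exact_mod_cast le_top
  -- Polar coordinates miss the origin, but near it the mode vanishes and the vortex is constant, so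
  -- both sides are zero.
  rcases eq_or_ne X 0 with rfl | hX
  · have hball := Metric.ball_mem_nhds (0 : ℂ) one_pos
    have d1 : fderiv ℝ (modeFun n f) 0 = 0 := by
      have : modeFun n f =ᶠ[𝓝 0] fun _ => 0 := by
        filter_upwards [hball] with Y hY
        exact modeFun_eq_zero hf0 (by simpa using hY)
      rw [this.fderiv_eq]; simp
    have d2 : fderiv ℝ (fun Y => (vortex γ T Y : ℂ)) 0 = 0 := by
      have : (fun Y => (vortex γ T Y : ℂ)) =ᶠ[𝓝 0] fun _ => (vortex γ T 0 : ℂ) := by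
        filter_upwards [hball] with Y hY
        rw [vortex_eq_at_zero hγ.continuous h0 (by simpa using hY)]
      rw [this.fderiv_eq]; simp
    rw [linearization, advect, advect, d1, d2, modeFun_eq_zero hf0 (by simp)]
    simp
  · obtain ⟨r, φ, rfl⟩ := exists_eq_exp hX
    obtain ⟨M, hM⟩ := exists_bound_vortexProfile (T := T) hγ.continuous hc
    have hR : (Real.exp r : ℂ) ≠ 0 := by exact_mod_cast (Real.exp_pos r).ne'
    have v1 := radial_symmVelocity_of_radial hα₀ hα₁ (hΘ'.of_le one_le) hΘc'
      (F := fun t => (vortexProfile γ T t : ℂ)) (fun t φ => by rw [vortex_exp]) r φ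
    have v2 := angular_symmVelocity hα₀ hα₁ (hΘ'.of_le one_le) hΘc'
      (fun t φ => by rw [vortex_exp]) (fun t => hasDerivAt_vortexProfile hγ.continuous t)
      (fun t ht => vortexProfile_eq_zero hT ht) hM hγ.continuous hc r φ
    have v3 := radial_symmVelocity hα₀ hα₁ n (hW.of_le one_le) hWc hf.continuous hfc
      (fun t φ => modeFun_exp t φ) r φ
    have dW : fderiv ℝ (modeFun n f) (exp (r + φ * I)) (I * exp (r + φ * I)) =
        I * n * modeFun n f (exp (r + φ * I)) := by
      refine fderiv_apply_angular (hW.differentiable (by simp)).differentiableAt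
        (fun t => modeFun_exp r t) ?_
      have h1 : HasDerivAt (fun t : ℝ => (n : ℂ) * t * I) (n * I) φ := by
        simpa using ((Complex.ofRealCLM.hasDerivAt (x := φ)).const_mul (n : ℂ)).mul_const I
      refine (h1.cexp.const_mul (f r * (Real.exp r : ℂ)⁻¹ ^ 3)).congr_deriv ?_
      rw [modeFun_exp]; ring
    have dΘ1 : fderiv ℝ (fun Y => (vortex γ T Y : ℂ)) (exp (r + φ * I)) (exp (r + φ * I)) =
        ((-(γ r * Real.exp (-2 * r)) : ℝ) : ℂ) :=
      fderiv_apply_radial (hΘ'.differentiable (by simp)).differentiableAt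
        (fun t => by rw [vortex_exp]) (hasDerivAt_vortexProfile hγ.continuous r).ofReal_comp
    have dΘ2 : fderiv ℝ (fun Y => (vortex γ T Y : ℂ)) (exp (r + φ * I)) (I * exp (r + φ * I)) = 0 :=
      fderiv_apply_angular (hΘ'.differentiable (by simp)).differentiableAt
        (fun t => by rw [vortex_exp]) (hasDerivAt_const φ _)
    have a1 := norm_sq_mul_advect (velocity α fun Y => (vortex γ T Y : ℂ)) (modeFun n f)
      (exp (r + φ * I))
    have a2 := norm_sq_mul_advect (velocity α (modeFun n f)) (fun Y => (vortex γ T Y : ℂ))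
      (exp (r + φ * I))
    rw [velocity_eq hα₀ hα₁ (hΘ'.of_le one_le) hΘc', norm_exp_logPolar, dW] at a1
    rw [velocity_eq hα₀ hα₁ (hW.of_le one_le) hWc, norm_exp_logPolar, dΘ1, dΘ2] at a2
    have hexp : (Real.exp (-2 * r) : ℂ) * (Real.exp r : ℂ) ^ 2 = 1 := by
      rw [← ofReal_pow, ← ofReal_mul, ← Real.exp_nat_mul, ← Real.exp_add]; simp
    have hmode := modeFun_exp (n := n) (f := f) r φ
    rw [linearization, velocity_eq hα₀ hα₁ (hΘ'.of_le one_le) hΘc',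
      velocity_eq hα₀ hα₁ (hW.of_le one_le) hWc]
    set W := modeFun n f (exp (r + φ * I))
    set K := ∫ y, (radKer (1 + α / 2) n r y : ℂ) * f y
    set A₁ := advect (fun x j => (bsConst α : ℂ) *
      symmVelocity α (fun Y => (vortex γ T Y : ℂ)) x j) (modeFun n f) (exp (r + φ * I))
    set A₂ := advect (fun x j => (bsConst α : ℂ) *
      symmVelocity α (modeFun n f) x j) (fun Y => (vortex γ T Y : ℂ)) (exp (r + φ * I))
    -- The vortex only rotates: its radial velocity vanishes, and ∂_φ W = inW.
    have b1 : A₁ = bsConst α * radOmega (1 + α / 2) γ r * (I * n * W) := by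
      have hR2 : (Real.exp r : ℂ) ^ 2 ≠ 0 := pow_ne_zero 2 hR
      refine mul_left_cancel₀ hR2 ?_
      rw [a1]
      linear_combination ((bsConst α : ℂ) * fderiv ℝ (modeFun n f) (exp (r + φ * I))
        (exp (r + φ * I))) * v1 + ((bsConst α : ℂ) * (I * n * W)) * v2
    -- Only the radial velocity of the mode meets the gradient of the vortex. Their product is -i n
    -- C_α R⁻³ e^{inφ} γ ∫ K_n f, and the radial equation replaces γ ∫ K_n f by (Ω - c) f. In the
    -- sum with A₁ the terms in Ω cancel.
    have b2 : A₂ = -(bsConst α * (I * n) * ((radOmega (1 + α / 2) γ r : ℂ) - c) * W) := by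
      have hR2 : (Real.exp r : ℂ) ^ 2 ≠ 0 := pow_ne_zero 2 hR
      refine mul_left_cancel₀ hR2 ?_
      have hW3 : (Real.exp r : ℂ) ^ 2 * W = f r * (Real.exp r : ℂ)⁻¹ * exp (n * φ * I) := by
        rw [hmode]; field_simp
      have hE : (Real.exp (-2 * r) : ℂ) * Real.exp r = (Real.exp r : ℂ)⁻¹ :=
        eq_inv_of_mul_eq_one_left (by linear_combination hexp)
      rw [a2]
      push_cast at hE ⊢
      push_cast at v3 hW3
      linear_combination (-(bsConst α : ℂ) * (γ r * exp (-2 * r))) * v3 +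
        (bsConst α * (I * n) * ((radOmega (1 + α / 2) γ r : ℂ) - c)) * hW3 +
        (bsConst α * (I * n) * (exp r)⁻¹ * exp (n * φ * I)) * heq r -
        (bsConst α * (I * n) * exp (n * φ * I) * γ r * K) * hE
    rw [b1, b2]; ring

end AlphaSQG

theorem theorem3p3 (α : ℝ) (hα₀ : 0 ≤ α) (hα₁ : α ≤ 1) (n : ℕ) (hn : 2 ≤ n) :
    ∃ Θ : ℂ → ℝ, AlphaSQG.IsTestFunction Θ ∧ Θ ∈ AlphaSQG.vortexSpace ∧
      ∃ (lam : ℂ) (W : ℂ → ℂ),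
        AlphaSQG.IsTestFunction W ∧ AlphaSQG.IsUnstableMode α Θ (n : ℤ) lam W := by
  open AlphaSQG in
  -- The range 0 ≤ α ≤ 1 corresponds to 1 ≤ s ≤ 3/2. Since f vanishes wherever γ does, the mode too
  -- is supported away from the origin.
  obtain ⟨γ, hγ, hc, h0, hint, c, hcim, f, hf, hfc, hγf, hfne, heq⟩ :=
    exists_radial_mode (s := 1 + α / 2) (by linarith) (by linarith) hn
  obtain ⟨T, -, hT⟩ := exists_eq_zero_of_le hc
  have hf0 : ∀ t ≤ 1 / 2, f t = 0 := fun t ht => hγf t (h0 t ht)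
  have one_le : (1 : WithTop ℕ∞) ≤ ∞ := by exact_mod_cast le_top
  have hΘ := isTestFunction_vortex hγ h0 hT
  have hW := isTestFunction_modeFun (n := n) hf hfc hf0
  refine ⟨vortex γ T, hΘ, vortex_mem_vortexSpace hγ hc h0 hT hint,
    -(I * n * bsConst α * c), modeFun n f, hW, modeFun_mem_pureSymmetric hf hfc hf0,
    modeFun_ne_zero hfne, ?_, ?_, isVelocity_velocity hα₀ hα₁ (hW.1.of_le one_le) hW.2,
    linearization_modeFun hα₀ hα₁ hγ hc h0 hT hf hfc hf0 heq⟩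
  · have h1 : (-(I * n * bsConst α * c)).re = n * bsConst α * c.im := by
      simp [mul_assoc]
    rw [h1]
    have := bsConst_pos hα₀ hα₁
    have : (0 : ℝ) < n := by exact_mod_cast (by omega : 0 < n)
    positivity
  · exact isVelocity_velocity hα₀ hα₁ ((Complex.ofRealCLM.contDiff.comp hΘ.1).of_le one_le)
      (hΘ.2.comp_left (g := fun x : ℝ => (x : ℂ)) (by simp))
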